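/- Identify $S^3$ with the unit quaternions and let $\phi:S^3\times S^3\to SO(4)$, $\phi(a,b)(x)=axb^{-1}$. Orient $S^3$ so that the left-invariant framing $x\mapsto(xi,xj,xk)$ is positive. If a framing (trivialisation of the tangent bundle, compatible with the orientation) of $S^3$ is homotopic through framings to a framing $Y$ such that the matrix converting coordinates in $(xi,xj,xk)$ into coordinates in $Y(x)$ is, for every $x\in S^3$, the matrix of $v\mapsto f(x)\,v\,f(x)^{-1}$ in the basis $i,j,k$, for a continuous map $f:S^3\to S^3$ of degree $n$, assign to it the integer $n$ (so the left-invariant framing has number $0$). Let $G$ be a finite group of linear isometries of $\mathbb R^4=\mathbb H$ acting without fixed points on $S^3$, let $p:S^3\to M=S^3/G$ be the quotient covering, and orient the smooth manifold $M$ by requiring that $p$ preserve orientation. Put $\langle G\rangle=|G|$ if $H_1(M;\mathbb Z/2)=0$ and $\langle G\rangle=|G|/2$ otherwise. Say that $\mathfrak F(M)=c\in\mathbb Z/\langle G\rangle\mathbb Z$ if $M$ has a framing and, for every framing $\tau$ of $M$, there is exactly one integer assigned to $p^*\tau$, and this integer reduces to $c$ modulo $\langle G\rangle$. 1. If $G\subset\phi(S^3\times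 1)$ (left multiplications), then $\mathfrak F(M)=0$. 2. If $G\subset\phi(1\times S^3)$ (right multiplications), then $\mathfrak F(M)=1$. 3. If $G\subset\phi(S^3\times 1)$ and $|G|>2$, then no framing of $-M$ ($M$ with the opposite orientation) lifts to the left-invariant framing of $S^3$ up to homotopy. That is: for every orientation-reversing linear isometry $r$ of $\mathbb R^4$, so that $p\circ r:S^3\to -M$ is an orientation-preserving universal covering, and every framing $\tau$ of $-M$, the framing $(p\circ r)^*\tau$ is not homotopic through framings to the left-invariant framing. -/

import Mathlib

open Manifold ContDiff Metric Quaternion CategoryTheory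

noncomputable section

namespace EquivFraming

/-! ### The 3-sphere of unit quaternions and the double cover of `SO(4)` -/

instance finrank_quaternion_fact : Fact (Module.finrank ℝ ℍ[ℝ] = 3 + 1) :=
  ⟨Quaternion.finrank_eq_four⟩

/-- `S³`, the Lie group of unit quaternions, with Mathlib's smooth structure on spheres. -/
abbrev S3 : Type := sphere (0 : ℍ[ℝ]) 1

/-- The group of linear isometries of `ℍ = ℝ⁴`, that is `O(4)`. -/
abbrev O4 : Type := ℍ[ℝ] ≃ₗᵢ[ℝ] ℍ[ℝ]

/-- `O(4)` acts on the unit sphere. -/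
instance instMulActionS3 : MulAction O4 S3 where
  smul g x := ⟨g x, by simp⟩
  one_smul x := Subtype.ext rfl
  mul_smul g h x := Subtype.ext rfl

@[simp] theorem coe_smul_S3 (g : O4) (x : S3) : ((g • x : S3) : ℍ[ℝ]) = g (x : ℍ[ℝ]) := rfl

instance instContinuousConstSMulS3 : ContinuousConstSMul O4 S3 where
  continuous_const_smul g :=
    Continuous.subtype_mk (g.continuous.comp continuous_subtype_val) _

instance instContinuousConstSMulSubgroup (G : Subgroup O4) : ContinuousConstSMul G S3 where
  continuous_const_smul g := continuous_const_smul (g : O4)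

theorem contMDiff_smul_S3 (g : O4) : ContMDiff (𝓡 3) (𝓡 3) ∞ (fun x : S3 => g • x) := by
  have h : ContMDiff (𝓡 3) 𝓘(ℝ, ℍ[ℝ]) ∞ (fun x : S3 => g (x : ℍ[ℝ])) :=
    g.toContinuousLinearEquiv.contDiff.contMDiff.comp contMDiff_coe_sphere
  exact ContMDiff.codRestrict_sphere h (fun x => (g • x).2)

/-- The homomorphism `φ : S³ × S³ → SO(4)`, `φ(a, b) x = a x b⁻¹` (with kernel `±(1, 1)`). -/
def phi : S3 × S3 →* O4 where
  toFun ab :=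
    { toFun := fun x => (ab.1 : ℍ[ℝ]) * x * ((ab.2⁻¹ : S3) : ℍ[ℝ])
      invFun := fun x => ((ab.1⁻¹ : S3) : ℍ[ℝ]) * x * (ab.2 : ℍ[ℝ])
      map_add' := fun x y => by rw [mul_add, add_mul]
      map_smul' := fun c x => by simp
      left_inv := fun x => by
        have h1 : ((ab.1⁻¹ : S3) : ℍ[ℝ]) * (ab.1 : ℍ[ℝ]) = 1 := by
          rw [← Metric.unitSphere.coe_mul]; simp
        have h2 : ((ab.2⁻¹ : S3) : ℍ[ℝ]) * (ab.2 : ℍ[ℝ]) = 1 := by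
          rw [← Metric.unitSphere.coe_mul]; simp
        simp only [mul_assoc, h2, mul_one]
        rw [← mul_assoc, h1, one_mul]
      right_inv := fun x => by
        have h1 : (ab.1 : ℍ[ℝ]) * ((ab.1⁻¹ : S3) : ℍ[ℝ]) = 1 := by
          rw [← Metric.unitSphere.coe_mul]; simp
        have h2 : (ab.2 : ℍ[ℝ]) * ((ab.2⁻¹ : S3) : ℍ[ℝ]) = 1 := by
          rw [← Metric.unitSphere.coe_mul]; simp
        simp only [mul_assoc, h2, mul_one]
        rw [← mul_assoc, h1, one_mul]
      norm_map' := fun x => by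
        change ‖(ab.1 : ℍ[ℝ]) * x * ((ab.2⁻¹ : S3) : ℍ[ℝ])‖ = ‖x‖
        rw [norm_mul, norm_mul, norm_eq_of_mem_sphere, norm_eq_of_mem_sphere, one_mul, mul_one] }
  map_one' := by
    ext1 x
    change ((1 : S3) : ℍ[ℝ]) * x * (((1 : S3)⁻¹ : S3) : ℍ[ℝ]) = x
    simp
  map_mul' a b := by
    ext1 x
    change ((a.1 * b.1 : S3) : ℍ[ℝ]) * x * (((a.2 * b.2)⁻¹ : S3) : ℍ[ℝ])
      = (a.1 : ℍ[ℝ]) * ((b.1 : ℍ[ℝ]) * x * ((b.2⁻¹ : S3) : ℍ[ℝ])) * ((a.2⁻¹ : S3) : ℍ[ℝ])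
    rw [mul_inv_rev, Metric.unitSphere.coe_mul, Metric.unitSphere.coe_mul]
    simp only [mul_assoc]

@[simp] theorem phi_apply (a b : S3) (x : ℍ[ℝ]) :
    phi (a, b) x = (a : ℍ[ℝ]) * x * ((b⁻¹ : S3) : ℍ[ℝ]) := rfl

/-- `φ(S³ × 1)`: left multiplications by unit quaternions. -/
def leftMultiplications : Subgroup O4 := ((⊤ : Subgroup S3).prod (⊥ : Subgroup S3)).map phi

/-- `φ(1 × S³)`: right multiplications by unit quaternions. -/
def rightMultiplications : Subgroup O4 := ((⊥ : Subgroup S3).prod (⊤ : Subgroup S3)).map phi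

/-! ### The quotient manifold -/

section Quotient

variable (G : Subgroup O4) [Finite G] [IsCancelSMul G S3]

/-- The manifold `M = S³/G`, for a finite group `G` of isometries acting freely. Its topology and
charts are those that Mathlib gives to a quotient by a free, properly discontinuous action. -/
abbrev Quot3 : Type := MulAction.orbitRel.Quotient G S3

/-- The universal covering map `S³ → S³/G`. -/
def proj : S3 → Quot3 G := Quotient.mk (MulAction.orbitRel G S3)

/-- `S³/G` is a smooth manifold. -/
instance instIsManifoldQuot3 : IsManifold (𝓡 3) ∞ (Quot3 G) := by
  have hq : IsQuotientCoveringMap (Quotient.mk (MulAction.orbitRel G S3)) G :=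
    isQuotientCoveringMap_quotientMk_of_properlyDiscontinuousSMul
  have hf := hq.isCoveringMap.isLocalHomeomorph
  apply isManifold_of_contDiffOn
  rintro e e' ⟨qa, rfl⟩ ⟨qb, rfl⟩
  generalize Quotient.mk_surjective.hasRightInverse.choose qa = a
  generalize Quotient.mk_surjective.hasRightInverse.choose qb = b
  intro u hu
  apply ContDiffAt.contDiffWithinAt
  have hu := hu.1
  simp only [modelWithCornersSelf_coe_symm, Set.preimage_id, OpenPartialHomeomorph.trans_source,
    OpenPartialHomeomorph.symm_source, OpenPartialHomeomorph.trans_target,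
    OpenPartialHomeomorph.coe_trans_symm, Set.mem_inter_iff, Set.mem_preimage,
    Function.comp_apply, IsLocalHomeomorph.localInverseAt_symm] at hu
  obtain ⟨⟨hu1, hu2⟩, hu3, hu4⟩ := hu
  set ca := chartAt (EuclideanSpace ℝ (Fin 3)) a with hca
  set cb := chartAt (EuclideanSpace ℝ (Fin 3)) b with hcb
  set lb := hf.localInverseAt b with hlb
  have hlbs : ⇑lb.symm = Quotient.mk (MulAction.orbitRel G S3) := hf.localInverseAt_symm b
  set x : S3 := ca.symm u with hx
  obtain ⟨g, hg⟩ : ∃ g : G, g • x = lb (Quotient.mk _ x) := by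
    have h1 : (Quotient.mk (MulAction.orbitRel G S3)) (lb (Quotient.mk _ x)) = Quotient.mk _ x := by
      have h0 := lb.left_inv hu3
      rwa [hlbs] at h0
    exact hq.apply_eq_iff_mem_orbit.mp h1
  have hgx : g • x ∈ lb.target := by rw [hg]; exact lb.map_source hu3
  have hev : ∀ᶠ y in nhds x, lb (Quotient.mk _ y) = g • y := by
    have hcont : Continuous (fun y : S3 => g • y) := continuous_const_smul g
    filter_upwards [hcont.continuousAt.preimage_mem_nhds (lb.open_target.mem_nhds hgx)] with y hy
    have h2 : lb.symm (g • y) = Quotient.mk _ y := by rw [hlbs]; exact hq.map_smul g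
    rw [← h2]; exact lb.right_inv hy
  have hcs : ContMDiffAt (𝓡 3) (𝓡 3) ∞ ca.symm u :=
    contMDiffOn_chart_symm.contMDiffAt (ca.open_target.mem_nhds hu1)
  have hsm : ContMDiffAt (𝓡 3) (𝓡 3) ∞ (fun y : S3 => g • y) x :=
    (contMDiff_smul_S3 (g : O4)).contMDiffAt
  have hcb' : ContMDiffAt (𝓡 3) (𝓡 3) ∞ cb (g • x) := by
    refine contMDiffOn_chart.contMDiffAt (cb.open_source.mem_nhds ?_)
    rw [hg]; exact hu4
  have hcomp : ContMDiffAt (𝓡 3) (𝓡 3) ∞ (fun v => cb (g • ca.symm v)) u :=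
    ContMDiffAt.comp u (g := fun y : S3 => cb (g • y))
      (ContMDiffAt.comp x (g := cb) hcb' hsm) hcs
  have hcd := contMDiffAt_iff_contDiffAt.mp hcomp
  refine hcd.congr_of_eventuallyEq ?_
  have hca' : ContinuousAt ca.symm u := ca.continuousAt_symm hu1
  filter_upwards [hca'.eventually hev] with v hv
  rw [← hv]
  simp only [Function.comp_apply, modelWithCornersSelf_coe, modelWithCornersSelf_coe_symm, id,
    OpenPartialHomeomorph.coe_trans, OpenPartialHomeomorph.coe_trans_symm,
    IsLocalHomeomorph.localInverseAt_symm]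

end Quotient
/-! ### The degree of a self-map of `S³` -/

open Classical in
/-- The extension of `f : S³ → S³` to `ℍ`, homogeneous of degree one. -/
def radialExtension (f : S3 → S3) (v : ℍ[ℝ]) : ℍ[ℝ] :=
  if h : v = 0 then 0
  else ‖v‖ • (f ⟨‖v‖⁻¹ • v, by simp [norm_smul, norm_ne_zero_iff.mpr h]⟩ : ℍ[ℝ])

/-- The Jacobian determinant of `f : S³ → S³` at `x`, with respect to the orientation of `S³` in
source and target. In the splittings `ℍ = ℝx ⊕ T_x S³` and `ℍ = ℝf(x) ⊕ T_{f(x)} S³` the derivative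
of the radial extension is `1 ⊕ df_x`, so its determinant is that of `df_x` in oriented orthonormal
bases. -/
def jacobianDet (f : S3 → S3) (x : S3) : ℝ :=
  LinearMap.det (fderiv ℝ (radialExtension f) (x : ℍ[ℝ]) : ℍ[ℝ] →ₗ[ℝ] ℍ[ℝ])

/-- The continuous map `f : S³ → S³` has degree `n`: some smooth map `g` homotopic to `f` has a
regular value `y` whose preimages, counted with the sign of the Jacobian determinant, add up
to `n`. -/
def HasDegree (f : C(S3, S3)) (n : ℤ) : Prop :=
  ∃ g : C(S3, S3), f.Homotopic g ∧ ContMDiff (𝓡 3) (𝓡 3) ∞ g ∧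
    ∃ (y : S3) (s : Finset S3), (∀ x, x ∈ s ↔ g x = y) ∧ (∀ x ∈ s, jacobianDet g x ≠ 0) ∧
      n = ∑ x ∈ s, (SignType.sign (jacobianDet g x) : ℤ)

/-! ### Framings -/

section Framings

variable {M : Type} [TopologicalSpace M] [ChartedSpace (EuclideanSpace ℝ (Fin 3)) M]

/-- An ordered triple of vector fields on a `3`-manifold. -/
abbrev FieldTriple (M : Type) [TopologicalSpace M] [ChartedSpace (EuclideanSpace ℝ (Fin 3)) M] :
    Type :=
  Fin 3 → (m : M) → TangentSpace (𝓡 3) m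

/-- A framing, i.e. a trivialisation of the tangent bundle: three continuous sections of `TM` that
are linearly independent at every point. -/
structure IsFraming [IsManifold (𝓡 3) ∞ M] (X : FieldTriple M) : Prop where
  continuous : ∀ a, Continuous (fun m => (⟨m, X a m⟩ : TangentBundle (𝓡 3) M))
  linearIndependent : ∀ m, LinearIndependent ℝ (fun a => X a m)

/-- Two framings are homotopic (isotopic) if a continuous path of framings joins them. -/
def FramingHomotopic [IsManifold (𝓡 3) ∞ M] (X Y : FieldTriple M) : Prop :=
  ∃ H : unitInterval → FieldTriple M, H 0 = X ∧ H 1 = Y ∧ (∀ t, IsFraming (H t)) ∧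
    ∀ a, Continuous (fun p : unitInterval × M => (⟨p.2, H p.1 a p.2⟩ : TangentBundle (𝓡 3) M))

/-- The pullback of a triple of vector fields under a local diffeomorphism `q : S³ → M`: its value
at `x` is the image of `(X₁, X₂, X₃)` at `q x` under the inverse of `dq_x`. -/
def pullback (q : S3 → M) (X : FieldTriple M) : FieldTriple S3 :=
  fun a => VectorField.mpullback (𝓡 3) (𝓡 3) q (X a)

end Framings

/-- The imaginary units `i, j, k`. -/
def imUnit : Fin 3 → ℍ[ℝ] := ![⟨0, 1, 0, 0⟩, ⟨0, 0, 1, 0⟩, ⟨0, 0, 0, 1⟩]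

theorem exists_leftFrame (a : Fin 3) (x : S3) :
    ∃ v : TangentSpace (𝓡 3) x,
      mvfderiv (𝓡 3) ((↑) : S3 → ℍ[ℝ]) x v = (x : ℍ[ℝ]) * imUnit a := by
  have h : (x : ℍ[ℝ]) * imUnit a ∈ (mvfderiv (𝓡 3) ((↑) : S3 → ℍ[ℝ]) x).range := by
    rw [range_mvfderiv_subtypeVal, Submodule.mem_orthogonal_singleton_iff_inner_right,
      Quaternion.inner_def]
    have h0 : (imUnit a).re = 0 := by fin_cases a <;> rfl
    generalize imUnit a = e at h0
    rw [Quaternion.re_mul, Quaternion.re_star, Quaternion.imI_star, Quaternion.imJ_star,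
      Quaternion.imK_star, Quaternion.re_mul, Quaternion.imI_mul, Quaternion.imJ_mul,
      Quaternion.imK_mul, h0]
    ring
  exact h

/-- The left-invariant framing of `S³`: at `x` it is `(xi, xj, xk)`, viewed in `T_x S³ ⊂ ℍ`. -/
def leftFrame : FieldTriple S3 := fun a x => (exists_leftFrame a x).choose

theorem leftFrame_spec (a : Fin 3) (x : S3) :
    mvfderiv (𝓡 3) ((↑) : S3 → ℍ[ℝ]) x (leftFrame a x) = (x : ℍ[ℝ]) * imUnit a :=
  (exists_leftFrame a x).choose_spec

/-- `P` is the transition matrix at `x` from the left-invariant framing to `X`, the matrix that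
turns coordinates with respect to `(xi, xj, xk)` into coordinates with respect to `X`. -/
def IsTransition (X : FieldTriple S3) (x : S3) (P : Matrix (Fin 3) (Fin 3) ℝ) : Prop :=
  ∀ b, leftFrame b x = ∑ a, P a b • X a x

/-- `X` is compatible with the orientation of `S³`, for which the left-invariant framing is
positive. -/
def IsPositive (X : FieldTriple S3) : Prop :=
  ∀ x, ∃ P : Matrix (Fin 3) (Fin 3) ℝ, IsTransition X x P ∧ 0 < P.det

/-- The double cover `S³ → SO(3)`: the matrix of `v ↦ q v q⁻¹` in the basis `i, j, k`. -/
def adMatrix (q : S3) : Matrix (Fin 3) (Fin 3) ℝ :=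
  Matrix.of fun a b => inner ℝ (imUnit a) ((q : ℍ[ℝ]) * imUnit b * ((q⁻¹ : S3) : ℍ[ℝ]))

/-- The homotopy class of the framing `X` of `S³` corresponds to the integer `n`: up to homotopy of
framings, the transition map from the left-invariant framing to `X` takes values in `SO(3)`, and it
has a lift `f : S³ → S³` (the comparison map) of degree `n`. -/
def HasFramingNumber (X : FieldTriple S3) (n : ℤ) : Prop :=
  ∃ Y : FieldTriple S3, FramingHomotopic X Y ∧
    ∃ f : C(S3, S3), (∀ x, IsTransition Y x (adMatrix (f x))) ∧ HasDegree f n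

section Invariant

variable {M : Type} [TopologicalSpace M] [ChartedSpace (EuclideanSpace ℝ (Fin 3)) M]
  [IsManifold (𝓡 3) ∞ M]

/-- `X` is a framing of `M`, oriented so that the covering `q : S³ → M` preserves orientation. -/
def IsOrientedFraming (q : S3 → M) (X : FieldTriple M) : Prop :=
  IsFraming X ∧ IsPositive (pullback q X)

/-- The equivariant framing, in `ℤ/k`, of the manifold `M`, oriented by its universal covering
`q : S³ → M`, is well defined and equal to `c`: there are framings of `M`, and for each of them the
pullback to `S³` corresponds to exactly one integer, which reduces to `c`. -/
def EquivariantFramingEq (q : S3 → M) (k : ℕ) (c : ZMod k) : Prop :=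
  (∃ X, IsOrientedFraming q X) ∧
    ∀ X, IsOrientedFraming q X →
      ∃ n : ℤ, (∀ m, HasFramingNumber (pullback q X) m ↔ m = n) ∧ (n : ZMod k) = c

end Invariant

/-- The singular homology group `H₁(X; ℤ/2)`. -/
def H1Mod2 (X : Type) [TopologicalSpace X] : ModuleCat.{0} (ZMod 2) :=
  ((AlgebraicTopology.singularHomologyFunctor (ModuleCat.{0} (ZMod 2)) 1).obj
    (ModuleCat.of (ZMod 2) (ZMod 2))).obj (TopCat.of X)

open Classical in
/-- The modulus `⟨G⟩`: it is `|G|` if `H₁(S³/G; ℤ/2) = 0` and `|G|/2` otherwise. -/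
def framingModulus (G : Subgroup O4) : ℕ :=
  if Limits.IsZero (H1Mod2 (MulAction.orbitRel.Quotient G S3)) then Nat.card G else Nat.card G / 2

end EquivFraming

end

/-!
Framings of `S³` are compared with the left-invariant framing `(xi, xj, xk)` through their transition
maps `P : S³ → GL₃⁺(ℝ)`. The Gram–Schmidt process deforms `P` into a map to `SO(3)`, which lifts along
the double cover `adMatrix : S³ → SO(3)` because `S³` is simply connected, and the number of the
framing is the degree of the lift. It exists, and it is unique since two lifts differ by a sign and the
degree is a homotopy invariant.

Let the framing be pulled back from `M = S³/G`. Left multiplications preserve the left-invariant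
framing, so for `G` acting on the left `P` is `G`-invariant. Right multiplication by `h⁻¹` multiplies
`P` by `adMatrix h⁻¹`, so for `G` acting on the right `P(x) adMatrix(x)⁻¹` is `G`-invariant. In both
cases the orthonormalisation of the invariant map lifts to a map `q : S³ → S³` that is invariant up to
a sign character `ε : G → {±1}`, and `q` itself is invariant under `ker ε`. Since `ker ε` acts freely
by rotations, the order of `ker ε` divides the degree of `q` (`HasDegree.card_dvd`). The number of the
framing is the degree of `q` in the first case and of `x ↦ q(x) x` in the second, and degrees add
under pointwise multiplication (`HasDegree.mul`). So the number is congruent to `0`, respectively `1`,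
modulo the order of `ker ε` (`exists_framingNumber`).

If `H₁(M; ℤ/2) = 0`, then `ε` is trivial, because a sign character defines a singular cocycle
(`sign_character_trivial`). If `H₁(M; ℤ/2) ≠ 0`, then `|G|` is even by a transfer argument
(`isZero_H1Mod2_of_odd`), and `|ker ε|` is `|G|` or `|G|/2`. In either case `⟨G⟩` divides `|ker ε|`.
Framings of `M` exist because the left-invariant framing, respectively the right-invariant one,
descends. An orientation-reversing isometry conjugates left multiplications into right ones, so the
number of a framing of `-M` is congruent to `1` modulo `|ker ε|`, and it is not `0` once `|G| > 2`.

The degree is handled analytically. For a smooth `g : S³ → S³` with radial extension `F : ℍ → ℍ` and a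
bump function `φ` near a regular value, the integral of `φ(F) det DF` is the signed number of preimages
times the integral of `φ` (`exists_degreeIntegral_eq`). It is invariant under homotopy because the
time derivative of the integrand is a divergence (`sum_fderiv_fluxComponent`).
-/

noncomputable section

namespace EquivFraming

open MeasureTheory Module Topology
open scoped Matrix

/-! ### Homotopy invariance of degree integrals -/

section

theorem one_add_one_le_infty : (1 : WithTop ℕ∞) + 1 ≤ ∞ := by
  rw [one_add_one_eq_two]
  exact WithTop.coe_le_coe.2 (le_top : (2 : ℕ∞) ≤ ⊤)

variable {E : Type*} [NormedAddCommGroup E] [NormedSpace ℝ E] {ι : Type*} [Fintype ι]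
  [DecidableEq ι]

/-- Cramer's rule for a family of vectors. -/
theorem sum_det_update_smul (b : Basis ι ℝ E) (v : ι → E) (w : E) :
    ∑ i, b.det (Function.update v i w) • v i = b.det v • w := by
  apply b.equivFun.injective
  ext k
  have h := congrFun (Matrix.mulVec_cramer (b.toMatrix v) (b.repr w)) k
  simp only [Matrix.mulVec, dotProduct, Matrix.cramer_apply, Pi.smul_apply, smul_eq_mul] at h
  simp only [map_sum, map_smul, Finset.sum_apply, Pi.smul_apply, smul_eq_mul, Basis.equivFun_apply]
  rw [Basis.det_apply, ← h]
  refine Finset.sum_congr rfl fun i _ => ?_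
  rw [Basis.det_apply, Basis.toMatrix_update, mul_comm]
  rfl

/-- The terms for `(i, j)` and `(j, i)` cancel: they differ by a transposition of two arguments. -/
theorem sum_alternating_update_update_eq_zero (D : E [⋀^ι]→L[ℝ] ℝ) (v : ι → E) (w : E)
    (S : ι → ι → E) (hS : ∀ i j, S i j = S j i) :
    ∑ i, ∑ j ∈ Finset.univ.erase i,
      D (Function.update (Function.update v i w) j (S i j)) = 0 := by
  have key : ∀ i j, i ≠ j → D (Function.update (Function.update v i w) j (S i j)) =
      - D (Function.update (Function.update v j w) i (S j i)) := by
    intro i j hij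
    refine Eq.trans ?_ (D.toAlternatingMap.map_swap _ hij)
    change D _ = D _
    congr 1
    ext k
    rcases eq_or_ne k i with rfl | hki
    · simp [hij, hij.symm]
    rcases eq_or_ne k j with rfl | hkj
    · simp [hS i k]
    · simp [Function.comp, Equiv.swap_apply_of_ne_of_ne, *]
  have h1 : ∀ i, ∑ j ∈ Finset.univ.erase i,
      D (Function.update (Function.update v i w) j (S i j)) =
      ∑ j, if i = j then 0 else D (Function.update (Function.update v i w) j (S i j)) := by
    intro i
    rw [← Finset.sum_filter_add_sum_filter_not Finset.univ (fun j => i = j)]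
    rw [Finset.sum_eq_zero (s := Finset.filter (fun j => i = j) _), zero_add]
    · refine Finset.sum_congr ?_ ?_
      · ext j; simp [eq_comm]
      · intro j hj; simp at hj; rw [if_neg hj]
    · intro j hj; simp at hj; simp [hj]
  simp_rw [h1]
  set T : ι → ι → ℝ := fun i j => if i = j then 0 else
    D (Function.update (Function.update v i w) j (S i j)) with hT
  have hTa : ∀ i j, T i j = - T j i := by
    intro i j
    by_cases h : i = j
    · subst h; simp [hT]
    · simp only [hT, if_neg h, if_neg (Ne.symm h)]; exact key i j h
  change ∑ i, ∑ j, T i j = 0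
  have : ∑ i, ∑ j, T i j = - ∑ i, ∑ j, T i j := by
    conv_lhs => rw [Finset.sum_comm]
    rw [← Finset.sum_neg_distrib]
    refine Finset.sum_congr rfl fun i _ => ?_
    rw [← Finset.sum_neg_distrib]
    exact Finset.sum_congr rfl fun j _ => hTa j i
  linarith

/-- The determinant with respect to a basis, as a continuous alternating map. -/
def detCAM (b : Basis ι ℝ E) : E [⋀^ι]→L[ℝ] ℝ :=
  { b.det with
    cont := by
      have : FiniteDimensional ℝ E := b.finiteDimensional_of_finite
      change Continuous fun v : ι → E => b.det v
      simp only [Basis.det_apply]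
      refine Continuous.matrix_det ?_
      refine continuous_matrix fun i j => ?_
      have : Continuous (b.coord i) := LinearMap.continuous_of_finiteDimensional _
      exact this.comp (continuous_apply j) }

theorem detCAM_apply (b : Basis ι ℝ E) (v : ι → E) : detCAM b v = b.det v := rfl

theorem detCAM_clm (b : Basis ι ℝ E) (A : E →L[ℝ] E) :
    detCAM b (fun i => A (b i)) = LinearMap.det (A : E →ₗ[ℝ] E) := by
  rw [detCAM_apply]
  have := b.det_comp (A : E →ₗ[ℝ] E) b
  rw [b.det_self, mul_one] at this
  exact this

/-- The `i`-th component of the vector field whose divergence is the time derivative of the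
integrand `φ(G) det DG` when `G` moves with velocity `W`. -/
def fluxComponent (b : Basis ι ℝ E) (φ : E → ℝ) (G W : E → E) (i : ι) (v : E) : ℝ :=
  φ (G v) * detCAM b (Function.update (fun j => fderiv ℝ G v (b j)) i (W v))

/-- The time derivative of `φ(G) det DG` when `G` moves with velocity `W`. -/
def fluxDensity (b : Basis ι ℝ E) (φ : E → ℝ) (G W : E → E) (v : E) : ℝ :=
  fderiv ℝ φ (G v) (W v) * detCAM b (fun j => fderiv ℝ G v (b j)) +
    φ (G v) * ∑ i, detCAM b (Function.update (fun j => fderiv ℝ G v (b j)) i (fderiv ℝ W v (b i)))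

variable (b : Basis ι ℝ E) {φ : E → ℝ} {G W : E → E}

theorem contDiff_fluxComponent (hφ : ContDiff ℝ ∞ φ) (hG : ContDiff ℝ ∞ G) (hW : ContDiff ℝ ∞ W)
    (i : ι) : ContDiff ℝ 1 (fluxComponent b φ G W i) := by
  have hG' : ContDiff ℝ 1 (fderiv ℝ G) := hG.fderiv_right one_add_one_le_infty
  refine ContDiff.mul ((hφ.comp hG).of_le (by simp)) ?_
  refine (detCAM b).contDiff.comp ?_
  refine contDiff_pi.2 fun j => ?_
  by_cases h : j = i
  · subst h; simpa using hW.of_le (by simp)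
  · simpa [h] using hG'.clm_apply contDiff_const

/-- Conservation law behind the homotopy invariance of the degree: the time derivative of
`φ(G) det DG` is a divergence. Second derivatives of `G` cancel in pairs because they are symmetric
while the determinant is alternating. -/
theorem sum_fderiv_fluxComponent (hφ : ContDiff ℝ ∞ φ) (hG : ContDiff ℝ ∞ G)
    (hW : ContDiff ℝ ∞ W) (v : E) :
    ∑ i, fderiv ℝ (fluxComponent b φ G W i) v (b i) = fluxDensity b φ G W v := by
  have hG' : ContDiff ℝ 1 (fderiv ℝ G) := hG.fderiv_right one_add_one_le_infty
  set S : ι → ι → E := fun i j => fderiv ℝ (fderiv ℝ G) v (b i) (b j) with hS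
  have hsym : ∀ i j, S i j = S j i := fun i j =>
    (hG.contDiffAt.isSymmSndFDerivAt (by simp; norm_cast)) (b i) (b j)
  have key : ∀ i, fderiv ℝ (fluxComponent b φ G W i) v (b i) =
      fderiv ℝ φ (G v) (fderiv ℝ G v (b i)) *
        detCAM b (Function.update (fun j => fderiv ℝ G v (b j)) i (W v)) +
      φ (G v) * (detCAM b (Function.update (fun j => fderiv ℝ G v (b j)) i (fderiv ℝ W v (b i))) +
        ∑ j ∈ Finset.univ.erase i, detCAM b
          (Function.update (Function.update (fun j => fderiv ℝ G v (b j)) i (W v)) j (S i j))) := by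
    intro i
    have h1 : HasFDerivAt (fun v => φ (G v)) ((fderiv ℝ φ (G v)).comp (fderiv ℝ G v)) v :=
      ((hφ.differentiable (by simp)) (G v)).hasFDerivAt.comp v
        ((hG.differentiable (by simp)) v).hasFDerivAt
    set L : ∀ j : ι, E →L[ℝ] E := fun j => if j = i then fderiv ℝ W v else
      (fderiv ℝ (fderiv ℝ G) v).flip (b j) with hL
    have h2 : HasFDerivAt (fun v => Function.update (fun j => fderiv ℝ G v (b j)) i (W v))
        (ContinuousLinearMap.pi L) v := by
      refine hasFDerivAt_pi.2 fun j => ?_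
      by_cases h : j = i
      · subst h
        simpa [hL] using ((hW.differentiable (by simp)) v).hasFDerivAt
      · simp only [Function.update_of_ne h, hL, if_neg h]
        have := ((hG'.differentiable (by simp)) v).hasFDerivAt.clm_apply
          (hasFDerivAt_const (b j) v)
        simpa using this
    have h3 := h1.mul (((detCAM b).hasFDerivAt _).comp v h2)
    have h4 : fderiv ℝ (fluxComponent b φ G W i) v = _ := h3.fderiv
    rw [h4]
    simp only [add_apply, smul_apply,
      ContinuousLinearMap.comp_apply, smul_eq_mul, ContinuousMultilinearMap.linearDeriv_apply,
      ContinuousLinearMap.pi_apply]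
    rw [add_comm, ← Finset.add_sum_erase _ _ (Finset.mem_univ i)]
    congr 1
    · rw [mul_comm]; rfl
    · congr 2
      · simp [hL]
      · refine Finset.sum_congr rfl fun j hj => ?_
        have hj : j ≠ i := (Finset.mem_erase.1 hj).1
        simp [hL, hj, hS]
  simp_rw [key, Finset.sum_add_distrib, mul_add, Finset.sum_add_distrib, ← Finset.mul_sum]
  rw [sum_alternating_update_update_eq_zero _ _ _ _ hsym, mul_zero, add_zero, fluxDensity]
  congr 1
  have h := congrArg (fderiv ℝ φ (G v)) (sum_det_update_smul b (fun j => fderiv ℝ G v (b j)) (W v))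
  simp only [map_sum, map_smul, smul_eq_mul] at h
  rw [mul_comm, detCAM_apply, ← h]
  exact Finset.sum_congr rfl fun i _ => mul_comm _ _

/-- Along the straight-line homotopy `G + t W`, the integrand `φ(G) det DG` has time derivative
`fluxDensity`. -/
theorem hasDerivAt_mul_det (hφ : ContDiff ℝ ∞ φ) (hG : ContDiff ℝ ∞ G)
    (hW : ContDiff ℝ ∞ W) (v : E) (t : ℝ) :
    HasDerivAt (fun t : ℝ => φ (G v + t • W v) *
        detCAM b (fun j => fderiv ℝ (fun v => G v + t • W v) v (b j)))
      (fluxDensity b φ (fun v => G v + t • W v) W v) t := by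
  have hd : ∀ t : ℝ, fderiv ℝ (fun v => G v + t • W v) v = fderiv ℝ G v + t • fderiv ℝ W v := by
    intro t
    exact (((hG.differentiable (by simp)) v).hasFDerivAt.add
      (((hW.differentiable (by simp)) v).hasFDerivAt.const_smul t)).fderiv
  have h1 : HasDerivAt (fun t : ℝ => G v + t • W v) (W v) t := by
    simpa using ((hasDerivAt_id t).smul_const (W v)).const_add (G v)
  have h2 : HasDerivAt (fun t : ℝ => φ (G v + t • W v)) (fderiv ℝ φ (G v + t • W v) (W v)) t :=
    ((hφ.differentiable (by simp)) _).hasFDerivAt.comp_hasDerivAt t h1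
  have h3 : HasDerivAt (fun t : ℝ => (fun j => (fderiv ℝ G v + t • fderiv ℝ W v) (b j)))
      (fun j => fderiv ℝ W v (b j)) t := by
    refine hasDerivAt_pi.2 fun j => ?_
    simpa using ((hasDerivAt_id t).smul_const (fderiv ℝ W v (b j))).const_add (fderiv ℝ G v (b j))
  have h4 := h2.mul (((detCAM b).hasFDerivAt _).comp_hasDerivAt t h3)
  simp only [fluxDensity, hd]
  refine HasDerivAt.congr_deriv (f := fun t : ℝ => φ (G v + t • W v) *
    detCAM b (fun j => (fderiv ℝ G v + t • fderiv ℝ W v) (b j))) h4 ?_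
  congr 2
  exact ContinuousMultilinearMap.linearDeriv_apply _ _ _

theorem continuous_fluxDensity (hφ : ContDiff ℝ ∞ φ) (hG : ContDiff ℝ ∞ G)
    (hW : ContDiff ℝ ∞ W) :
    Continuous (fun p : ℝ × E => fluxDensity b φ (fun v => G v + p.1 • W v) W p.2) := by
  have hd : ∀ (t : ℝ) v, fderiv ℝ (fun v => G v + t • W v) v = fderiv ℝ G v + t • fderiv ℝ W v := by
    intro t v
    exact (((hG.differentiable (by simp)) v).hasFDerivAt.add
      (((hW.differentiable (by simp)) v).hasFDerivAt.const_smul t)).fderiv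
  have c1 := hφ.continuous_fderiv (by simp)
  have c2 := hG.continuous_fderiv (by simp)
  have c3 := hW.continuous_fderiv (by simp)
  have c4 := hG.continuous
  have c5 := hW.continuous
  have c6 := hφ.continuous
  have c7 := (detCAM b).cont
  have c8 : Continuous (fun p : ℝ × E => fun j => (fderiv ℝ G p.2 + p.1 • fderiv ℝ W p.2) (b j)) :=
    continuous_pi fun j => by simp only [add_apply, smul_apply]; fun_prop
  simp only [fluxDensity, hd]
  refine Continuous.add (Continuous.mul ?_ (c7.comp c8)) (Continuous.mul ?_ ?_)
  · exact (c1.comp (by fun_prop)).clm_apply (by fun_prop)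
  · fun_prop
  · refine continuous_finsetSum _ fun i _ => c7.comp ?_
    exact c8.update i (by fun_prop)

/-- The divergence of a compactly supported vector field integrates to zero. -/
theorem integral_fluxDensity_eq_zero [FiniteDimensional ℝ E] [MeasurableSpace E] [BorelSpace E]
    (μ : Measure E) [μ.IsAddHaarMeasure] (hφ : ContDiff ℝ ∞ φ) (hG : ContDiff ℝ ∞ G)
    (hW : ContDiff ℝ ∞ W) {K : Set E} (hK : IsCompact K) (h0 : ∀ v ∉ K, φ (G v) = 0) :
    ∫ v, fluxDensity b φ G W v ∂μ = 0 := by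
  have hs : ∀ i, HasCompactSupport (fluxComponent b φ G W i) := fun i =>
    HasCompactSupport.intro hK fun v hv => by simp [fluxComponent, h0 v hv]
  have hc := fun i => contDiff_fluxComponent b hφ hG hW i
  have hi : ∀ i, Integrable (fun v => fderiv ℝ (fluxComponent b φ G W i) v (b i)) μ := fun i =>
    (((hc i).continuous_fderiv (by simp)).clm_apply continuous_const).integrable_of_hasCompactSupport
      ((hs i).fderiv_apply ℝ (b i))
  simp_rw [← sum_fderiv_fluxComponent b hφ hG hW]
  rw [integral_finsetSum _ fun i _ => hi i]
  refine Finset.sum_eq_zero fun i _ => ?_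
  have := integral_mul_fderiv_eq_neg_fderiv_mul_of_integrable (μ := μ) (f := fun _ : E => (1 : ℝ))
    (g := fluxComponent b φ G W i) (v := b i) (by simp) (by simpa using hi i)
    (by simpa using (hc i).continuous.integrable_of_hasCompactSupport (hs i))
    (by simp) (fun x _ => (hc i).differentiable (by simp) x)
  simpa using this

/-- The integral of `φ(G) det DG` is the same at both ends of the homotopy `G + t W` if `φ(G + t W)`
vanishes outside a fixed compact set: the time derivative of the integrand is the divergence of a
compactly supported field. -/
theorem integral_mul_det_eq_of_homotopy [FiniteDimensional ℝ E] [MeasurableSpace E] [BorelSpace E]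
    (μ : Measure E) [μ.IsAddHaarMeasure] (hφ : ContDiff ℝ ∞ φ) (hG : ContDiff ℝ ∞ G)
    (hW : ContDiff ℝ ∞ W) {K : Set E} (hK : IsCompact K)
    (h0 : ∀ t ∈ Set.Icc (0 : ℝ) 1, ∀ v ∉ K, φ (G v + t • W v) = 0) :
    ∫ v, φ (G v + W v) * LinearMap.det (fderiv ℝ (fun v => G v + W v) v : E →ₗ[ℝ] E) ∂μ =
      ∫ v, φ (G v) * LinearMap.det (fderiv ℝ G v : E →ₗ[ℝ] E) ∂μ := by
  have hb : Nonempty (Basis (Fin (finrank ℝ E)) ℝ E) := ⟨Module.finBasis ℝ E⟩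
  obtain ⟨b⟩ := hb
  set F : ℝ → E → ℝ := fun t v => φ (G v + t • W v) *
        detCAM b (fun j => fderiv ℝ (fun v => G v + t • W v) v (b j)) with hF
  set Z : ℝ → E → ℝ := fun t v => fluxDensity b φ (fun v => G v + t • W v) W v with hZ
  have hGt : ∀ t : ℝ, ContDiff ℝ ∞ (fun v => G v + t • W v) := fun t =>
    hG.add (contDiff_const.smul hW)
  have hZc : Continuous (Function.uncurry Z) := continuous_fluxDensity b hφ hG hW
  have hFc : ∀ t, Continuous (F t) := by
    intro t
    refine ((hφ.continuous.comp (hGt t).continuous)).mul ((detCAM b).cont.comp ?_)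
    exact continuous_pi fun j => ((hGt t).continuous_fderiv (by simp)).clm_apply continuous_const
  have hZ0 : ∀ t ∈ Set.Icc (0 : ℝ) 1, ∀ v ∉ K, Z t v = 0 := by
    intro t ht v hv
    have hx : ∀ i, fderiv ℝ (fluxComponent b φ (fun v => G v + t • W v) W i) v = 0 := by
      intro i
      have : fluxComponent b φ (fun v => G v + t • W v) W i =ᶠ[𝓝 v] fun _ => 0 := by
        filter_upwards [hK.isClosed.isOpen_compl.mem_nhds hv] with u hu
        simp [fluxComponent, h0 t ht u hu]
      rw [this.fderiv_eq]; simp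
    simp only [hZ]
    rw [← sum_fderiv_fluxComponent b hφ (hGt t) hW]
    simp [hx]
  have hFi : ∀ t ∈ Set.Icc (0 : ℝ) 1, Integrable (F t) μ := fun t ht =>
    (hFc t).integrable_of_hasCompactSupport
      (HasCompactSupport.intro hK fun v hv => by simp [hF, h0 t ht v hv])
  have hint : ∀ v, ∫ t in (0 : ℝ)..1, Z t v = F 1 v - F 0 v := by
    intro v
    refine intervalIntegral.integral_eq_sub_of_hasDerivAt (f := fun t => F t v)
      (fun t _ => hasDerivAt_mul_det b hφ hG hW v t) ?_
    exact (hZc.comp (by fun_prop : Continuous fun t : ℝ => (t, v))).intervalIntegrable _ _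
  -- Fubini: the total change is the time integral of the space integrals of `Z`, which vanish.
  have hsw : ∫ t in (0 : ℝ)..1, ∫ v, Z t v ∂μ = ∫ v, (∫ t in (0 : ℝ)..1, Z t v) ∂μ := by
    refine intervalIntegral_integral_swap ?_
    have h1 : IntegrableOn (Function.uncurry Z) (Set.Icc (0 : ℝ) 1 ×ˢ K)
        ((volume : Measure ℝ).prod μ) :=
      hZc.continuousOn.integrableOn_compact (isCompact_Icc.prod hK)
    have h2 : IntegrableOn (Function.uncurry Z) (Set.Icc (0 : ℝ) 1 ×ˢ Set.univ)
        ((volume : Measure ℝ).prod μ) := by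
      refine h1.of_forall_sdiff_eq_zero (measurableSet_Icc.prod MeasurableSet.univ) ?_
      rintro ⟨t, v⟩ ⟨⟨ht, _⟩, hn⟩
      exact hZ0 t ht v fun hv => hn ⟨ht, hv⟩
    have h3 := h2.mono_set (s := Set.uIoc (0 : ℝ) 1 ×ˢ Set.univ) (by
      rw [Set.uIoc_of_le zero_le_one]; exact Set.prod_mono Set.Ioc_subset_Icc_self le_rfl)
    rw [IntegrableOn, ← Measure.prod_restrict, Measure.restrict_univ] at h3
    exact h3
  have hzero : ∫ t in (0 : ℝ)..1, ∫ v, Z t v ∂μ = 0 := by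
    rw [intervalIntegral.integral_congr (g := fun _ => (0 : ℝ))]
    · simp
    · intro t ht
      rw [Set.uIcc_of_le zero_le_one] at ht
      exact integral_fluxDensity_eq_zero b μ hφ (hGt t) hW hK (h0 t ht)
  rw [hzero] at hsw
  simp_rw [hint] at hsw
  rw [integral_sub (hFi 1 (by simp)) (hFi 0 (by simp))] at hsw
  have h5 := sub_eq_zero.1 hsw.symm
  simpa [hF, detCAM_clm] using h5

end

/-! ### Integrals that count preimages -/

section

variable {E : Type*} [NormedAddCommGroup E] [NormedSpace ℝ E]

/-- If `y` is a regular value of a proper map `G`, integrals of `φ(G) det DG`, with `φ` supported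
near `y`, count the preimages of `y` with signs. -/
theorem exists_integral_mul_det_eq_sum_sign [FiniteDimensional ℝ E] [MeasurableSpace E]
    [BorelSpace E] (μ : Measure E) [μ.IsAddHaarMeasure] {G : E → E} (hG : ContDiff ℝ 1 G) {y : E}
    {s : Finset E} (hs : ∀ v, v ∈ s ↔ G v = y) (hK : IsCompact (G ⁻¹' closedBall y 1))
    (hd : ∀ v ∈ s, LinearMap.det (fderiv ℝ G v : E →ₗ[ℝ] E) ≠ 0) :
    ∃ δ > 0, ∀ φ : E → ℝ, Integrable φ μ → (∀ z ∉ ball y δ, φ z = 0) →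
      ∫ v, φ (G v) * LinearMap.det (fderiv ℝ G v : E →ₗ[ℝ] E) ∂μ =
        ((∑ v ∈ s, (SignType.sign (LinearMap.det (fderiv ℝ G v : E →ₗ[ℝ] E)) : ℤ) : ℤ) : ℝ) *
          ∫ z, φ z ∂μ := by
  classical
  set J : E → ℝ := fun v => LinearMap.det (fderiv ℝ G v : E →ₗ[ℝ] E) with hJ
  have hJc : Continuous J := by
    have h1 := hG.continuous_fderiv (by simp)
    exact (ContinuousLinearMap.continuous_det (E := E) (𝕜 := ℝ)).comp h1
  have hloc : ∀ x ∈ s, ∃ O : Set E, IsOpen O ∧ x ∈ O ∧ Set.InjOn G O ∧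
      ∀ V ⊆ O, IsOpen V → IsOpen (G '' V) := by
    intro x hx
    have h1 : HasStrictFDerivAt G (fderiv ℝ G x) x :=
      hG.contDiffAt.hasStrictFDerivAt (by simp)
    have hu : IsUnit (LinearMap.det (fderiv ℝ G x : E →ₗ[ℝ] E)) := (hd x hx).isUnit
    set A : E ≃L[ℝ] E := (LinearEquiv.ofIsUnitDet (f := (fderiv ℝ G x : E →ₗ[ℝ] E))
      (v := Module.finBasis ℝ E) (v' := Module.finBasis ℝ E)
      (by rw [LinearMap.det_toMatrix]; exact hu)).toContinuousLinearEquiv with hA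
    have h2 : HasStrictFDerivAt G (A : E →L[ℝ] E) x := by
      have : (A : E →L[ℝ] E) = fderiv ℝ G x := by ext v; rfl
      rwa [this]
    refine ⟨(h2.toOpenPartialHomeomorph G).source, (h2.toOpenPartialHomeomorph G).open_source,
      h2.mem_toOpenPartialHomeomorph_source, ?_, ?_⟩
    · have := (h2.toOpenPartialHomeomorph G).injOn
      simpa using this
    · intro V hV hVo
      have := (h2.toOpenPartialHomeomorph G).isOpen_image_of_subset_source hVo hV
      simpa using this
  choose! O hO hxO hinj himg using hloc
  obtain ⟨U, hU, hUd⟩ := s.finite_toSet.t2_separation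
  -- disjoint neighbourhoods of the preimages, on which `G` is injective and `J` keeps its sign
  set V : E → Set E := fun x => U x ∩ O x ∩ {v | 0 < J v * J x} with hV
  have hVo : ∀ x ∈ s, IsOpen (V x) := fun x hx =>
    (((hU x).2.inter (hO x hx))).inter (isOpen_lt continuous_const (hJc.mul continuous_const))
  have hxV : ∀ x ∈ s, x ∈ V x := fun x hx =>
    ⟨⟨(hU x).1, hxO x hx⟩, mul_self_pos.2 (hd x hx)⟩
  have hVinj : ∀ x ∈ s, Set.InjOn G (V x) := fun x hx =>
    (hinj x hx).mono fun v hv => hv.1.2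
  have hVimg : ∀ x ∈ s, IsOpen (G '' V x) := fun x hx =>
    himg x hx _ (fun v hv => hv.1.2) (hVo x hx)
  have hdisj : (s : Set E).PairwiseDisjoint V := fun a ha b hb hab =>
    (hUd ha hb hab).mono (fun v hv => hv.1.1) (fun v hv => hv.1.1)
  -- the part of the preimage of a ball away from `s` stays at a positive distance from `y`
  set C : Set E := G ⁻¹' closedBall y 1 \ ⋃ x ∈ s, V x with hC
  have hCc : IsCompact C := hK.diff (isOpen_biUnion hVo)
  have hyC : y ∉ G '' C := by
    rintro ⟨v, hv, hvy⟩
    exact hv.2 (Set.mem_biUnion ((hs v).2 hvy) (hxV v ((hs v).2 hvy)))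
  have hn1 : (G '' C)ᶜ ∈ 𝓝 y := (hCc.image hG.continuous).isClosed.isOpen_compl.mem_nhds hyC
  have hn2 : (⋂ x ∈ s, G '' V x) ∈ 𝓝 y := (Filter.biInter_finset_mem s).2 fun x hx =>
    (hVimg x hx).mem_nhds ⟨x, hxV x hx, (hs x).1 hx⟩
  obtain ⟨δ, hδ, hball⟩ := Metric.mem_nhds_iff.1
    (Filter.inter_mem (Filter.inter_mem hn1 hn2) (closedBall_mem_nhds y one_pos))
  refine ⟨δ, hδ, fun φ hφ hφ0 => ?_⟩
  have hder : ∀ x, ∀ v ∈ V x, HasFDerivWithinAt G (fderiv ℝ G v) (V x) v := fun x v _ =>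
    ((hG.differentiable (by simp)) v).hasFDerivAt.hasFDerivWithinAt
  have hsgn : ∀ x ∈ s, ∀ v ∈ V x, J v = (SignType.sign (J x) : ℤ) * |J v| := by
    intro x hx v hv
    have h : 0 < J v * J x := hv.2
    rcases lt_or_gt_of_ne (hd x hx) with h' | h'
    · have : J v < 0 := by nlinarith
      rw [show SignType.sign (J x) = -1 from sign_neg h', abs_of_neg this]; simp
    · have : 0 < J v := by nlinarith
      rw [show SignType.sign (J x) = 1 from sign_pos h', abs_of_pos this]; simp
  have hint : ∀ x ∈ s, ∫ v in V x, φ (G v) * J v ∂μ =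
      (SignType.sign (J x) : ℤ) * ∫ z, φ z ∂μ := by
    intro x hx
    have h1 := integral_image_eq_integral_abs_det_fderiv_smul μ (hVo x hx).measurableSet (hder x)
      (hVinj x hx) φ
    have h2 : ∫ z in G '' V x, φ z ∂μ = ∫ z, φ z ∂μ :=
      setIntegral_eq_integral_of_forall_compl_eq_zero fun z hz =>
        hφ0 z fun hzb => hz (Set.mem_iInter₂.1 (hball hzb).1.2 x hx)
    rw [← h2, h1, ← integral_const_mul]
    refine setIntegral_congr_fun (hVo x hx).measurableSet fun v hv => ?_
    change φ (G v) * J v = _ * (|J v| * φ (G v))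
    nth_rewrite 1 [hsgn x hx v hv]
    ring
  have hintg : ∀ x ∈ s, IntegrableOn (fun v => φ (G v) * J v) (V x) μ := by
    intro x hx
    have h1 := (integrableOn_image_iff_integrableOn_abs_det_fderiv_smul μ
      (hVo x hx).measurableSet (hder x) (hVinj x hx) φ).1 hφ.integrableOn
    refine IntegrableOn.congr_fun (Integrable.const_mul h1 ((SignType.sign (J x) : ℤ) : ℝ)) ?_
      (hVo x hx).measurableSet
    intro v hv
    change _ * (|J v| * φ (G v)) = φ (G v) * J v
    nth_rewrite 2 [hsgn x hx v hv]
    ring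
  have hsub : ∀ v ∉ ⋃ x ∈ s, V x, φ (G v) * J v = 0 := by
    intro v hv
    rw [hφ0, zero_mul]
    intro hb
    exact (hball hb).1.1 ⟨v, ⟨(hball hb).2, hv⟩, rfl⟩
  rw [← setIntegral_eq_integral_of_forall_compl_eq_zero hsub,
    integral_biUnion_finset s (fun x hx => (hVo x hx).measurableSet) hdisj hintg,
    Finset.sum_congr rfl hint, ← Finset.sum_mul]
  push_cast
  rfl

end

/-! ### Maps into the sphere -/

open Classical in
/-- Radial projection `ℍ ∖ 0 → S³`, extended by the junk value `1` at the origin. -/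
def normalize (v : ℍ[ℝ]) : S3 :=
  if h : v = 0 then 1 else ⟨‖v‖⁻¹ • v, by simp [norm_smul, norm_ne_zero_iff.mpr h]⟩

theorem coe_normalize {v : ℍ[ℝ]} (h : v ≠ 0) : (normalize v : ℍ[ℝ]) = ‖v‖⁻¹ • v := by
  simp [normalize, h]

@[simp] theorem normalize_coe (x : S3) : normalize (x : ℍ[ℝ]) = x := by
  have h : (x : ℍ[ℝ]) ≠ 0 := ne_zero_of_mem_unit_sphere x
  ext1; rw [coe_normalize h]; simp

theorem norm_smul_normalize (v : ℍ[ℝ]) : ‖v‖ • (normalize v : ℍ[ℝ]) = v := by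
  by_cases h : v = 0
  · simp [h]
  · rw [coe_normalize h, smul_smul, mul_inv_cancel₀ (norm_ne_zero_iff.2 h), one_smul]

theorem normalize_smul {c : ℝ} (hc : 0 < c) (v : ℍ[ℝ]) : normalize (c • v) = normalize v := by
  by_cases h : v = 0
  · simp [h]
  · ext1
    have h2 : c • v ≠ 0 := smul_ne_zero hc.ne' h
    rw [coe_normalize h, coe_normalize h2, norm_smul, Real.norm_of_nonneg hc.le, smul_smul]
    congr 1
    field_simp

theorem continuousAt_normalize {v : ℍ[ℝ]} (h : v ≠ 0) : ContinuousAt normalize v := by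
  rw [Topology.IsInducing.subtypeVal.continuousAt_iff]
  have : (fun v => (normalize v : ℍ[ℝ])) =ᶠ[𝓝 v] fun v => ‖v‖⁻¹ • v := by
    filter_upwards [isOpen_ne.mem_nhds h] with w hw using coe_normalize hw
  refine ContinuousAt.congr ?_ this.symm
  exact (continuousAt_id.norm.inv₀ (norm_ne_zero_iff.2 h)).smul continuousAt_id

theorem continuous_normalize_comp {X : Type*} [TopologicalSpace X] {F : X → ℍ[ℝ]}
    (hF : Continuous F) (h0 : ∀ x, F x ≠ 0) : Continuous fun x => normalize (F x) :=
  continuous_iff_continuousAt.2 fun x =>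
    ContinuousAt.comp (f := F) (continuousAt_normalize (h0 x)) hF.continuousAt

theorem contMDiff_normalize_comp {F' H' N : Type*} [NormedAddCommGroup F'] [NormedSpace ℝ F']
    [TopologicalSpace H'] {I : ModelWithCorners ℝ F' H'} [TopologicalSpace N] [ChartedSpace H' N]
    [IsManifold I ∞ N] {F : N → ℍ[ℝ]} (hF : ContMDiff I 𝓘(ℝ, ℍ[ℝ]) ∞ F) (h0 : ∀ x, F x ≠ 0) :
    ContMDiff I (𝓡 3) ∞ fun x => normalize (F x) := by
  have h1 : ContMDiff I 𝓘(ℝ, ℍ[ℝ]) ∞ fun x => ‖F x‖⁻¹ • F x := by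
    intro x
    have : ContDiffAt ℝ ∞ (fun v : ℍ[ℝ] => ‖v‖⁻¹ • v) (F x) :=
      ((contDiffAt_norm ℝ (h0 x)).inv (norm_ne_zero_iff.2 (h0 x))).smul contDiffAt_id
    exact this.contMDiffAt.comp x (hF x)
  have h2 := ContMDiff.codRestrict_sphere (n := 3) h1
    (fun x => by simp [norm_smul, norm_ne_zero_iff.mpr (h0 x)])
  have h3 : (fun x => normalize (F x)) = Set.codRestrict (fun x => ‖F x‖⁻¹ • F x)
      (sphere (0 : ℍ[ℝ]) 1) (fun x => by simp [norm_smul, norm_ne_zero_iff.mpr (h0 x)]) := by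
    ext1 x
    ext1
    rw [coe_normalize (h0 x)]
    rfl
  rw [h3]
  exact h2

theorem contMDiffAt_normalize {v : ℍ[ℝ]} (h : v ≠ 0) :
    ContMDiffAt 𝓘(ℝ, ℍ[ℝ]) (𝓡 3) ∞ normalize v := by
  have hv : 0 < ‖v‖ := norm_pos_iff.2 h
  -- Near `v`, composition with the map `w ↦ v + χ(w) (w - v)`, which is the identity near `v` and
  -- never vanishes, does not change `normalize`.
  let χ : ContDiffBump v := ⟨‖v‖ / 4, ‖v‖ / 2, by positivity, by linarith⟩
  have h0 : ∀ w, v + χ w • (w - v) ≠ 0 := by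
    intro w hw
    have h1 : ‖χ w • (w - v)‖ = ‖v‖ := by
      rw [← norm_neg v]; congr 1; rw [eq_neg_iff_add_eq_zero, add_comm]; exact hw
    by_cases hd : dist w v < ‖v‖ / 2
    · rw [norm_smul, Real.norm_of_nonneg χ.nonneg, ← dist_eq_norm] at h1
      have : χ w * dist w v ≤ 1 * dist w v := by gcongr; exact χ.le_one
      linarith
    · have : χ w = 0 := χ.zero_of_le_dist (not_lt.1 hd)
      simp [this] at h1
      exact h (norm_eq_zero.1 h1.symm)
  have h1 : ContDiff ℝ ∞ fun w => v + χ w • (w - v) :=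
    contDiff_const.add (χ.contDiff.smul (contDiff_id.sub contDiff_const))
  have h2 := contMDiff_normalize_comp h1.contMDiff h0
  refine (h2 v).congr_of_eventuallyEq ?_
  filter_upwards [χ.eventuallyEq_one] with w hw
  simp only [hw, Pi.one_apply, one_smul, add_sub_cancel]

theorem radialExtension_eq (f : S3 → S3) (v : ℍ[ℝ]) :
    radialExtension f v = ‖v‖ • (f (normalize v) : ℍ[ℝ]) := by
  by_cases h : v = 0
  · simp [radialExtension, h]
  · simp [radialExtension, normalize, h]

theorem norm_radialExtension (f : S3 → S3) (v : ℍ[ℝ]) : ‖radialExtension f v‖ = ‖v‖ := by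
  rw [radialExtension_eq, norm_smul]; simp

theorem radialExtension_smul (f : S3 → S3) {c : ℝ} (hc : 0 < c) (v : ℍ[ℝ]) :
    radialExtension f (c • v) = c • radialExtension f v := by
  rw [radialExtension_eq, radialExtension_eq, normalize_smul hc, norm_smul,
    Real.norm_of_nonneg hc.le, smul_smul]

@[simp] theorem radialExtension_coe (f : S3 → S3) (x : S3) : radialExtension f (x : ℍ[ℝ]) = f x := by
  rw [radialExtension_eq]; simp

theorem contDiffAt_radialExtension {g : S3 → S3} (hg : ContMDiff (𝓡 3) (𝓡 3) ∞ g) {v : ℍ[ℝ]}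
    (h : v ≠ 0) : ContDiffAt ℝ ∞ (radialExtension g) v := by
  have h1 : ContMDiffAt 𝓘(ℝ, ℍ[ℝ]) 𝓘(ℝ, ℍ[ℝ]) ∞ (fun v => (g (normalize v) : ℍ[ℝ])) v :=
    (contMDiff_coe_sphere (g (normalize v))).comp v ((hg _).comp v (contMDiffAt_normalize h))
  have h2 := (contDiffAt_norm ℝ h).smul (contMDiffAt_iff_contDiffAt.1 h1)
  exact h2.congr_of_eventuallyEq (Filter.Eventually.of_forall fun w => radialExtension_eq g w)

/-- Maps into the sphere that are nowhere antipodal are homotopic relative to the set where they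
agree. -/
theorem homotopicRel_of_forall_ne_neg {X : Type*} [TopologicalSpace X] (f g : C(X, S3))
    (h : ∀ x, (f x : ℍ[ℝ]) ≠ -(g x : ℍ[ℝ])) (S : Set X) (hS : ∀ x ∈ S, f x = g x) :
    f.HomotopicRel g S := by
  have h0 : ∀ p : unitInterval × X,
      (1 - (p.1 : ℝ)) • (f p.2 : ℍ[ℝ]) + (p.1 : ℝ) • (g p.2 : ℍ[ℝ]) ≠ 0 := by
    rintro ⟨t, x⟩ h1
    have h2 := eq_neg_of_add_eq_zero_left h1
    have h3 := congrArg norm h2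
    simp only [norm_neg, norm_smul, norm_eq_of_mem_sphere, mul_one, Real.norm_eq_abs] at h3
    rw [abs_of_nonneg (sub_nonneg.2 t.2.2), abs_of_nonneg t.2.1] at h3
    simp only at h2
    rw [h3, ← smul_neg] at h2
    have ht : (t : ℝ) ≠ 0 := fun h4 => by rw [h4] at h3; norm_num at h3
    exact h x (smul_right_injective _ ht h2)
  refine ⟨{ toFun := fun p =>
              normalize ((1 - (p.1 : ℝ)) • (f p.2 : ℍ[ℝ]) + (p.1 : ℝ) • (g p.2 : ℍ[ℝ]))
            continuous_toFun := continuous_normalize_comp (by fun_prop) h0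
            map_zero_left := fun x => by simp
            map_one_left := fun x => by simp
            prop' := fun t x hx => ?_ }⟩
  simp only [ContinuousMap.coe_mk, hS x hx, ← add_smul]
  simp

theorem homotopic_of_forall_ne_neg {X : Type*} [TopologicalSpace X] (f g : C(X, S3))
    (h : ∀ x, (f x : ℍ[ℝ]) ≠ -(g x : ℍ[ℝ])) : f.Homotopic g := by
  obtain ⟨H⟩ := homotopicRel_of_forall_ne_neg f g h ∅ fun x hx => hx.elim
  exact ⟨H.toHomotopy⟩

/-! ### Jacobians and isometries -/

/-- The real basis `1, i, j, k` of the quaternions. -/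
def quatBasis : Basis (Fin 4) ℝ ℍ[ℝ] := QuaternionAlgebra.basisOneIJK (-1 : ℝ) 0 (-1)

theorem quatBasis_repr (x : ℍ[ℝ]) : ⇑(quatBasis.repr x) = ![x.re, x.imI, x.imJ, x.imK] :=
  QuaternionAlgebra.coe_basisOneIJK_repr (-1 : ℝ) 0 (-1) x

theorem quatBasis_apply :
    ⇑quatBasis = ![⟨1, 0, 0, 0⟩, ⟨0, 1, 0, 0⟩, ⟨0, 0, 1, 0⟩, ⟨0, 0, 0, 1⟩] := by
  ext1 j
  apply quatBasis.repr.injective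
  ext i
  rw [Basis.repr_self, quatBasis_repr]
  fin_cases i <;> fin_cases j <;> simp

theorem det_mulLeft_pos (a : S3) : 0 < LinearMap.det (LinearMap.mulLeft ℝ (a : ℍ[ℝ])) := by
  have hM : LinearMap.toMatrix quatBasis quatBasis (LinearMap.mulLeft ℝ (a : ℍ[ℝ])) =
      !![a.1.re, -a.1.imI, -a.1.imJ, -a.1.imK; a.1.imI, a.1.re, -a.1.imK, a.1.imJ;
        a.1.imJ, a.1.imK, a.1.re, -a.1.imI; a.1.imK, -a.1.imJ, a.1.imI, a.1.re] := by
    ext i j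
    rw [LinearMap.toMatrix_apply, quatBasis_repr, LinearMap.mulLeft_apply, Quaternion.re_mul,
      Quaternion.imI_mul, Quaternion.imJ_mul, Quaternion.imK_mul, quatBasis_apply]
    fin_cases i <;> fin_cases j <;> simp
  have h : LinearMap.det (LinearMap.mulLeft ℝ (a : ℍ[ℝ])) = (Quaternion.normSq (a : ℍ[ℝ])) ^ 2 := by
    rw [← LinearMap.det_toMatrix quatBasis, hM, Matrix.det_succ_row_zero, Quaternion.normSq_def']
    simp [Matrix.det_fin_three, Fin.sum_univ_succ, Fin.succAbove]
    ring
  rw [h, Quaternion.normSq_eq_norm_mul_self]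
  simp

theorem det_mulRight_pos (a : S3) : 0 < LinearMap.det (LinearMap.mulRight ℝ (a : ℍ[ℝ])) := by
  have hM : LinearMap.toMatrix quatBasis quatBasis (LinearMap.mulRight ℝ (a : ℍ[ℝ])) =
      !![a.1.re, -a.1.imI, -a.1.imJ, -a.1.imK; a.1.imI, a.1.re, a.1.imK, -a.1.imJ;
        a.1.imJ, -a.1.imK, a.1.re, a.1.imI; a.1.imK, a.1.imJ, -a.1.imI, a.1.re] := by
    ext i j
    rw [LinearMap.toMatrix_apply, quatBasis_repr, LinearMap.mulRight_apply, Quaternion.re_mul,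
      Quaternion.imI_mul, Quaternion.imJ_mul, Quaternion.imK_mul, quatBasis_apply]
    fin_cases i <;> fin_cases j <;> simp
  have h : LinearMap.det (LinearMap.mulRight ℝ (a : ℍ[ℝ])) = (Quaternion.normSq (a : ℍ[ℝ])) ^ 2 := by
    rw [← LinearMap.det_toMatrix quatBasis, hM, Matrix.det_succ_row_zero, Quaternion.normSq_def']
    simp [Matrix.det_fin_three, Fin.sum_univ_succ, Fin.succAbove]
    ring
  rw [h, Quaternion.normSq_eq_norm_mul_self]
  simp

theorem det_phi_pos (a b : S3) : 0 < LinearMap.det ((phi (a, b)) : ℍ[ℝ] →ₗ[ℝ] ℍ[ℝ]) := by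
  have : ((phi (a, b)) : ℍ[ℝ] →ₗ[ℝ] ℍ[ℝ]) =
      (LinearMap.mulRight ℝ ((b⁻¹ : S3) : ℍ[ℝ])).comp (LinearMap.mulLeft ℝ (a : ℍ[ℝ])) := by
    ext1 x; rfl
  rw [this, LinearMap.det_comp]
  exact mul_pos (det_mulRight_pos _) (det_mulLeft_pos _)

theorem normalize_isometry (r : O4) (v : ℍ[ℝ]) (hv : v ≠ 0) : normalize (r v) = r • normalize v := by
  ext1
  rw [coe_smul_S3, coe_normalize hv, coe_normalize (by simpa using hv), map_smul, r.norm_map]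

theorem radialExtension_comp_smul (g : S3 → S3) (r : O4) (v : ℍ[ℝ]) :
    radialExtension (fun x => g (r • x)) v = radialExtension g (r v) := by
  by_cases h : v = 0
  · simp [radialExtension_eq, h]
  · rw [radialExtension_eq, radialExtension_eq, normalize_isometry r v h, r.norm_map]

theorem radialExtension_smul_comp (g : S3 → S3) (r : O4) (v : ℍ[ℝ]) :
    radialExtension (fun x => r • g x) v = r (radialExtension g v) := by
  rw [radialExtension_eq, radialExtension_eq, map_smul, coe_smul_S3]

theorem differentiableAt_radialExtension {g : S3 → S3} (hg : ContMDiff (𝓡 3) (𝓡 3) ∞ g) {v : ℍ[ℝ]}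
    (h : v ≠ 0) : DifferentiableAt ℝ (radialExtension g) v :=
  (contDiffAt_radialExtension hg h).differentiableAt (by simp)

theorem jacobianDet_comp_smul {g : S3 → S3} (hg : ContMDiff (𝓡 3) (𝓡 3) ∞ g) (r : O4) (x : S3) :
    jacobianDet (fun x => g (r • x)) x =
      jacobianDet g (r • x) * LinearMap.det (r : ℍ[ℝ] →ₗ[ℝ] ℍ[ℝ]) := by
  have h1 : HasFDerivAt (radialExtension fun x => g (r • x))
      ((fderiv ℝ (radialExtension g) (r x)).comp
        (r.toContinuousLinearEquiv : ℍ[ℝ] →L[ℝ] ℍ[ℝ])) (x : ℍ[ℝ]) := by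
    have : radialExtension (fun x => g (r • x)) = fun v => radialExtension g (r v) :=
      funext fun v => radialExtension_comp_smul g r v
    rw [this]
    have h2 : HasFDerivAt (radialExtension g) _ (r (x : ℍ[ℝ])) :=
      (differentiableAt_radialExtension hg (v := r x)
        (by simpa using ne_zero_of_mem_unit_sphere x)).hasFDerivAt
    exact h2.comp (x : ℍ[ℝ]) r.toContinuousLinearEquiv.hasFDerivAt
  rw [jacobianDet, h1.fderiv, jacobianDet, coe_smul_S3, ← LinearMap.det_comp]
  rfl

theorem jacobianDet_smul_comp {g : S3 → S3} (hg : ContMDiff (𝓡 3) (𝓡 3) ∞ g) (r : O4) (x : S3) :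
    jacobianDet (fun x => r • g x) x =
      LinearMap.det (r : ℍ[ℝ] →ₗ[ℝ] ℍ[ℝ]) * jacobianDet g x := by
  have h1 : HasFDerivAt (radialExtension fun x => r • g x)
      ((r.toContinuousLinearEquiv : ℍ[ℝ] →L[ℝ] ℍ[ℝ]).comp (fderiv ℝ (radialExtension g) x))
      (x : ℍ[ℝ]) := by
    have : radialExtension (fun x => r • g x) = fun v => r (radialExtension g v) :=
      funext fun v => radialExtension_smul_comp g r v
    rw [this]
    have h2 := (differentiableAt_radialExtension hg (ne_zero_of_mem_unit_sphere x)).hasFDerivAt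
    exact r.toContinuousLinearEquiv.hasFDerivAt.comp (x : ℍ[ℝ]) h2
  rw [jacobianDet, h1.fderiv, jacobianDet, ← LinearMap.det_comp]
  rfl

/-! ### Smooth approximation -/

/-- A map `S³ → S³` invariant under a finite group of isometries is approximated by smooth maps with
the same invariance: average a smooth approximation and project back to the sphere. -/
theorem exists_smooth_near_of_invariant {K : Type*} [Group K] [Finite K] (ρ : K →* O4)
    (f : C(S3, S3)) (hf : ∀ k x, f (ρ k • x) = f x) {ε : ℝ} (hε : 0 < ε) :
    ∃ g : C(S3, S3), ContMDiff (𝓡 3) (𝓡 3) ∞ g ∧ (∀ k x, g (ρ k • x) = g x) ∧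
      ∀ x, ‖(g x : ℍ[ℝ]) - f x‖ ≤ ε := by
  have := Fintype.ofFinite K
  set η : ℝ := min (ε / 2) (1 / 2) with hη
  have hη0 : 0 < η := by positivity
  obtain ⟨F, hF, -⟩ := Continuous.exists_contMDiff_approx (𝓡 3) (F := ℍ[ℝ])
    (f := fun x : S3 => (f x : ℍ[ℝ])) (ε := fun _ => η) ⊤ (by fun_prop) continuous_const
    (fun _ => hη0)
  set c : ℝ := (Fintype.card K : ℝ)⁻¹ with hc
  have hcard : (Fintype.card K : ℝ) ≠ 0 := by simp
  set A : S3 → ℍ[ℝ] := fun x => c • ∑ k, F (ρ k • x) with hA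
  have hAf : ∀ x, ‖A x - f x‖ ≤ η := by
    intro x
    have h1 : A x - f x = c • ∑ k, (F (ρ k • x) - f (ρ k • x)) := by
      simp only [hA, hf, Finset.sum_sub_distrib, smul_sub, Finset.sum_const, Finset.card_univ]
      rw [← Nat.cast_smul_eq_nsmul ℝ, smul_smul, hc, inv_mul_cancel₀ hcard, one_smul]
    have h2 : ‖∑ k, (F (ρ k • x) - f (ρ k • x) : ℍ[ℝ])‖ ≤ Fintype.card K * η := by
      refine (norm_sum_le _ _).trans ?_
      refine (Finset.sum_le_card_nsmul _ _ η fun k _ => ?_).trans (by simp)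
      rw [← dist_eq_norm]; exact (hF _).le
    rw [h1, norm_smul, Real.norm_of_nonneg (by positivity)]
    calc c * _ ≤ c * (Fintype.card K * η) := by gcongr
      _ = η := by rw [hc, ← mul_assoc, inv_mul_cancel₀ hcard, one_mul]
  have hA0 : ∀ x, A x ≠ 0 := by
    intro x h
    have h1 := hAf x
    rw [h, zero_sub, norm_neg, norm_eq_of_mem_sphere] at h1
    have : η ≤ 1 / 2 := min_le_right _ _
    linarith
  have hAs : ContMDiff (𝓡 3) 𝓘(ℝ, ℍ[ℝ]) ∞ A := by
    have h1 : ContMDiff (𝓡 3) 𝓘(ℝ, ℍ[ℝ]) ∞ fun x => ∑ k, F (ρ k • x) :=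
      contMDiff_finsetSum fun k _ => F.contMDiff.comp (contMDiff_smul_S3 (ρ k))
    exact ((contDiff_const_smul c).contMDiff (n := ∞)).comp h1
  have hgs := contMDiff_normalize_comp hAs hA0
  refine ⟨⟨_, hgs.continuous⟩, hgs, ?_, ?_⟩
  · intro k x
    have : A (ρ k • x) = A x := by
      simp only [hA]
      congr 1
      refine Fintype.sum_equiv (Equiv.mulRight k) _ _ fun j => ?_
      simp [mul_smul]
    simp [this]
  · intro x
    have h1 : ‖(normalize (A x) : ℍ[ℝ]) - A x‖ ≤ η := by
      have h2 : (normalize (A x) : ℍ[ℝ]) - A x = (1 - ‖A x‖) • (normalize (A x) : ℍ[ℝ]) := by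
        rw [sub_smul, one_smul, norm_smul_normalize]
      rw [h2, norm_smul, norm_eq_of_mem_sphere, mul_one, Real.norm_eq_abs, abs_sub_comm]
      have h3 := abs_norm_sub_norm_le (A x) (f x : ℍ[ℝ])
      rw [norm_eq_of_mem_sphere] at h3
      exact h3.trans (hAf x)
    have h4 : η ≤ ε / 2 := min_le_left _ _
    calc ‖(normalize (A x) : ℍ[ℝ]) - f x‖
        ≤ ‖(normalize (A x) : ℍ[ℝ]) - A x‖ + ‖A x - f x‖ := norm_sub_le_norm_sub_add_norm_sub _ _ _
      _ ≤ ε := by linarith [hAf x]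

theorem exists_smooth_near (f : C(S3, S3)) {ε : ℝ} (hε : 0 < ε) :
    ∃ g : C(S3, S3), ContMDiff (𝓡 3) (𝓡 3) ∞ g ∧ ∀ x, ‖(g x : ℍ[ℝ]) - f x‖ ≤ ε := by
  obtain ⟨g, h1, -, h3⟩ := exists_smooth_near_of_invariant (1 : Unit →* O4) f (by simp) hε
  exact ⟨g, h1, h3⟩

theorem ne_neg_of_norm_sub_lt {x y : S3} (h : ‖(x : ℍ[ℝ]) - y‖ < 2) : (x : ℍ[ℝ]) ≠ -(y : ℍ[ℝ]) := by
  intro h1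
  rw [h1, ← neg_add', norm_neg, ← two_smul ℝ, norm_smul, norm_eq_of_mem_sphere] at h
  norm_num at h

/-! ### The degree integral -/

/-- The radial extension, multiplied by a smooth cutoff that vanishes near the origin, where the
radial extension may fail to be smooth, and equals `1` for `‖v‖ ≥ 1/2`. -/
def cutRadial (f : S3 → S3) (v : ℍ[ℝ]) : ℍ[ℝ] :=
  Real.smoothTransition (8 * ‖v‖ ^ 2 - 1) • radialExtension f v

theorem cutRadial_eq (f : S3 → S3) {v : ℍ[ℝ]} (h : 1 / 2 ≤ ‖v‖) :
    cutRadial f v = radialExtension f v := by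
  have h1 : Real.smoothTransition (8 * ‖v‖ ^ 2 - 1) = 1 :=
    Real.smoothTransition.one_of_one_le (by nlinarith)
  rw [cutRadial, h1, one_smul]

theorem norm_cutRadial_le (f : S3 → S3) (v : ℍ[ℝ]) : ‖cutRadial f v‖ ≤ ‖v‖ := by
  rw [cutRadial, norm_smul, Real.norm_of_nonneg (Real.smoothTransition.nonneg _),
    norm_radialExtension]
  exact mul_le_of_le_one_left (norm_nonneg _) (Real.smoothTransition.le_one _)

theorem contDiff_cutRadial {g : S3 → S3} (hg : ContMDiff (𝓡 3) (𝓡 3) ∞ g) :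
    ContDiff ℝ ∞ (cutRadial g) := by
  rw [contDiff_iff_contDiffAt]
  intro v
  by_cases h : v = 0
  · subst h
    have : cutRadial g =ᶠ[𝓝 0] fun _ => 0 := by
      filter_upwards [ball_mem_nhds (0 : ℍ[ℝ]) (by norm_num : (0 : ℝ) < 1 / 4)] with w hw
      rw [mem_ball_zero_iff] at hw
      rw [cutRadial, Real.smoothTransition.zero_of_nonpos, zero_smul]
      nlinarith [norm_nonneg w]
    exact contDiffAt_const.congr_of_eventuallyEq this
  · have h1 : ContDiff ℝ ∞ fun v : ℍ[ℝ] => 8 * ‖v‖ ^ 2 - 1 :=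
      (contDiff_const.mul (contDiff_norm_sq ℝ)).sub contDiff_const
    exact (Real.smoothTransition.contDiff.comp h1).contDiffAt.smul
      (contDiffAt_radialExtension hg h)

theorem cutRadial_eventuallyEq (f : S3 → S3) (x : S3) :
    cutRadial f =ᶠ[𝓝 (x : ℍ[ℝ])] radialExtension f := by
  have : (1 : ℝ) / 2 < ‖(x : ℍ[ℝ])‖ := by rw [norm_eq_of_mem_sphere]; norm_num
  filter_upwards [(isOpen_lt continuous_const continuous_norm).mem_nhds this] with v hv
  exact cutRadial_eq f hv.le

theorem det_fderiv_cutRadial (f : S3 → S3) (x : S3) :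
    LinearMap.det (fderiv ℝ (cutRadial f) x : ℍ[ℝ] →ₗ[ℝ] ℍ[ℝ]) = jacobianDet f x := by
  rw [jacobianDet, (cutRadial_eventuallyEq f x).fderiv_eq]

section Integral
variable [MeasurableSpace ℍ[ℝ]] [BorelSpace ℍ[ℝ]] (μ : Measure ℍ[ℝ]) [μ.IsAddHaarMeasure]

/-- The integral of the pullback of the volume form `φ` by the (cut off) radial extension. -/
def degreeIntegral (φ : ℍ[ℝ] → ℝ) (g : S3 → S3) : ℝ :=
  ∫ v, φ (cutRadial g v) * LinearMap.det (fderiv ℝ (cutRadial g) v : ℍ[ℝ] →ₗ[ℝ] ℍ[ℝ]) ∂μ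

/-- For nowhere antipodal maps, the segment between the radial extensions is a homotopy that is
proper, uniformly in time. -/
theorem degreeIntegral_eq_of_ne_neg {φ : ℍ[ℝ] → ℝ} (hφ : ContDiff ℝ ∞ φ)
    (hφ0 : ∀ z, 2 < ‖z‖ → φ z = 0) {f g : S3 → S3} (hf : ContMDiff (𝓡 3) (𝓡 3) ∞ f)
    (hg : ContMDiff (𝓡 3) (𝓡 3) ∞ g) (h : ∀ x, (f x : ℍ[ℝ]) ≠ -(g x : ℍ[ℝ])) :
    degreeIntegral μ φ g = degreeIntegral μ φ f := by
  have hf' := hf.continuous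
  have hg' := hg.continuous
  -- by compactness, the segments between `f x` and `g x` stay at a positive distance from `0`
  obtain ⟨c, hc, hcb⟩ : ∃ c > 0, ∀ t ∈ Set.Icc (0 : ℝ) 1, ∀ x : S3,
      c ≤ ‖(1 - t) • (f x : ℍ[ℝ]) + t • (g x : ℍ[ℝ])‖ := by
    have hne : ∀ p ∈ (Set.Icc (0 : ℝ) 1 ×ˢ (Set.univ : Set S3)),
        0 < ‖(1 - p.1) • (f p.2 : ℍ[ℝ]) + p.1 • (g p.2 : ℍ[ℝ])‖ := by
      rintro ⟨t, x⟩ ⟨ht, -⟩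
      rw [norm_pos_iff]
      intro h1
      have h2 := eq_neg_of_add_eq_zero_left h1
      have h3 := congrArg norm h2
      simp only [norm_neg, norm_smul, norm_eq_of_mem_sphere, mul_one] at h3
      rw [Real.norm_of_nonneg ht.1, Real.norm_of_nonneg (sub_nonneg.2 ht.2)] at h3
      have h4 : t = 1 / 2 := by linarith
      subst h4
      norm_num at h2
      rw [← smul_neg] at h2
      exact h x (smul_right_injective _ (by norm_num : (1 / 2 : ℝ) ≠ 0) h2)
    obtain ⟨p, hp, hmin⟩ := (isCompact_Icc.prod (isCompact_univ (X := S3))).exists_isMinOn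
      (f := fun p : ℝ × S3 => ‖(1 - p.1) • (f p.2 : ℍ[ℝ]) + p.1 • (g p.2 : ℍ[ℝ])‖)
      ⟨((0 : ℝ), (1 : S3)), ⟨⟨le_rfl, zero_le_one⟩, trivial⟩⟩ (by fun_prop)
    exact ⟨_, hne p hp, fun t ht x => hmin (a := (t, x)) ⟨ht, trivial⟩⟩
  have key := integral_mul_det_eq_of_homotopy μ hφ (contDiff_cutRadial hf)
    ((contDiff_cutRadial hg).sub (contDiff_cutRadial hf))
    (isCompact_closedBall (0 : ℍ[ℝ]) (max (2 / c) 1)) (by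
      intro t ht v hv
      rw [mem_closedBall_zero_iff, not_le, max_lt_iff] at hv
      apply hφ0
      have h1 : cutRadial f v + t • (cutRadial g v - cutRadial f v) =
          ‖v‖ • ((1 - t) • (f (normalize v) : ℍ[ℝ]) + t • (g (normalize v) : ℍ[ℝ])) := by
        rw [cutRadial_eq f (by linarith), cutRadial_eq g (by linarith), radialExtension_eq,
          radialExtension_eq]
        module
      rw [h1, norm_smul, norm_norm]
      calc 2 = 2 / c * c := by field_simp
        _ < ‖v‖ * c := by gcongr; exact hv.1
        _ ≤ _ := by gcongr; exact hcb t ht _)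
  simpa [degreeIntegral] using key

/-- A homotopy is subdivided until consecutive stages are close; smooth approximations of consecutive
stages are then nowhere antipodal. -/
theorem degreeIntegral_eq_of_homotopic {φ : ℍ[ℝ] → ℝ} (hφ : ContDiff ℝ ∞ φ)
    (hφ0 : ∀ z, 2 < ‖z‖ → φ z = 0) {f g : C(S3, S3)} (hf : ContMDiff (𝓡 3) (𝓡 3) ∞ f)
    (hg : ContMDiff (𝓡 3) (𝓡 3) ∞ g) (h : f.Homotopic g) :
    degreeIntegral μ φ g = degreeIntegral μ φ f := by
  obtain ⟨H⟩ := h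
  have huc : UniformContinuous H := CompactSpace.uniformContinuous_of_continuous H.continuous
  obtain ⟨δ, hδ, hH⟩ := Metric.uniformContinuous_iff.1 huc (1 / 2) (by norm_num)
  obtain ⟨N, hN⟩ := exists_nat_gt (1 / δ)
  have hN0 : (0 : ℝ) < N := lt_trans (by positivity) hN
  set τ : ℕ → unitInterval := fun i => Set.projIcc (0 : ℝ) 1 zero_le_one (i / N) with hτ
  have hstep : ∀ i x, ‖(H (τ i, x) : ℍ[ℝ]) - H (τ (i + 1), x)‖ < 1 / 2 := by
    intro i x
    rw [← dist_eq_norm]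
    refine hH ?_
    rw [Prod.dist_eq, dist_self, max_lt_iff]
    refine ⟨?_, hδ⟩
    have h1 : dist (τ i) (τ (i + 1)) ≤ dist ((i : ℝ) / N) (((i + 1 : ℕ) : ℝ) / N) := by
      have := (LipschitzWith.projIcc (zero_le_one (α := ℝ))).dist_le_mul ((i : ℝ) / N)
        (((i + 1 : ℕ) : ℝ) / N)
      rwa [NNReal.coe_one, one_mul] at this
    refine h1.trans_lt ?_
    rw [Real.dist_eq, ← sub_div]
    push_cast
    rw [sub_add_cancel_left, abs_div, abs_neg, abs_one, abs_of_pos hN0]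
    rwa [one_div_lt hδ hN0] at hN
  have key : ∀ i : ℕ, ∀ k : C(S3, S3), ContMDiff (𝓡 3) (𝓡 3) ∞ k →
      (∀ x, ‖(k x : ℍ[ℝ]) - H (τ i, x)‖ ≤ 1 / 2) → degreeIntegral μ φ k = degreeIntegral μ φ f := by
    intro i
    induction i with
    | zero =>
      intro k hk hkH
      refine degreeIntegral_eq_of_ne_neg μ hφ hφ0 hf hk fun x => ne_neg_of_norm_sub_lt ?_
      have h0 : τ 0 = 0 := by simp [hτ, Set.projIcc_of_le_left]
      have := hkH x
      rw [h0, H.apply_zero] at this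
      rw [norm_sub_rev]
      linarith
    | succ i ih =>
      intro k hk hkH
      obtain ⟨k', hk', hk'H⟩ := exists_smooth_near ⟨fun x => H (τ i, x), by fun_prop⟩
        (by norm_num : (0 : ℝ) < 1 / 2)
      rw [← ih k' hk' hk'H]
      refine degreeIntegral_eq_of_ne_neg μ hφ hφ0 hk' hk fun x => ne_neg_of_norm_sub_lt ?_
      have h1 := norm_sub_le_norm_sub_add_norm_sub (k' x : ℍ[ℝ]) (H (τ i, x) : ℍ[ℝ]) (k x)
      have h2 := norm_sub_le_norm_sub_add_norm_sub (H (τ i, x) : ℍ[ℝ]) (H (τ (i + 1), x) : ℍ[ℝ]) (k x)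
      have h3 := hkH x
      rw [norm_sub_rev] at h3
      have h4 := hstep i x
      have h5 := hk'H x
      simp only [ContinuousMap.coe_mk] at h5
      linarith
  refine key N g hg fun x => ?_
  have h1 : τ N = 1 := by simp [hτ, div_self hN0.ne']
  rw [h1, H.apply_one]
  simp

/-- For `φ` supported near a regular value, the degree integral is the signed number of preimages
times the integral of `φ`. -/
theorem exists_degreeIntegral_eq {g : S3 → S3} (hg : ContMDiff (𝓡 3) (𝓡 3) ∞ g) {y : S3}
    {s : Finset S3} (hs : ∀ x, x ∈ s ↔ g x = y) (hd : ∀ x ∈ s, jacobianDet g x ≠ 0) :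
    ∃ δ > 0, ∀ φ : ℍ[ℝ] → ℝ, Integrable φ μ → (∀ z ∉ ball (y : ℍ[ℝ]) δ, φ z = 0) →
      degreeIntegral μ φ g =
        ((∑ x ∈ s, (SignType.sign (jacobianDet g x) : ℤ) : ℤ) : ℝ) * ∫ z, φ z ∂μ := by
  have hval : ∀ v, cutRadial g v = y → ∃ x ∈ s, (x : ℍ[ℝ]) = v := by
    intro v hv
    have h1 := norm_cutRadial_le g v
    rw [hv, norm_eq_of_mem_sphere] at h1
    rw [cutRadial_eq g (by linarith)] at hv
    have h2 := congrArg norm hv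
    rw [norm_radialExtension, norm_eq_of_mem_sphere] at h2
    refine ⟨⟨v, by simpa using h2⟩, (hs _).2 ?_, rfl⟩
    have h3 := radialExtension_coe g ⟨v, by simpa using h2⟩
    ext1
    rw [← h3]; exact hv
  have hKc : IsCompact (cutRadial g ⁻¹' closedBall (y : ℍ[ℝ]) 1) := by
    refine (isCompact_closedBall (0 : ℍ[ℝ]) 2).of_isClosed_subset
      (isClosed_closedBall.preimage (contDiff_cutRadial hg).continuous) ?_
    intro v hv
    rw [mem_closedBall_zero_iff]
    by_contra h
    rw [not_le] at h
    rw [Set.mem_preimage, mem_closedBall, dist_eq_norm, cutRadial_eq g (by linarith)] at hv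
    have h1 := norm_sub_norm_le (radialExtension g v) (y : ℍ[ℝ])
    rw [norm_radialExtension, norm_eq_of_mem_sphere] at h1
    linarith
  obtain ⟨δ, hδ, H⟩ := exists_integral_mul_det_eq_sum_sign μ
    ((contDiff_cutRadial hg).of_le (by simp)) (y := (y : ℍ[ℝ]))
    (s := s.map ⟨((↑) : S3 → ℍ[ℝ]), Subtype.val_injective⟩) (by
      intro v
      rw [Finset.mem_map]
      constructor
      · rintro ⟨x, hx, rfl⟩
        change cutRadial g (x : ℍ[ℝ]) = _
        rw [cutRadial_eq g (by rw [norm_eq_of_mem_sphere]; norm_num), radialExtension_coe,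
          (hs x).1 hx]
      · exact fun hv => hval v hv) hKc (by
      intro v hv
      obtain ⟨x, hx, rfl⟩ := Finset.mem_map.1 hv
      change LinearMap.det (fderiv ℝ (cutRadial g) (x : ℍ[ℝ]) : ℍ[ℝ] →ₗ[ℝ] ℍ[ℝ]) ≠ 0
      rw [det_fderiv_cutRadial]
      exact hd x hx)
  refine ⟨δ, hδ, fun φ h1 h2 => ?_⟩
  rw [degreeIntegral, H φ h1 h2, Finset.sum_map]
  simp only [Function.Embedding.coeFn_mk, det_fderiv_cutRadial]

end Integral

/-! ### The degree is well defined -/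

theorem joinedIn_S3 (x y : S3) : Joined x y := by
  have h : IsPathConnected (sphere (0 : ℍ[ℝ]) 1) := by
    refine isPathConnected_sphere ?_ 0 zero_le_one
    rw [← Module.finrank_eq_rank, Quaternion.finrank_eq_four]
    norm_num
  have : PathConnectedSpace S3 := isPathConnected_iff_pathConnectedSpace.1 h
  exact PathConnectedSpace.joined x y

theorem homotopic_mul {X : Type*} [TopologicalSpace X] {f f' g g' : C(X, S3)}
    (hf : f.Homotopic f') (hg : g.Homotopic g') : (f * g).Homotopic (f' * g') := by
  obtain ⟨F⟩ := hf
  obtain ⟨G⟩ := hg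
  exact ⟨⟨⟨fun p => F p * G p, by fun_prop⟩, by intro x; simp, by intro x; simp⟩⟩

theorem homotopic_const {X : Type*} [TopologicalSpace X] (a b : S3) :
    (ContinuousMap.const X a).Homotopic (ContinuousMap.const X b) := by
  obtain ⟨γ⟩ := joinedIn_S3 a b
  exact ⟨⟨⟨fun p => γ p.1, by fun_prop⟩, by intro x; simp, by intro x; simp⟩⟩

theorem homotopic_const_mul {X : Type*} [TopologicalSpace X] (a : S3) (g : C(X, S3)) :
    (ContinuousMap.const X a * g).Homotopic g := by
  have := homotopic_mul (homotopic_const (X := X) a 1) (ContinuousMap.Homotopic.refl g)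
  have h1 : ContinuousMap.const X (1 : S3) * g = g := by ext1 x; simp
  rwa [h1] at this

theorem phi_one_smul (a x : S3) : phi (a, 1) • x = a * x := by
  ext1
  rw [coe_smul_S3, phi_apply]
  simp

theorem HasDegree.homotopic {f g : C(S3, S3)} {n : ℤ} (h : HasDegree f n) (hfg : g.Homotopic f) :
    HasDegree g n := by
  obtain ⟨k, hk, h⟩ := h
  exact ⟨k, hfg.trans hk, h⟩

theorem contMDiff_mul_S3 {f g : S3 → S3} (hf : ContMDiff (𝓡 3) (𝓡 3) ∞ f)
    (hg : ContMDiff (𝓡 3) (𝓡 3) ∞ g) : ContMDiff (𝓡 3) (𝓡 3) ∞ (fun x => f x * g x) := by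
  have h1 : ContMDiff (𝓡 3) 𝓘(ℝ, ℍ[ℝ]) ∞ (fun x => (f x : ℍ[ℝ]) * (g x : ℍ[ℝ])) := by
    have hm : ContDiff ℝ ∞ (fun p : ℍ[ℝ] × ℍ[ℝ] => p.1 * p.2) := contDiff_mul
    exact hm.contMDiff.comp
      ((contMDiff_coe_sphere.comp hf).prodMk_space (contMDiff_coe_sphere.comp hg))
  have h2 := contMDiff_normalize_comp h1 fun x h => by
    have := congrArg norm h
    simp at this
  convert h2 using 1
  ext1 x
  rw [← Metric.unitSphere.coe_mul, normalize_coe]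

/-- The degree is a homotopy invariant; in particular it is unique. -/
theorem HasDegree.unique_of_homotopic {f f' : C(S3, S3)} (h : f.Homotopic f') {m n : ℤ}
    (hm : HasDegree f m) (hn : HasDegree f' n) : m = n := by
  obtain ⟨g₀, hg₀, hs₀, y₀, s₀, hy₀, hd₀, rfl⟩ := hm
  obtain ⟨g₁, hg₁, hs₁, y₁, s₁, hy₁, hd₁, rfl⟩ := hn
  let _ : MeasurableSpace ℍ[ℝ] := borel _
  have _ : BorelSpace ℍ[ℝ] := ⟨rfl⟩
  set μ : Measure ℍ[ℝ] := Measure.addHaar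
  -- rotate the second map so that both regular values agree
  set u : S3 := y₀ * y₁⁻¹ with hu
  set g₂ : C(S3, S3) := ContinuousMap.const S3 u * g₁ with hg₂
  have hg₂e : ⇑g₂ = fun x => phi (u, 1) • g₁ x := by ext1 x; rw [phi_one_smul]; rfl
  have hs₂ : ContMDiff (𝓡 3) (𝓡 3) ∞ g₂ := by
    rw [hg₂e]; exact (contMDiff_smul_S3 _).comp hs₁
  have hy₂ : ∀ x, x ∈ s₁ ↔ g₂ x = y₀ := by
    intro x
    rw [hy₁]
    change _ ↔ u * g₁ x = y₀
    rw [hu, mul_assoc, mul_eq_left, inv_mul_eq_one, eq_comm]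
  have hj₂ : ∀ x, jacobianDet g₂ x = LinearMap.det (phi (u, 1) : ℍ[ℝ] →ₗ[ℝ] ℍ[ℝ]) *
      jacobianDet g₁ x := by
    intro x; rw [hg₂e]; exact jacobianDet_smul_comp hs₁ _ x
  have hsig : ∀ x, SignType.sign (jacobianDet g₂ x) = SignType.sign (jacobianDet g₁ x) := by
    intro x
    rw [hj₂, sign_mul, sign_pos (det_phi_pos u 1), one_mul]
  have hd₂ : ∀ x ∈ s₁, jacobianDet g₂ x ≠ 0 := by
    intro x hx; rw [hj₂]; exact mul_ne_zero (det_phi_pos u 1).ne' (hd₁ x hx)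
  obtain ⟨δ₀, hδ₀, H₀⟩ := exists_degreeIntegral_eq μ hs₀ hy₀ hd₀
  obtain ⟨δ₂, hδ₂, H₂⟩ := exists_degreeIntegral_eq μ hs₂ hy₂ hd₂
  set δ : ℝ := min (min δ₀ δ₂) 1 with hδ
  have hδ0 : 0 < δ := by positivity
  let φ : ContDiffBump (y₀ : ℍ[ℝ]) := ⟨δ / 2, δ, by linarith, by linarith⟩
  have hφ0 : ∀ z, z ∉ ball (y₀ : ℍ[ℝ]) δ → φ z = 0 := by
    intro z hz
    exact φ.zero_of_le_dist (by simpa using hz)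
  have hb₀ : ball (y₀ : ℍ[ℝ]) δ ⊆ ball (y₀ : ℍ[ℝ]) δ₀ :=
    ball_subset_ball ((min_le_left _ _).trans (min_le_left _ _))
  have hb₂ : ball (y₀ : ℍ[ℝ]) δ ⊆ ball (y₀ : ℍ[ℝ]) δ₂ :=
    ball_subset_ball ((min_le_left _ _).trans (min_le_right _ _))
  have e₀ := H₀ φ φ.integrable fun z hz => hφ0 z fun h => hz (hb₀ h)
  have e₂ := H₂ φ φ.integrable fun z hz => hφ0 z fun h => hz (hb₂ h)
  have hhom : g₀.Homotopic g₂ :=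
    hg₀.symm.trans (h.trans (hg₁.trans (homotopic_const_mul u g₁).symm))
  have e := degreeIntegral_eq_of_homotopic μ (φ := φ) φ.contDiff (fun z hz => hφ0 z (by
    rw [mem_ball, not_lt, dist_eq_norm]
    have h1 := norm_sub_norm_le z (y₀ : ℍ[ℝ])
    rw [norm_eq_of_mem_sphere] at h1
    have : δ ≤ 1 := min_le_right _ _
    linarith)) hs₀ hs₂ hhom
  rw [e₀, e₂] at e
  have h1 := mul_right_cancel₀ (φ.integral_pos (μ := μ)).ne' e
  rw [← Int.cast_inj (α := ℝ), ← h1]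
  simp only [hsig]

/-! ### Regular values -/

/-- Sard's theorem for smooth self-maps of `S³`. -/
theorem exists_regular_value {g : S3 → S3} (hg : ContMDiff (𝓡 3) (𝓡 3) ∞ g) {U : Set S3}
    (hU : IsOpen U) (hne : U.Nonempty) :
    ∃ y ∈ U, ∀ x, g x = y → jacobianDet g x ≠ 0 := by
  let _ : MeasurableSpace ℍ[ℝ] := borel _
  have _ : BorelSpace ℍ[ℝ] := ⟨rfl⟩
  set μ : Measure ℍ[ℝ] := Measure.addHaar
  by_contra! hcon
  -- The critical values of the radial extension form a null set. Were all values in `U` critical,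
  -- it would contain the open cone over `U`.
  set G := radialExtension g with hG
  set C : Set ℍ[ℝ] := {v | v ≠ 0 ∧ LinearMap.det (fderiv ℝ G v : ℍ[ℝ] →ₗ[ℝ] ℍ[ℝ]) = 0} with hC
  have h0 : μ (G '' C) = 0 := addHaar_image_eq_zero_of_det_fderivWithin_eq_zero μ
    (f' := fderiv ℝ G)
    (fun v hv => (differentiableAt_radialExtension hg hv.1).hasFDerivAt.hasFDerivWithinAt)
    (fun v hv => hv.2)
  set W : Set ℍ[ℝ] := {v | v ≠ 0 ∧ normalize v ∈ U} with hW
  have hWo : IsOpen W := by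
    rw [isOpen_iff_mem_nhds]
    rintro v ⟨hv, hvU⟩
    filter_upwards [isOpen_ne.mem_nhds hv,
      (continuousAt_normalize hv).preimage_mem_nhds (hU.mem_nhds hvU)] with w h1 h2 using ⟨h1, h2⟩
  have hWne : W.Nonempty := by
    obtain ⟨y, hy⟩ := hne
    exact ⟨y, ne_zero_of_mem_unit_sphere y, by simpa using hy⟩
  have hsub : W ⊆ G '' C := by
    rintro v ⟨hv, hvU⟩
    obtain ⟨x, hx, hj⟩ := hcon _ hvU
    have hn : 0 < ‖v‖ := norm_pos_iff.2 hv
    refine ⟨‖v‖ • (x : ℍ[ℝ]), ⟨smul_ne_zero hn.ne' (ne_zero_of_mem_unit_sphere x), ?_⟩, ?_⟩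
    · -- the derivative of a map homogeneous of degree one is homogeneous of degree zero
      have h1 : HasFDerivAt G (fderiv ℝ G (x : ℍ[ℝ])) (‖v‖ • (x : ℍ[ℝ])) := by
        have h2 : G = fun w => ‖v‖ • G (‖v‖⁻¹ • w) := by
          ext1 w
          rw [hG, ← radialExtension_smul g hn, smul_smul, mul_inv_cancel₀ hn.ne', one_smul]
        have h3 : HasFDerivAt G (fderiv ℝ G (x : ℍ[ℝ])) (‖v‖⁻¹ • (‖v‖ • (x : ℍ[ℝ]))) := by
          rw [smul_smul, inv_mul_cancel₀ hn.ne', one_smul]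
          exact (differentiableAt_radialExtension hg (ne_zero_of_mem_unit_sphere x)).hasFDerivAt
        have h4 : HasFDerivAt (fun w : ℍ[ℝ] => ‖v‖⁻¹ • w) (‖v‖⁻¹ • ContinuousLinearMap.id ℝ ℍ[ℝ])
          (‖v‖ • (x : ℍ[ℝ])) := (hasFDerivAt_id (𝕜 := ℝ) (‖v‖ • (x : ℍ[ℝ]))).const_smul ‖v‖⁻¹
        have h5 := (h3.comp (‖v‖ • (x : ℍ[ℝ])) h4).const_smul ‖v‖
        have h6 : ‖v‖ • (fderiv ℝ G (x : ℍ[ℝ])).comp (‖v‖⁻¹ • ContinuousLinearMap.id ℝ ℍ[ℝ]) =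
            fderiv ℝ G (x : ℍ[ℝ]) := by
          ext1 w
          change ‖v‖ • fderiv ℝ G (x : ℍ[ℝ]) (‖v‖⁻¹ • w) = _
          rw [map_smul, smul_smul, mul_inv_cancel₀ hn.ne', one_smul]
        rw [h6] at h5
        exact h5.congr_of_eventuallyEq (Filter.Eventually.of_forall fun w => congrFun h2 w)
      rw [h1.fderiv]; exact hj
    · rw [hG, radialExtension_smul g hn, radialExtension_coe, hx, norm_smul_normalize]
  exact (hWo.measure_pos μ hWne).ne' (measure_mono_null hsub h0)

/-- Regular preimages are isolated, so by compactness there are finitely many. -/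
theorem finite_preimage_of_regular {g : S3 → S3} (hg : ContMDiff (𝓡 3) (𝓡 3) ∞ g) {y : S3}
    (hy : ∀ x, g x = y → jacobianDet g x ≠ 0) : {x | g x = y}.Finite := by
  by_contra hinf
  have hinf : {x | g x = y}.Infinite := hinf
  have hcl : IsClosed {x | g x = y} := isClosed_eq hg.continuous continuous_const
  obtain ⟨x, hx, hacc⟩ := hinf.exists_accPt_of_subset_isCompact hcl.isCompact subset_rfl
  have h1 := (differentiableAt_radialExtension hg (ne_zero_of_mem_unit_sphere x)).hasFDerivAt
  have h2 : ∃ C, AntilipschitzWith C (fderiv ℝ (radialExtension g) (x : ℍ[ℝ])) := by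
    obtain ⟨K, -, hK⟩ := LinearMap.exists_antilipschitzWith
      (fderiv ℝ (radialExtension g) (x : ℍ[ℝ]) : ℍ[ℝ] →ₗ[ℝ] ℍ[ℝ])
      (LinearMap.ker_eq_bot.2 (LinearMap.equivOfDetNeZero _ (hy x hx)).injective)
    exact ⟨K, hK⟩
  have h3 := h1.eventually_ne (c := (y : ℍ[ℝ])) h2
  have h4 : ∀ᶠ z in 𝓝[≠] x, g z ≠ y := by
    have ht : Filter.Tendsto ((↑) : S3 → ℍ[ℝ]) (𝓝[≠] x) (𝓝[≠] (x : ℍ[ℝ])) :=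
      tendsto_nhdsWithin_of_tendsto_nhds_of_eventually_within _
        (continuous_subtype_val.continuousAt.mono_left nhdsWithin_le_nhds)
        (by filter_upwards [self_mem_nhdsWithin] with z hz using fun h => hz (Subtype.ext h))
    filter_upwards [ht.eventually h3] with z hz h
    exact hz (by rw [radialExtension_coe, h])
  rw [accPt_iff_frequently_nhdsNE] at hacc
  exact hacc h4

/-- The regular value that computes the degree can be chosen in any nonempty open set. -/
theorem exists_hasDegree_of_smooth {g : C(S3, S3)} (hg : ContMDiff (𝓡 3) (𝓡 3) ∞ g) {U : Set S3}
    (hU : IsOpen U) (hne : U.Nonempty) :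
    ∃ y ∈ U, ∃ s : Finset S3, (∀ x, x ∈ s ↔ g x = y) ∧ (∀ x ∈ s, jacobianDet g x ≠ 0) ∧
      HasDegree g (∑ x ∈ s, (SignType.sign (jacobianDet g x) : ℤ)) := by
  obtain ⟨y, hyU, hy⟩ := exists_regular_value hg hU hne
  have hfin := finite_preimage_of_regular hg hy
  have hs : ∀ x, x ∈ hfin.toFinset ↔ g x = y := fun x => by simp
  have hd : ∀ x ∈ hfin.toFinset, jacobianDet g x ≠ 0 := fun x hx => hy x ((hs x).1 hx)
  exact ⟨y, hyU, hfin.toFinset, hs, hd, g, .refl g, hg, y, _, hs, hd, rfl⟩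

theorem exists_hasDegree (f : C(S3, S3)) : ∃ n, HasDegree f n := by
  obtain ⟨g, hg, hgf⟩ := exists_smooth_near f one_pos
  obtain ⟨y, -, s, -, -, h⟩ := exists_hasDegree_of_smooth hg isOpen_univ Set.univ_nonempty
  refine ⟨_, h.homotopic (homotopic_of_forall_ne_neg f g fun x => ne_neg_of_norm_sub_lt ?_)⟩
  rw [norm_sub_rev]
  linarith [hgf x]

theorem hasDegree_const (a : S3) : HasDegree (ContinuousMap.const S3 a) 0 := by
  refine ⟨_, .refl _, contMDiff_const, -a, ∅, fun x => ?_, by simp, by simp⟩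
  simp only [Finset.notMem_empty, ContinuousMap.const_apply, false_iff]
  intro h
  exact ne_neg_of_norm_sub_lt (x := a) (y := a) (by simp) (congrArg Subtype.val h)

theorem hasDegree_id : HasDegree (ContinuousMap.id S3) 1 := by
  have hj : ∀ x, jacobianDet (ContinuousMap.id S3) x = 1 := by
    intro x
    have : radialExtension (ContinuousMap.id S3) = id := by
      ext1 v; rw [radialExtension_eq]; exact norm_smul_normalize v
    rw [jacobianDet, this, fderiv_id]
    exact LinearMap.det_id
  exact ⟨_, .refl _, contMDiff_id, 1, {1}, by simp, fun x _ => by rw [hj]; norm_num,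
    by rw [Finset.sum_singleton, hj]; simp⟩

theorem jacobianDet_congr {f g : S3 → S3} {x : S3} (h : f =ᶠ[𝓝 x] g) :
    jacobianDet f x = jacobianDet g x := by
  have h1 : radialExtension f =ᶠ[𝓝 (x : ℍ[ℝ])] radialExtension g := by
    have hc := continuousAt_normalize (ne_zero_of_mem_unit_sphere x)
    have h2 : ∀ᶠ z in 𝓝 (normalize (x : ℍ[ℝ])), f z = g z := by rwa [normalize_coe]
    filter_upwards [hc.eventually h2] with v hv
    rw [radialExtension_eq, radialExtension_eq, hv]
  rw [jacobianDet, jacobianDet, h1.fderiv_eq]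

/-! ### Additivity of the degree -/

/-- A smooth map homotopic to the identity that sends a neighbourhood of a closed hemisphere to a
point. -/
theorem exists_smooth_collapse : ∃ c : C(S3, S3), ContMDiff (𝓡 3) (𝓡 3) ∞ c ∧
    c.Homotopic (ContinuousMap.id S3) ∧ ∀ x : S3, (x : ℍ[ℝ]).re < 1 / 4 → c x = -1 := by
  -- The map is the radial projection of `ψ(x) x + (1 - ψ(x)) (-1)`, where the cutoff `ψ` vanishes for
  -- `Re x ≤ 1/4` and is `1` for `Re x ≥ 1/2`.
  set ψ : S3 → ℝ := fun x => Real.smoothTransition (4 * (x : ℍ[ℝ]).re - 1) with hψ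
  have hre : ContDiff ℝ ∞ (fun v : ℍ[ℝ] => v.re) := by
    have : (fun v : ℍ[ℝ] => v.re) = fun v : ℍ[ℝ] => inner ℝ (1 : ℍ[ℝ]) v := by
      ext1 v; simp [Quaternion.inner_def]
    rw [this]
    exact contDiff_const.inner ℝ contDiff_id
  have hψs : ContMDiff (𝓡 3) 𝓘(ℝ, ℝ) ∞ ψ := by
    have : ContDiff ℝ ∞ (fun v : ℍ[ℝ] => Real.smoothTransition (4 * v.re - 1)) :=
      Real.smoothTransition.contDiff.comp ((contDiff_const.mul hre).sub contDiff_const)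
    exact this.contMDiff.comp contMDiff_coe_sphere
  have hF : ContMDiff (𝓡 3) 𝓘(ℝ, ℍ[ℝ]) ∞ fun x => ψ x • (x : ℍ[ℝ]) - (1 - ψ x) • (1 : ℍ[ℝ]) :=
    (hψs.smul contMDiff_coe_sphere).sub ((contMDiff_const.sub hψs).smul contMDiff_const)
  have h01 : ∀ x, 0 ≤ ψ x ∧ ψ x ≤ 1 := fun x =>
    ⟨Real.smoothTransition.nonneg _, Real.smoothTransition.le_one _⟩
  have hcoll : ∀ (x : S3) (t : ℝ), t • (x : ℍ[ℝ]) - (1 - t) • (1 : ℍ[ℝ]) = 0 → 0 ≤ t → t ≤ 1 →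
      x = 1 ∧ t = 1 / 2 := by
    intro x t h h0 h1
    have h2 := sub_eq_zero.1 h
    have h3 := congrArg norm h2
    rw [norm_smul, norm_smul, norm_eq_of_mem_sphere, norm_one, Real.norm_of_nonneg h0,
      Real.norm_of_nonneg (sub_nonneg.2 h1)] at h3
    have ht : t = 1 / 2 := by linarith
    refine ⟨?_, ht⟩
    rw [ht] at h2
    ext1
    refine smul_right_injective _ (by norm_num : (1 / 2 : ℝ) ≠ 0) ?_
    norm_num at h2 ⊢
    exact h2
  have hψ1 : ψ 1 = 1 := Real.smoothTransition.one_of_one_le (by simp; norm_num)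
  have hF0 : ∀ x, ψ x • (x : ℍ[ℝ]) - (1 - ψ x) • (1 : ℍ[ℝ]) ≠ 0 := by
    intro x h
    obtain ⟨rfl, h2⟩ := hcoll x _ h (h01 x).1 (h01 x).2
    rw [hψ1] at h2
    norm_num at h2
  have hc := contMDiff_normalize_comp hF hF0
  refine ⟨⟨_, hc.continuous⟩, hc, homotopic_of_forall_ne_neg _ _ fun x h => ?_, fun x hx => ?_⟩
  · simp only [ContinuousMap.coe_mk, ContinuousMap.id_apply] at h
    have hn := norm_pos_iff.2 (hF0 x)
    rw [coe_normalize (hF0 x), inv_smul_eq_iff₀ hn.ne'] at h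
    set N := ‖ψ x • (x : ℍ[ℝ]) - (1 - ψ x) • (1 : ℍ[ℝ])‖ with hN
    have h2 : (ψ x + N) • (x : ℍ[ℝ]) = (1 - ψ x) • (1 : ℍ[ℝ]) := by
      rw [add_smul, ← sub_eq_zero]
      rw [smul_neg, ← sub_eq_zero] at h
      refine Eq.trans ?_ h; abel
    have h3 := congrArg norm h2
    have := h01 x
    rw [norm_smul, norm_smul, norm_eq_of_mem_sphere, norm_one, Real.norm_of_nonneg (by linarith),
      Real.norm_of_nonneg (by linarith), mul_one, mul_one] at h3
    have hpos : 1 - ψ x ≠ 0 := by linarith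
    rw [h3] at h2
    have h4 : x = 1 := Subtype.ext (smul_right_injective _ hpos h2)
    rw [h4, hψ1] at h3
    rw [h4, hψ1] at hpos
    exact hpos (by ring)
  · have : ψ x = 0 := Real.smoothTransition.zero_of_nonpos (by linarith)
    simp only [ContinuousMap.coe_mk, this, zero_smul, zero_sub, sub_zero, one_smul]
    exact normalize_coe (-1 : S3)

/-- The degree turns pointwise products of maps `S³ → S³` into sums: push the two maps to opposite
hemispheres, where the product is one of the factors. -/
theorem HasDegree.mul {f₁ f₂ : C(S3, S3)} {m n : ℤ} (h₁ : HasDegree f₁ m) (h₂ : HasDegree f₂ n) :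
    HasDegree (f₁ * f₂) (m + n) := by
  classical
  obtain ⟨g₁, hg₁, hs₁, -⟩ := id h₁
  obtain ⟨g₂, hg₂, hs₂, -⟩ := id h₂
  obtain ⟨c, hcs, hci, hc⟩ := exists_smooth_collapse
  -- `k₁` and `k₂` are homotopic to `f₁` and `f₂`, and equal to `1` on the hemispheres `Re x < 1/4` and
  -- `Re x > -1/4` respectively.
  let ν : C(S3, S3) := ⟨fun x => -x, continuous_neg⟩
  have hνs : ContMDiff (𝓡 3) (𝓡 3) ∞ ν := contMDiff_neg_sphere
  set k₁ : C(S3, S3) := ContinuousMap.const S3 (g₁ (-1))⁻¹ * g₁.comp c with hk₁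
  set k₂ : C(S3, S3) := ContinuousMap.const S3 (g₂ 1)⁻¹ * g₂.comp (ν.comp (c.comp ν)) with hk₂
  have hk₁s : ContMDiff (𝓡 3) (𝓡 3) ∞ k₁ := contMDiff_mul_S3 contMDiff_const (hs₁.comp hcs)
  have hk₂s : ContMDiff (𝓡 3) (𝓡 3) ∞ k₂ :=
    contMDiff_mul_S3 contMDiff_const (hs₂.comp (hνs.comp (hcs.comp hνs)))
  have hkg₁ : k₁.Homotopic f₁ := by
    refine (homotopic_const_mul _ _).trans (ContinuousMap.Homotopic.trans ?_ hg₁.symm)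
    exact (ContinuousMap.Homotopic.refl g₁).comp hci
  have hkg₂ : k₂.Homotopic f₂ := by
    refine (homotopic_const_mul _ _).trans (ContinuousMap.Homotopic.trans ?_ hg₂.symm)
    have h1 : (ν.comp (c.comp ν)).Homotopic (ν.comp ((ContinuousMap.id S3).comp ν)) :=
      (ContinuousMap.Homotopic.refl ν).comp (hci.comp (ContinuousMap.Homotopic.refl ν))
    have h2 : ν.comp ((ContinuousMap.id S3).comp ν) = ContinuousMap.id S3 := by
      ext1 x; exact neg_neg x
    rw [h2] at h1
    exact (ContinuousMap.Homotopic.refl g₂).comp h1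
  have hone₁ : ∀ x : S3, (x : ℍ[ℝ]).re < 1 / 4 → k₁ x = 1 := by
    intro x hx
    change (g₁ (-1))⁻¹ * g₁ (c x) = 1
    rw [hc x hx, inv_mul_cancel]
  have hone₂ : ∀ x : S3, -(1 / 4) < (x : ℍ[ℝ]).re → k₂ x = 1 := by
    intro x hx
    change (g₂ 1)⁻¹ * g₂ (-(c (-x))) = 1
    have h1 : c (-x) = -1 := hc (-x) (by simp; linarith)
    rw [h1, neg_neg, inv_mul_cancel]
  have hreo : Continuous fun x : S3 => (x : ℍ[ℝ]).re :=
    Quaternion.continuous_re.comp continuous_subtype_val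
  have hev₁ : ∀ x : S3, -(1 / 4) < (x : ℍ[ℝ]).re → ⇑(k₁ * k₂) =ᶠ[𝓝 x] k₁ := by
    intro x hx
    filter_upwards [(isOpen_lt continuous_const hreo).mem_nhds hx] with z hz
    simp [hone₂ z hz]
  have hev₂ : ∀ x : S3, (x : ℍ[ℝ]).re < 1 / 4 → ⇑(k₁ * k₂) =ᶠ[𝓝 x] k₂ := by
    intro x hx
    filter_upwards [(isOpen_lt hreo continuous_const).mem_nhds hx] with z hz
    simp [hone₁ z hz]
  have hks : ContMDiff (𝓡 3) (𝓡 3) ∞ (k₁ * k₂) := contMDiff_mul_S3 hk₁s hk₂s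
  obtain ⟨y, hy1, s, hs, hd, hdeg⟩ := exists_hasDegree_of_smooth hks (U := {1}ᶜ)
    isOpen_compl_singleton ⟨-1, fun h => ne_neg_of_norm_sub_lt (x := (1 : S3)) (y := 1) (by simp)
      (congrArg Subtype.val h).symm⟩
  have hre₁ : ∀ x, k₁ x = y → 1 / 4 ≤ (x : ℍ[ℝ]).re := fun x hx => by
    by_contra! h; exact hy1 (hx.symm.trans (hone₁ x h))
  have hre₂ : ∀ x, k₂ x = y → (x : ℍ[ℝ]).re ≤ -(1 / 4) := fun x hx => by
    by_contra! h; exact hy1 (hx.symm.trans (hone₂ x h))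
  have hmem : ∀ x, x ∈ s ↔ k₁ x = y ∨ k₂ x = y := by
    intro x
    rw [hs]
    constructor
    · intro h
      rw [ContinuousMap.mul_apply] at h
      rcases lt_or_ge (-(1 / 4)) (x : ℍ[ℝ]).re with hx | hx
      · left; rwa [hone₂ x hx, mul_one] at h
      · right; rwa [hone₁ x (by linarith), one_mul] at h
    · rintro (h | h)
      · have := hre₁ x h
        rw [ContinuousMap.mul_apply, hone₂ x (by linarith), mul_one, h]
      · have := hre₂ x h
        rw [ContinuousMap.mul_apply, hone₁ x (by linarith), one_mul, h]
  set s₁ := s.filter fun x => k₁ x = y with hs₁d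
  set s₂ := s.filter fun x => ¬ k₁ x = y with hs₂d
  have hm₁ : ∀ x, x ∈ s₁ ↔ k₁ x = y := fun x => by
    rw [hs₁d, Finset.mem_filter, hmem]; tauto
  have hm₂ : ∀ x, x ∈ s₂ ↔ k₂ x = y := fun x => by
    rw [hs₂d, Finset.mem_filter, hmem]
    refine ⟨by tauto, fun h => ⟨Or.inr h, fun h' => ?_⟩⟩
    linarith [hre₁ x h', hre₂ x h]
  have hj₁ : ∀ x ∈ s₁, jacobianDet (k₁ * k₂ : C(S3, S3)) x = jacobianDet k₁ x := fun x hx =>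
    jacobianDet_congr (hev₁ x (by linarith [hre₁ x ((hm₁ x).1 hx)]))
  have hj₂ : ∀ x ∈ s₂, jacobianDet (k₁ * k₂ : C(S3, S3)) x = jacobianDet k₂ x := fun x hx =>
    jacobianDet_congr (hev₂ x (by linarith [hre₂ x ((hm₂ x).1 hx)]))
  have hdk₁ : HasDegree k₁ (∑ x ∈ s₁, (SignType.sign (jacobianDet k₁ x) : ℤ)) :=
    ⟨k₁, .refl _, hk₁s, y, s₁, hm₁, fun x hx => by
      rw [← hj₁ x hx]; exact hd x (Finset.mem_filter.1 hx).1, rfl⟩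
  have hdk₂ : HasDegree k₂ (∑ x ∈ s₂, (SignType.sign (jacobianDet k₂ x) : ℤ)) :=
    ⟨k₂, .refl _, hk₂s, y, s₂, hm₂, fun x hx => by
      rw [← hj₂ x hx]; exact hd x (Finset.mem_filter.1 hx).1, rfl⟩
  have e₁ := HasDegree.unique_of_homotopic hkg₁ hdk₁ h₁
  have e₂ := HasDegree.unique_of_homotopic hkg₂ hdk₂ h₂
  have hsum : ∑ x ∈ s, (SignType.sign (jacobianDet (k₁ * k₂ : C(S3, S3)) x) : ℤ) = m + n := by
    rw [← e₁, ← e₂, ← Finset.sum_filter_add_sum_filter_not s (fun x => k₁ x = y)]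
    congr 1
    · exact Finset.sum_congr rfl fun x hx => by rw [hj₁ x hx]
    · exact Finset.sum_congr rfl fun x hx => by rw [hj₂ x hx]
  rw [hsum] at hdeg
  exact hdeg.homotopic (homotopic_mul hkg₁ hkg₂).symm

/-- A map `S³ → S³` invariant under a finite group acting freely by rotations has degree divisible
by the order of the group: preimages of a regular value come in free orbits. -/
theorem HasDegree.card_dvd {K : Type*} [Group K] [Finite K] (ρ : K →* O4)
    (hfree : ∀ k, ∀ x : S3, ρ k • x = x → k = 1)
    (hdet : ∀ k, 0 < LinearMap.det (ρ k : ℍ[ℝ] →ₗ[ℝ] ℍ[ℝ])) {q : C(S3, S3)}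
    (hq : ∀ k x, q (ρ k • x) = q x) {n : ℤ} (hn : HasDegree q n) : (Nat.card K : ℤ) ∣ n := by
  classical
  have := Fintype.ofFinite K
  obtain ⟨g, hg, hgi, hgq⟩ := exists_smooth_near_of_invariant ρ q hq one_pos
  obtain ⟨y, -, s, hs, hd, h⟩ := exists_hasDegree_of_smooth hg isOpen_univ Set.univ_nonempty
  have e := HasDegree.unique_of_homotopic (homotopic_of_forall_ne_neg q g fun x =>
    ne_neg_of_norm_sub_lt (by rw [norm_sub_rev]; linarith [hgq x])) hn h
  rw [e]
  have hsign : ∀ k x, SignType.sign (jacobianDet g (ρ k • x)) = SignType.sign (jacobianDet g x) := by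
    intro k x
    have h1 := jacobianDet_comp_smul hg (ρ k) x
    have h2 : (fun x => g (ρ k • x)) = g := funext fun x => hgi k x
    rw [h2] at h1
    rw [h1, sign_mul, sign_pos (hdet k), mul_one]
  have horb : ∀ x ∈ s, ∑ z ∈ s with (∃ k, z = ρ k • x), (SignType.sign (jacobianDet g z) : ℤ) =
      Nat.card K * (SignType.sign (jacobianDet g x) : ℤ) := by
    intro x hx
    have h1 : s.filter (fun z => ∃ k, z = ρ k • x) = Finset.univ.image fun k => ρ k • x := by
      ext z
      simp only [Finset.mem_filter, Finset.mem_image, Finset.mem_univ, true_and]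
      constructor
      · rintro ⟨-, k, rfl⟩; exact ⟨k, rfl⟩
      · rintro ⟨k, rfl⟩
        exact ⟨(hs _).2 (by rw [hgi]; exact (hs x).1 hx), k, rfl⟩
    have hinj : Function.Injective fun k => ρ k • x := by
      intro a b hab
      have : ρ (b⁻¹ * a) • x = x := by
        rw [map_mul, mul_smul]
        rw [show ρ a • x = ρ b • x from hab, ← mul_smul, ← map_mul, inv_mul_cancel, map_one, one_smul]
      have := hfree _ x this
      rw [inv_mul_eq_one] at this
      exact this.symm
    rw [h1, Finset.sum_image fun a _ b _ hab => hinj hab]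
    simp [hsign]
  -- group the preimages by orbit
  set r : S3 → Set S3 := fun x => Set.range fun k => ρ k • x with hr
  have hrr : ∀ x z, r z = r x ↔ ∃ k, z = ρ k • x := by
    intro x z
    constructor
    · intro h
      have : z ∈ r z := ⟨1, by simp⟩
      rw [h] at this
      obtain ⟨k, hk⟩ := this
      exact ⟨k, hk.symm⟩
    · rintro ⟨k, rfl⟩
      ext w
      constructor
      · rintro ⟨l, rfl⟩; exact ⟨l * k, by simp [mul_smul]⟩
      · rintro ⟨l, rfl⟩; exact ⟨l * k⁻¹, by simp [mul_smul]⟩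
  rw [← Finset.sum_fiberwise_of_maps_to (t := s.image r) (g := r)
    fun x hx => Finset.mem_image_of_mem _ hx]
  refine Finset.dvd_sum fun b hb => ?_
  obtain ⟨x, hx, rfl⟩ := Finset.mem_image.1 hb
  simp only [hrr]
  rw [horb x hx]
  exact dvd_mul_right _ _

/-! ### The adjoint representation `S³ → SO(3)` -/

theorem imUnit_re (a : Fin 3) : (imUnit a).re = 0 := by fin_cases a <;> rfl

theorem imUnit_imI (a : Fin 3) : (imUnit a).imI = ![1, 0, 0] a := by fin_cases a <;> rfl

theorem imUnit_imJ (a : Fin 3) : (imUnit a).imJ = ![0, 1, 0] a := by fin_cases a <;> rfl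

theorem imUnit_imK (a : Fin 3) : (imUnit a).imK = ![0, 0, 1] a := by fin_cases a <;> rfl

theorem inner_imUnit (a : Fin 3) (w : ℍ[ℝ]) : inner ℝ (imUnit a) w = ![w.imI, w.imJ, w.imK] a := by
  rw [Quaternion.inner_def, Quaternion.re_mul, Quaternion.re_star, Quaternion.imI_star,
    Quaternion.imJ_star, Quaternion.imK_star]
  rw [imUnit_re, imUnit_imI, imUnit_imJ, imUnit_imK]
  fin_cases a <;> simp

theorem inner_imUnit_imUnit (a b : Fin 3) :
    inner ℝ (imUnit a) (imUnit b) = if a = b then 1 else 0 := by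
  rw [inner_imUnit]
  rw [imUnit_imI, imUnit_imJ, imUnit_imK]
  fin_cases a <;> fin_cases b <;> simp

theorem re_sum_smul_imUnit (c : Fin 3 → ℝ) : (∑ a, c a • imUnit a).re = 0 := by
  simp [Fin.sum_univ_three, Quaternion.re_add, Quaternion.re_smul, imUnit_re]

theorem imI_sum_smul_imUnit (c : Fin 3 → ℝ) : (∑ a, c a • imUnit a).imI = c 0 := by
  simp [Fin.sum_univ_three, Quaternion.imI_add, Quaternion.imI_smul, imUnit_imI]

theorem imJ_sum_smul_imUnit (c : Fin 3 → ℝ) : (∑ a, c a • imUnit a).imJ = c 1 := by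
  simp [Fin.sum_univ_three, Quaternion.imJ_add, Quaternion.imJ_smul, imUnit_imJ]

theorem imK_sum_smul_imUnit (c : Fin 3 → ℝ) : (∑ a, c a • imUnit a).imK = c 2 := by
  simp [Fin.sum_univ_three, Quaternion.imK_add, Quaternion.imK_smul, imUnit_imK]

/-- A purely imaginary quaternion is determined by its coordinates. -/
theorem sum_inner_imUnit_smul {w : ℍ[ℝ]} (hw : w.re = 0) :
    ∑ a, (inner ℝ (imUnit a) w : ℝ) • imUnit a = w := by
  ext
  · rw [re_sum_smul_imUnit, hw]
  · rw [imI_sum_smul_imUnit, inner_imUnit]; rfl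
  · rw [imJ_sum_smul_imUnit, inner_imUnit]; rfl
  · rw [imK_sum_smul_imUnit, inner_imUnit]; rfl

theorem coe_inv_S3 (q : S3) : ((q⁻¹ : S3) : ℍ[ℝ]) = star (q : ℍ[ℝ]) := by
  have h : (q : ℍ[ℝ]) * star (q : ℍ[ℝ]) = 1 := by
    rw [Quaternion.self_mul_star, Quaternion.normSq_eq_norm_mul_self, norm_eq_of_mem_sphere]
    simp
  have h2 : ((q⁻¹ : S3) : ℍ[ℝ]) * (q : ℍ[ℝ]) = 1 := by
    rw [← Metric.unitSphere.coe_mul]; simp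
  calc ((q⁻¹ : S3) : ℍ[ℝ]) = ((q⁻¹ : S3) : ℍ[ℝ]) * ((q : ℍ[ℝ]) * star (q : ℍ[ℝ])) := by rw [h, mul_one]
    _ = star (q : ℍ[ℝ]) := by rw [← mul_assoc, h2, one_mul]

theorem coe_mul_inv_S3 (q : S3) : (q : ℍ[ℝ]) * ((q⁻¹ : S3) : ℍ[ℝ]) = 1 := by
  rw [← Metric.unitSphere.coe_mul]; simp

theorem coe_inv_mul_S3 (q : S3) : ((q⁻¹ : S3) : ℍ[ℝ]) * (q : ℍ[ℝ]) = 1 := by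
  rw [← Metric.unitSphere.coe_mul]; simp

theorem re_conj (q : S3) (w : ℍ[ℝ]) : ((q : ℍ[ℝ]) * w * ((q⁻¹ : S3) : ℍ[ℝ])).re = w.re := by
  have h : ∀ a b : ℍ[ℝ], (a * b).re = (b * a).re := fun a b => by
    rw [Quaternion.re_mul, Quaternion.re_mul]; ring
  rw [h, ← mul_assoc, coe_inv_mul_S3, one_mul]

theorem conj_imUnit (q : S3) (b : Fin 3) :
    (q : ℍ[ℝ]) * imUnit b * ((q⁻¹ : S3) : ℍ[ℝ]) = ∑ a, adMatrix q a b • imUnit a :=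
  (sum_inner_imUnit_smul (by rw [re_conj, imUnit_re])).symm

theorem adMatrix_eq_of_conj {q : S3} {M : Matrix (Fin 3) (Fin 3) ℝ}
    (h : ∀ b, (q : ℍ[ℝ]) * imUnit b * ((q⁻¹ : S3) : ℍ[ℝ]) = ∑ a, M a b • imUnit a) :
    adMatrix q = M := by
  ext a b
  rw [adMatrix, Matrix.of_apply, h]
  simp [inner_sum, inner_smul_right, inner_imUnit_imUnit]

theorem adMatrix_one : adMatrix 1 = 1 := by
  refine adMatrix_eq_of_conj fun b => ?_
  simp [Matrix.one_apply]

theorem adMatrix_mul (p q : S3) : adMatrix (p * q) = adMatrix p * adMatrix q := by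
  refine adMatrix_eq_of_conj fun b => ?_
  have h1 : ((p * q : S3) : ℍ[ℝ]) * imUnit b * (((p * q)⁻¹ : S3) : ℍ[ℝ]) =
      (p : ℍ[ℝ]) * ((q : ℍ[ℝ]) * imUnit b * ((q⁻¹ : S3) : ℍ[ℝ])) * ((p⁻¹ : S3) : ℍ[ℝ]) := by
    rw [mul_inv_rev, Metric.unitSphere.coe_mul, Metric.unitSphere.coe_mul]
    simp only [mul_assoc]
  rw [h1, conj_imUnit q, Finset.mul_sum, Finset.sum_mul]
  simp only [mul_smul_comm, smul_mul_assoc, conj_imUnit p, Finset.smul_sum, smul_smul,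
    Matrix.mul_apply, Finset.sum_smul]
  rw [Finset.sum_comm]
  simp only [mul_comm]

theorem coe_neg_S3 (q : S3) : ((-q : S3) : ℍ[ℝ]) = -(q : ℍ[ℝ]) := rfl

theorem adMatrix_neg (q : S3) : adMatrix (-q) = adMatrix q := by
  ext a b
  simp only [adMatrix, Matrix.of_apply, coe_inv_S3, coe_neg_S3, star_neg, neg_mul, mul_neg, neg_neg]

theorem continuous_adMatrix : Continuous adMatrix := by
  refine continuous_matrix fun a b => ?_
  simp only [adMatrix, Matrix.of_apply, coe_inv_S3]
  exact continuous_const.inner ((continuous_subtype_val.mul continuous_const).mul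
    (continuous_star.comp continuous_subtype_val))

theorem adMatrix_inv (q : S3) : adMatrix q⁻¹ = (adMatrix q)ᵀ := by
  ext a b
  simp only [adMatrix, Matrix.of_apply, Matrix.transpose_apply, inv_inv]
  have h := (phi (q, q)).inner_map_map (imUnit a) ((q⁻¹ : S3) * imUnit b * q)
  rw [← h, real_inner_comm]
  congr 1
  · simp only [phi_apply, mul_assoc]
    rw [coe_mul_inv_S3, mul_one, ← mul_assoc, coe_mul_inv_S3, one_mul]

theorem adMatrix_mul_transpose (q : S3) : adMatrix q * (adMatrix q)ᵀ = 1 := by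
  rw [← adMatrix_inv, ← adMatrix_mul, mul_inv_cancel, adMatrix_one]

theorem det_adMatrix (q : S3) : (adMatrix q).det = 1 := by
  have hn : (q : ℍ[ℝ]).re ^ 2 + (q : ℍ[ℝ]).imI ^ 2 + (q : ℍ[ℝ]).imJ ^ 2 + (q : ℍ[ℝ]).imK ^ 2 = 1 := by
    rw [← Quaternion.normSq_def', Quaternion.normSq_eq_norm_mul_self, norm_eq_of_mem_sphere, one_mul]
  have h : (adMatrix q).det = ((q : ℍ[ℝ]).re ^ 2 + (q : ℍ[ℝ]).imI ^ 2 + (q : ℍ[ℝ]).imJ ^ 2 +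
      (q : ℍ[ℝ]).imK ^ 2) ^ 3 := by
    simp only [Matrix.det_fin_three, adMatrix, Matrix.of_apply, inner_imUnit, coe_inv_S3,
      Quaternion.imI_mul, Quaternion.imJ_mul, Quaternion.imK_mul, Quaternion.re_mul,
      Quaternion.re_star, Quaternion.imI_star, Quaternion.imJ_star, Quaternion.imK_star]
    simp [imUnit_re, imUnit_imI, imUnit_imJ, imUnit_imK]
    ring
  rw [h, hn, one_pow]

/-- The only unit quaternions acting trivially by conjugation are `±1`. -/
theorem eq_or_eq_neg_of_adMatrix_eq {p q : S3} (h : adMatrix p = adMatrix q) : p = q ∨ p = -q := by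
  have h1 : adMatrix (q⁻¹ * p) = 1 := by
    rw [adMatrix_mul, h, ← adMatrix_mul, inv_mul_cancel, adMatrix_one]
  set r := q⁻¹ * p with hr
  have hcomm : ∀ b, (r : ℍ[ℝ]) * imUnit b = imUnit b * r := by
    intro b
    have h2 := conj_imUnit r b
    rw [h1] at h2
    have h3 : ∑ a, (1 : Matrix (Fin 3) (Fin 3) ℝ) a b • imUnit a = imUnit b := by
      simp [Matrix.one_apply]
    rw [h3] at h2
    calc (r : ℍ[ℝ]) * imUnit b
        = (r : ℍ[ℝ]) * imUnit b * ((r⁻¹ : S3) : ℍ[ℝ]) * (r : ℍ[ℝ]) := by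
          rw [mul_assoc _ _ (r : ℍ[ℝ]), coe_inv_mul_S3, mul_one]
      _ = _ := by rw [h2]
  have e1 := congrArg (fun w : ℍ[ℝ] => w.imJ) (hcomm 0)
  have e2 := congrArg (fun w : ℍ[ℝ] => w.imK) (hcomm 0)
  have e3 := congrArg (fun w : ℍ[ℝ] => w.imK) (hcomm 1)
  simp only [Quaternion.imJ_mul, Quaternion.imK_mul] at e1 e2 e3
  simp [imUnit_re, imUnit_imI, imUnit_imJ, imUnit_imK] at e1 e2 e3
  have hI : (r : ℍ[ℝ]).imI = 0 := by linarith
  have hJ : (r : ℍ[ℝ]).imJ = 0 := by linarith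
  have hK : (r : ℍ[ℝ]).imK = 0 := by linarith
  have hn : (r : ℍ[ℝ]).re ^ 2 + (r : ℍ[ℝ]).imI ^ 2 + (r : ℍ[ℝ]).imJ ^ 2 + (r : ℍ[ℝ]).imK ^ 2 = 1 := by
    rw [← Quaternion.normSq_def', Quaternion.normSq_eq_norm_mul_self, norm_eq_of_mem_sphere, one_mul]
  have hre : (r : ℍ[ℝ]).re = 1 ∨ (r : ℍ[ℝ]).re = -1 := by
    rw [hI, hJ, hK] at hn
    have : (r : ℍ[ℝ]).re ^ 2 = 1 := by linarith
    exact (mul_self_eq_one_iff).1 (by rw [← sq]; exact this)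
  have hp : p = q * r := by rw [hr, mul_inv_cancel_left]
  rcases hre with h | h
  · left
    have : r = 1 := by
      refine Subtype.ext (QuaternionAlgebra.ext ?_ ?_ ?_ ?_) <;>
        simp only [Metric.unitSphere.coe_one, h, hI, hJ, hK, Quaternion.re_one, Quaternion.imI_one,
          Quaternion.imJ_one, Quaternion.imK_one]
    rw [hp, this, mul_one]
  · right
    have hr' : (r : ℍ[ℝ]) = -1 := by
      refine QuaternionAlgebra.ext ?_ ?_ ?_ ?_ <;>
        simp only [h, hI, hJ, hK, Quaternion.re_neg, Quaternion.imI_neg, Quaternion.imJ_neg,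
          Quaternion.imK_neg, Quaternion.re_one, Quaternion.imI_one,
          Quaternion.imJ_one, Quaternion.imK_one, neg_zero]
    refine Subtype.ext ?_
    rw [hp, Metric.unitSphere.coe_mul, hr', coe_neg_S3, mul_neg, mul_one]

theorem adjugate_eq_transpose {M : Matrix (Fin 3) (Fin 3) ℝ} (h : M * Mᵀ = 1) (hd : M.det = 1) :
    M.adjugate = Mᵀ := by
  have h' : Mᵀ * M = 1 := mul_eq_one_comm.1 h
  calc M.adjugate = Mᵀ * M * M.adjugate := by rw [h', one_mul]
    _ = Mᵀ := by rw [Matrix.mul_assoc, Matrix.mul_adjugate, hd, one_smul, Matrix.mul_one]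

/-- Every rotation of `ℝ³` is conjugation by a unit quaternion. If `u₀, u₁, u₂` are the images of
`i, j, k`, then `e ↦ e - u₀ e i - u₁ e j - u₂ e k` maps to the quaternions `q` with `q i = u₀ q`,
`q j = u₁ q`, `q k = u₂ q`, and its trace is `4`, so it does not vanish. -/
theorem exists_adMatrix_eq {M : Matrix (Fin 3) (Fin 3) ℝ} (h : M * Mᵀ = 1) (hd : M.det = 1) :
    ∃ q, adMatrix q = M := by
  have h' : Mᵀ * M = 1 := mul_eq_one_comm.1 h
  have hadj := adjugate_eq_transpose h hd
  have horth : ∀ a b, M 0 a * M 0 b + M 1 a * M 1 b + M 2 a * M 2 b = if a = b then 1 else 0 := by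
    intro a b
    have := congrFun (congrFun h' a) b
    simpa [Matrix.mul_apply, Fin.sum_univ_three, Matrix.one_apply] using this
  set u : Fin 3 → ℍ[ℝ] := fun b => ∑ a, M a b • imUnit a with hu
  rw [Matrix.adjugate_fin_three] at hadj
  have A := fun i j => congrFun (congrFun hadj i) j
  have a00 := A 0 0
  have a01 := A 0 1
  have a02 := A 0 2
  have a10 := A 1 0
  have a11 := A 1 1
  have a12 := A 1 2
  have a20 := A 2 0
  have a21 := A 2 1
  have a22 := A 2 2
  simp [Matrix.transpose_apply] at a00 a01 a02 a10 a11 a12 a20 a21 a22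
  have o00 := horth 0 0
  have o11 := horth 1 1
  have o22 := horth 2 2
  have o01 := horth 0 1
  have o02 := horth 0 2
  have o12 := horth 1 2
  simp at o00 o11 o22 o01 o02 o12
  have hur : ∀ b, (u b).re = 0 := fun b => re_sum_smul_imUnit fun a => M a b
  have huI : ∀ b, (u b).imI = M 0 b := fun b => imI_sum_smul_imUnit fun a => M a b
  have huJ : ∀ b, (u b).imJ = M 1 b := fun b => imJ_sum_smul_imUnit fun a => M a b
  have huK : ∀ b, (u b).imK = M 2 b := fun b => imK_sum_smul_imUnit fun a => M a b
  have hub : ∀ b, u b = ∑ a, M a b • imUnit a := fun b => rfl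
  clear_value u
  -- The columns of `M` multiply like `i, j, k` because `M` equals its cofactor matrix.
  have hutab : u 0 * u 0 = -1 ∧ u 1 * u 1 = -1 ∧ u 2 * u 2 = -1 ∧
      u 0 * u 1 = u 2 ∧ u 1 * u 0 = -u 2 ∧ u 1 * u 2 = u 0 ∧
      u 2 * u 1 = -u 0 ∧ u 2 * u 0 = u 1 ∧ u 0 * u 2 = -u 1 := by
    refine ⟨?_, ?_, ?_, ?_, ?_, ?_, ?_, ?_, ?_⟩ <;> refine QuaternionAlgebra.ext ?_ ?_ ?_ ?_ <;>
      simp only [Quaternion.re_mul, Quaternion.imI_mul, Quaternion.imJ_mul, Quaternion.imK_mul,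
        Quaternion.re_neg, Quaternion.imI_neg, Quaternion.imJ_neg, Quaternion.imK_neg,
        Quaternion.re_one, Quaternion.imI_one, Quaternion.imJ_one, Quaternion.imK_one,
        hur, huI, huJ, huK] <;> linarith
  obtain ⟨u00, u11, u22, u01, u10, u12, u21, u20, u02⟩ := hutab
  have hitab : imUnit 0 * imUnit 0 = -1 ∧ imUnit 1 * imUnit 1 = -1 ∧ imUnit 2 * imUnit 2 = -1 ∧
      imUnit 0 * imUnit 1 = imUnit 2 ∧ imUnit 1 * imUnit 0 = -imUnit 2 ∧ imUnit 1 * imUnit 2 = imUnit 0 ∧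
      imUnit 2 * imUnit 1 = -imUnit 0 ∧ imUnit 2 * imUnit 0 = imUnit 1 ∧ imUnit 0 * imUnit 2 = -imUnit 1 := by
    refine ⟨?_, ?_, ?_, ?_, ?_, ?_, ?_, ?_, ?_⟩ <;> refine QuaternionAlgebra.ext ?_ ?_ ?_ ?_ <;>
      simp [imUnit_re, imUnit_imI, imUnit_imJ, imUnit_imK]
  obtain ⟨i00, i11, i22, i01, i10, i12, i21, i20, i02⟩ := hitab
  set F : ℍ[ℝ] → ℍ[ℝ] := fun e =>
    e - u 0 * e * imUnit 0 - u 1 * e * imUnit 1 - u 2 * e * imUnit 2 with hF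
  have hFint : ∀ e b, F e * imUnit b = u b * F e := by
    intro e b
    have hL : F e * imUnit b = e * imUnit b - u 0 * e * (imUnit 0 * imUnit b) -
      u 1 * e * (imUnit 1 * imUnit b) - u 2 * e * (imUnit 2 * imUnit b) := by
      simp only [hF]; noncomm_ring
    have hR : u b * F e = u b * e - (u b * u 0) * e * imUnit 0 -
      (u b * u 1) * e * imUnit 1 - (u b * u 2) * e * imUnit 2 := by
      simp only [hF]; noncomm_ring
    rw [hL, hR]
    fin_cases b
    · simp only [Fin.zero_eta, i00, i10, i20, u00, u01, u02]; noncomm_ring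
    · simp only [Fin.mk_one, i01, i11, i21, u10, u11, u12]; noncomm_ring
    · simp only [Fin.reduceFinMk, i02, i12, i22, u20, u21, u22]; noncomm_ring
  -- If `F` vanished, so would its trace, which is `4`.
  have hne : ∃ e, F e ≠ 0 := by
    by_contra! hz
    have z0 := congrArg (fun w : ℍ[ℝ] => w.re) (hz 1)
    have z1 := congrArg (fun w : ℍ[ℝ] => w.imI) (hz (imUnit 0))
    have z2 := congrArg (fun w : ℍ[ℝ] => w.imJ) (hz (imUnit 1))
    have z3 := congrArg (fun w : ℍ[ℝ] => w.imK) (hz (imUnit 2))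
    simp only [hF, mul_one, Quaternion.re_sub, Quaternion.imI_sub, Quaternion.imJ_sub,
      Quaternion.imK_sub, Quaternion.re_mul, Quaternion.imI_mul, Quaternion.imJ_mul,
      Quaternion.imK_mul] at z0 z1 z2 z3
    simp [imUnit_re, imUnit_imI, imUnit_imJ, imUnit_imK, hur, huI, huJ, huK] at z0 z1 z2 z3
    linarith
  obtain ⟨e, he⟩ := hne
  refine ⟨normalize (F e), adMatrix_eq_of_conj fun b => ?_⟩
  set q := normalize (F e) with hq
  have h1 : (q : ℍ[ℝ]) * imUnit b = u b * q := by
    rw [hq, coe_normalize he, smul_mul_assoc, hFint, mul_smul_comm]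
  rw [h1, mul_assoc, coe_mul_inv_S3, mul_one, hub]

/-! ### `S³` is simply connected -/

/-- A path in the sphere is homotopic to the radial projection of a polynomial path. -/
theorem exists_path_homotopic_contDiff {x y : S3} (γ : Path x y) :
    ∃ γ' : Path x y, γ.Homotopic γ' ∧ ∃ F : ℝ → ℍ[ℝ], ContDiff ℝ 1 F ∧
      ∀ t : unitInterval, ∃ r : ℝ, (γ' t : ℍ[ℝ]) = r • F t := by
  set f : C(unitInterval, ℍ[ℝ]) := ⟨fun t => (γ t : ℍ[ℝ]), by fun_prop⟩ with hf
  have hlim := bernsteinApproximation_uniform f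
  rw [Metric.tendsto_atTop] at hlim
  obtain ⟨N, hN⟩ := hlim 1 one_pos
  set n := N + 1
  have hn := hN n (Nat.le_succ N)
  rw [dist_eq_norm, ContinuousMap.norm_lt_iff _ one_pos] at hn
  set B := bernsteinApproximation n f with hB
  have hB0 : ∀ t, B t ≠ 0 := by
    intro t h
    have := hn t
    rw [ContinuousMap.sub_apply, h, zero_sub, norm_neg] at this
    simp [hf] at this
  have e0 : B 0 = x := by rw [hB, bernsteinApproximation.apply_zero]; simp [hf]
  have e1 : B 1 = y := by
    rw [hB, bernsteinApproximation.apply_one (Nat.succ_ne_zero N)]; simp [hf]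
  refine ⟨⟨⟨fun t => normalize (B t), continuous_normalize_comp B.continuous hB0⟩, ?_, ?_⟩,
    ?_, fun t => ∑ k : Fin (n + 1), ((n.choose k : ℝ) * t ^ (k : ℕ) * (1 - t) ^ (n - k)) •
      f (bernstein.z k), by fun_prop, fun t => ⟨‖B t‖⁻¹, ?_⟩⟩
  · simp only [e0, normalize_coe]
  · simp only [e1, normalize_coe]
  · refine homotopicRel_of_forall_ne_neg _ _ (fun t h => ?_) _ ?_
    · simp only [ContinuousMap.coe_mk, coe_normalize (hB0 t)] at h
      have h1 := hn t
      have h2 : (f t : ℍ[ℝ]) = -(‖B t‖⁻¹ • B t) := h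
      have h4 : B t - f t = (1 + ‖B t‖⁻¹) • B t := by
        rw [h2, sub_neg_eq_add, add_smul, one_smul]
      rw [ContinuousMap.sub_apply, h4, norm_smul, Real.norm_eq_abs,
        abs_of_nonneg (by positivity), add_mul, inv_mul_cancel₀ (norm_ne_zero_iff.2 (hB0 t))] at h1
      linarith [norm_nonneg (B t)]
    · rintro t (rfl | rfl)
      · simp [e0]
      · simp [e1]
  · change ((normalize (B t) : S3) : ℍ[ℝ]) = _
    rw [coe_normalize (hB0 t), hB, bernsteinApproximation.apply]
    simp only [bernstein_apply]

/-- The cones over two `C¹` curves in `ℍ` have Hausdorff dimension at most two, so together they do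
not exhaust the sphere. -/
theorem exists_forall_ne_of_contDiff {F₀ F₁ : ℝ → ℍ[ℝ]} (h₀ : ContDiff ℝ 1 F₀)
    (h₁ : ContDiff ℝ 1 F₁) : ∃ v : S3, ∀ r t : ℝ, (v : ℍ[ℝ]) ≠ r • F₀ t ∧ (v : ℍ[ℝ]) ≠ r • F₁ t := by
  have key : ∀ {F : ℝ → ℍ[ℝ]}, ContDiff ℝ 1 F →
      dimH (Set.range fun p : ℝ × ℝ => p.1 • F p.2) ≤ 2 := by
    intro F hF
    have : ContDiff ℝ 1 fun p : ℝ × ℝ => p.1 • F p.2 := by fun_prop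
    refine this.dimH_range_le.trans ?_
    simp
  have hd : Dense ((Set.range fun p : ℝ × ℝ => p.1 • F₀ p.2) ∪
      (Set.range fun p : ℝ × ℝ => p.1 • F₁ p.2))ᶜ := by
    refine dense_compl_of_dimH_lt_finrank ?_
    rw [dimH_union]
    refine (max_le (key h₀) (key h₁)).trans_lt ?_
    rw [Quaternion.finrank_eq_four]
    norm_num
  obtain ⟨w, hw⟩ := hd.nonempty
  rw [Set.mem_compl_iff, Set.mem_union, not_or] at hw
  have hw0 : w ≠ 0 := by
    rintro rfl
    exact hw.1 ⟨(0, 0), by simp⟩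
  have hwv : w = ‖w‖ • (normalize w : ℍ[ℝ]) := by
    rw [coe_normalize hw0, smul_smul, mul_inv_cancel₀ (norm_ne_zero_iff.2 hw0), one_smul]
  refine ⟨normalize w, fun r t =>
    ⟨fun h => hw.1 ⟨(‖w‖ * r, t), ?_⟩, fun h => hw.2 ⟨(‖w‖ * r, t), ?_⟩⟩⟩
  · exact (mul_smul _ _ _).trans (by rw [← h]; exact hwv.symm)
  · exact (mul_smul _ _ _).trans (by rw [← h]; exact hwv.symm)

/-- Stereographic projection identifies the complement of `v` with a vector space. -/
theorem path_homotopic_of_forall_ne {x y : S3} (γ₀ γ₁ : Path x y) (v : S3)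
    (h₀ : ∀ t, γ₀ t ≠ v) (h₁ : ∀ t, γ₁ t ≠ v) : γ₀.Homotopic γ₁ := by
  have hv : ‖(v : ℍ[ℝ])‖ = 1 := norm_eq_of_mem_sphere v
  set e := stereographic hv with he
  have hs : ∀ z : S3, z ≠ v → z ∈ e.source := fun z hz => by
    rw [he, stereographic_source]; exact hz
  have hcont : ∀ γ : Path x y, (∀ t, γ t ≠ v) → Continuous fun t => e (γ t) := fun γ h =>
    e.continuousOn.comp_continuous γ.continuous fun t => hs _ (h t)
  have hsymm : Continuous e.symm := by
    have := e.continuousOn_symm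
    rwa [he, stereographic_target, continuousOn_univ] at this
  have c₀ := hcont γ₀ h₀
  have c₁ := hcont γ₁ h₁
  have l₀ : ∀ t, e.symm (e (γ₀ t)) = γ₀ t := fun t => e.left_inv (hs _ (h₀ t))
  have l₁ : ∀ t, e.symm (e (γ₁ t)) = γ₁ t := fun t => e.left_inv (hs _ (h₁ t))
  refine ⟨{ toFun := fun p => e.symm ((1 - (p.1 : ℝ)) • e (γ₀ p.2) + (p.1 : ℝ) • e (γ₁ p.2))
            continuous_toFun := hsymm.comp (((continuous_const.sub
              (continuous_subtype_val.comp continuous_fst)).smul (c₀.comp continuous_snd)).add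
              ((continuous_subtype_val.comp continuous_fst).smul (c₁.comp continuous_snd)))
            map_zero_left := fun t => by simp [l₀]
            map_one_left := fun t => by simp [l₁]
            prop' := fun s t ht => ?_ }⟩
  have : γ₁ t = γ₀ t := by
    rcases ht with rfl | rfl <;> simp
  simp only [ContinuousMap.coe_mk, this, ← add_smul]
  simp [l₀]

instance instPathConnectedSpaceS3 : PathConnectedSpace S3 := ⟨⟨1⟩, joinedIn_S3⟩

/-- Two paths with the same ends can be deformed to radial projections of polynomial paths, which miss
a common point. -/
instance instSimplyConnectedSpaceS3 : SimplyConnectedSpace S3 := by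
  rw [simply_connected_iff_paths_homotopic']
  refine ⟨inferInstance, fun p₀ p₁ => ?_⟩
  obtain ⟨q₀, h₀, F₀, hF₀, e₀⟩ := exists_path_homotopic_contDiff p₀
  obtain ⟨q₁, h₁, F₁, hF₁, e₁⟩ := exists_path_homotopic_contDiff p₁
  obtain ⟨v, hv⟩ := exists_forall_ne_of_contDiff hF₀ hF₁
  refine h₀.trans ((path_homotopic_of_forall_ne q₀ q₁ v (fun t ht => ?_) fun t ht => ?_).trans h₁.symm)
  · obtain ⟨r, hr⟩ := e₀ t
    exact (hv r t).1 (by rw [← hr, ht])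
  · obtain ⟨r, hr⟩ := e₁ t
    exact (hv r t).2 (by rw [← hr, ht])

instance instLocallyPathConnectedSpaceS3 : LocallyPathConnectedSpace S3 :=
  ChartedSpace.locallyPathConnectedSpace (EuclideanSpace ℝ (Fin 3)) S3

/-! ### Lifting along the double cover -/

/-- The group `SO(3)` as a space of matrices. -/
abbrev SO3 : Type := {M : Matrix (Fin 3) (Fin 3) ℝ // M * Mᵀ = 1 ∧ M.det = 1}

/-- The double cover `S³ → SO(3)`. -/
def adSO (q : S3) : SO3 := ⟨adMatrix q, adMatrix_mul_transpose q, det_adMatrix q⟩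

theorem continuous_adSO : Continuous adSO := continuous_adMatrix.subtype_mk _

theorem adSO_eq_iff {p q : S3} : adSO p = adSO q ↔ p = q ∨ p = -q := by
  refine ⟨fun h => eq_or_eq_neg_of_adMatrix_eq (congrArg Subtype.val h), ?_⟩
  rintro (rfl | rfl)
  · rfl
  · exact Subtype.ext (adMatrix_neg q)

/-- The group `{1, -1}` of signs acts on `S³`, the sign `-1` as the antipodal map. -/
instance instMulActionSignS3 : MulAction ℤˣ S3 where
  smul u x := if u = 1 then x else -x
  one_smul x := if_pos rfl
  mul_smul u v x := by
    change (if u * v = 1 then x else -x) = if u = 1 then (if v = 1 then x else -x) else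
      -(if v = 1 then x else -x)
    rcases Int.units_eq_one_or u with rfl | rfl <;> rcases Int.units_eq_one_or v with rfl | rfl <;>
      simp [show (-1 : ℤˣ) ≠ 1 by decide]

theorem sign_one_smul (x : S3) : (1 : ℤˣ) • x = x := if_pos rfl

theorem sign_neg_one_smul (x : S3) : (-1 : ℤˣ) • x = -x := if_neg (by decide)

theorem isQuotientCoveringMap_adSO : IsQuotientCoveringMap adSO ℤˣ where
  toIsQuotientMap := by
    refine IsQuotientMap.of_surjective_continuous (fun M => ?_) continuous_adSO
    obtain ⟨q, hq⟩ := exists_adMatrix_eq M.2.1 M.2.2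
    exact ⟨q, Subtype.ext hq⟩
  continuous_const_smul u := by
    rcases Int.units_eq_one_or u with rfl | rfl
    · simpa only [sign_one_smul] using continuous_id'
    · simp only [sign_neg_one_smul]
      exact (continuous_subtype_val.neg).subtype_mk _
  apply_eq_iff_mem_orbit {p q} := by
    rw [adSO_eq_iff, MulAction.mem_orbit_iff]
    constructor
    · rintro (h | h)
      · exact ⟨1, by rw [sign_one_smul, h]⟩
      · exact ⟨-1, by rw [sign_neg_one_smul, h]⟩
    · rintro ⟨u, rfl⟩
      rcases Int.units_eq_one_or u with rfl | rfl
      · rw [sign_one_smul]; exact .inl rfl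
      · rw [sign_neg_one_smul]; exact .inr rfl
  disjoint x := by
    refine ⟨ball x 1, ball_mem_nhds x one_pos, fun u hu => ?_⟩
    rcases Int.units_eq_one_or u with rfl | rfl
    · rfl
    · exfalso
      obtain ⟨_, ⟨z, hz, rfl⟩, hz'⟩ := hu
      simp only [sign_neg_one_smul] at hz'
      have h1 : dist z (-z) < 2 := by
        calc dist z (-z) ≤ dist z x + dist (-z) x := dist_triangle_right _ _ _
          _ < 2 := by linarith [mem_ball.1 hz, mem_ball.1 hz']
      rw [Subtype.dist_eq, dist_eq_norm, coe_neg_S3, sub_neg_eq_add, ← two_smul ℝ, norm_smul,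
        norm_eq_of_mem_sphere] at h1
      norm_num at h1

theorem isCoveringMap_adSO : IsCoveringMap adSO := isQuotientCoveringMap_adSO.isCoveringMap

/-- Every continuous map `S³ → SO(3)` lifts to `S³`. -/
theorem exists_lift_adMatrix {Q : S3 → Matrix (Fin 3) (Fin 3) ℝ} (hQ : Continuous Q)
    (h : ∀ x, Q x * (Q x)ᵀ = 1 ∧ (Q x).det = 1) : ∃ q : C(S3, S3), ∀ x, adMatrix (q x) = Q x := by
  obtain ⟨e₀, he₀⟩ := exists_adMatrix_eq (h 1).1 (h 1).2
  obtain ⟨q, ⟨-, hq⟩, -⟩ := isCoveringMap_adSO.existsUnique_continuousMap_lifts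
    ⟨fun x => (⟨Q x, h x⟩ : SO3), hQ.subtype_mk _⟩ 1 e₀ (Subtype.ext he₀)
  exact ⟨q, fun x => congrArg Subtype.val (congrFun hq x)⟩

theorem eq_or_eq_neg_of_forall_adMatrix_eq {X : Type*} [TopologicalSpace X] [PreconnectedSpace X]
    {f g : C(X, S3)} (h : ∀ x, adMatrix (f x) = adMatrix (g x)) :
    (∀ x, f x = g x) ∨ ∀ x, f x = -g x := by
  by_cases hX : Nonempty X
  swap
  · exact .inl fun x => (hX ⟨x⟩).elim
  obtain ⟨x₀⟩ := hX
  rcases eq_or_eq_neg_of_adMatrix_eq (h x₀) with h0 | h0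
  · exact .inl fun x => congrFun (isCoveringMap_adSO.eq_of_comp_eq f.continuous g.continuous
      (funext fun x => Subtype.ext (h x)) x₀ h0) x
  · refine .inr fun x => congrFun (isCoveringMap_adSO.eq_of_comp_eq f.continuous
      (g₂ := fun x => -g x) ((g.continuous.subtype_val.neg).subtype_mk _)
      (funext fun x => Subtype.ext ((h x).trans (adMatrix_neg _).symm)) x₀ h0) x

theorem homotopic_neg {X : Type*} [TopologicalSpace X] {f g : C(X, S3)} (h : ∀ x, f x = -g x) :
    f.Homotopic g := by
  have h1 : f = ContinuousMap.const X (-1 : S3) * g := by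
    ext1 x
    refine Subtype.ext ?_
    rw [h x, ContinuousMap.mul_apply, Metric.unitSphere.coe_mul, ContinuousMap.const_apply,
      coe_neg_S3, coe_neg_S3, Metric.unitSphere.coe_one, neg_one_mul]
  rw [h1]
  exact homotopic_const_mul _ _

/-- Maps to `S³` whose images in `SO(3)` are homotopic are homotopic. -/
theorem homotopic_of_homotopy_adMatrix {f g : C(S3, S3)}
    {H : unitInterval × S3 → Matrix (Fin 3) (Fin 3) ℝ} (hH : Continuous H)
    (h : ∀ p, H p * (H p)ᵀ = 1 ∧ (H p).det = 1) (h0 : ∀ x, H (0, x) = adMatrix (f x))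
    (h1 : ∀ x, H (1, x) = adMatrix (g x)) : f.Homotopic g := by
  set H' : C(unitInterval × S3, SO3) := ⟨fun p => ⟨H p, h p⟩, hH.subtype_mk _⟩ with hH'
  have H0 : ∀ x, H' (0, x) = adSO (f x) := fun x => Subtype.ext (h0 x)
  set K := isCoveringMap_adSO.liftHomotopy H' f H0 with hK
  have hK1 : ∀ p, adSO (K p) = H' p := fun p =>
    congrFun (isCoveringMap_adSO.liftHomotopy_lifts H' f H0) p
  set g' : C(S3, S3) := K.comp ((ContinuousMap.const S3 1).prodMk (ContinuousMap.id S3)) with hg'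
  have hfg : f.Homotopic g' := ⟨{ toContinuousMap := K
                                  map_zero_left := fun x =>
                                    isCoveringMap_adSO.liftHomotopy_zero H' f H0 x
                                  map_one_left := fun x => rfl }⟩
  have hgg : ∀ x, adMatrix (g' x) = adMatrix (g x) := fun x =>
    (congrArg Subtype.val (hK1 (1, x))).trans (h1 x)
  rcases eq_or_eq_neg_of_forall_adMatrix_eq hgg with h2 | h2
  · rwa [ContinuousMap.ext h2] at hfg
  · exact hfg.trans (homotopic_neg h2)

/-! ### Gram–Schmidt orthonormalisation in dimension three -/

/-- The vector `r / |r|` for the Euclidean norm, with junk value `0` at `r = 0`. -/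
def unitVec (r : Fin 3 → ℝ) : Fin 3 → ℝ := (Real.sqrt (r ⬝ᵥ r))⁻¹ • r

theorem dotProduct_self_pos {r : Fin 3 → ℝ} (h : r ≠ 0) : 0 < r ⬝ᵥ r := by
  have h0 : 0 ≤ r ⬝ᵥ r := by
    rw [dotProduct]; exact Finset.sum_nonneg fun i _ => mul_self_nonneg _
  exact lt_of_le_of_ne h0 fun h1 => h (dotProduct_self_eq_zero.1 h1.symm)

theorem unitVec_dot_self {r : Fin 3 → ℝ} (h : r ≠ 0) : unitVec r ⬝ᵥ unitVec r = 1 := by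
  have h0 := dotProduct_self_pos h
  rw [unitVec, smul_dotProduct, dotProduct_smul, smul_eq_mul, smul_eq_mul, ← mul_assoc,
    ← mul_inv, Real.mul_self_sqrt h0.le, inv_mul_cancel₀ h0.ne']

theorem dot_unitVec {r : Fin 3 → ℝ} (h : r ≠ 0) : 0 < r ⬝ᵥ unitVec r := by
  have h0 := dotProduct_self_pos h
  rw [unitVec, dotProduct_smul, smul_eq_mul]
  have := Real.sqrt_pos.2 h0
  positivity

theorem unitVec_eq_self {r : Fin 3 → ℝ} (h : r ⬝ᵥ r = 1) : unitVec r = r := by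
  rw [unitVec, h]; simp

theorem continuous_unitVec_comp {X : Type*} [TopologicalSpace X] {r : X → Fin 3 → ℝ} (hr : Continuous r)
    (h : ∀ x, r x ≠ 0) : Continuous fun x => unitVec (r x) := by
  have h1 : Continuous fun x => Real.sqrt (r x ⬝ᵥ r x) :=
    Real.continuous_sqrt.comp (hr.dotProduct hr)
  exact (h1.inv₀ fun x => (Real.sqrt_pos.2 (dotProduct_self_pos (h x))).ne').smul hr

/-- The component of the second row of `T` orthogonal to the first. -/
def orthRow (T : Matrix (Fin 3) (Fin 3) ℝ) : Fin 3 → ℝ :=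
  T 1 - (T 1 ⬝ᵥ unitVec (T 0)) • unitVec (T 0)

/-- The rotation obtained from the rows of `T` by the Gram–Schmidt process. The third row is the
cross product of the first two. -/
def gramSchmidt (T : Matrix (Fin 3) (Fin 3) ℝ) : Matrix (Fin 3) (Fin 3) ℝ :=
  ![unitVec (T 0), unitVec (orthRow T), crossProduct (unitVec (T 0)) (unitVec (orthRow T))]

section

variable {T : Matrix (Fin 3) (Fin 3) ℝ}

theorem row_zero_ne_zero (h : 0 < T.det) : T 0 ≠ 0 := fun h0 =>
  h.ne' (Matrix.det_eq_zero_of_row_eq_zero 0 fun j => congrFun h0 j)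

theorem orthRow_ne_zero (h : 0 < T.det) : orthRow T ≠ 0 := by
  intro h0
  rw [orthRow, sub_eq_zero, unitVec, smul_smul] at h0
  generalize (T 1 ⬝ᵥ (√(T 0 ⬝ᵥ T 0))⁻¹ • T 0) * (√(T 0 ⬝ᵥ T 0))⁻¹ = c at h0
  have h1 : ∀ j, T 1 j = c * T 0 j := fun j => congrFun h0 j
  refine h.ne' ?_
  rw [Matrix.det_fin_three, h1, h1, h1]
  ring

theorem unitVec_dot_orthRow (h : 0 < T.det) : unitVec (T 0) ⬝ᵥ orthRow T = 0 := by
  rw [orthRow, dotProduct_sub, dotProduct_smul, unitVec_dot_self (row_zero_ne_zero h),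
    dotProduct_comm (T 1)]
  simp

theorem unitVec_dot_unitVec (h : 0 < T.det) : unitVec (T 0) ⬝ᵥ unitVec (orthRow T) = 0 := by
  have e : unitVec (orthRow T) = (Real.sqrt (orthRow T ⬝ᵥ orthRow T))⁻¹ • orthRow T := rfl
  rw [e, dotProduct_smul, unitVec_dot_orthRow h, smul_zero]

theorem gramSchmidt_mul_transpose (h : 0 < T.det) :
    gramSchmidt T * (gramSchmidt T)ᵀ = 1 := by
  have a00 := unitVec_dot_self (row_zero_ne_zero h)
  have a11 := unitVec_dot_self (orthRow_ne_zero h)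
  have a01 := unitVec_dot_unitVec h
  have a10 := a01
  rw [dotProduct_comm] at a10
  have a22 : crossProduct (unitVec (T 0)) (unitVec (orthRow T)) ⬝ᵥ
      crossProduct (unitVec (T 0)) (unitVec (orthRow T)) = 1 := by
    rw [cross_dot_cross, a00, a11, a01, a10]; norm_num
  ext i j
  change gramSchmidt T i ⬝ᵥ gramSchmidt T j = _
  fin_cases i <;> fin_cases j <;> simp [gramSchmidt, a00, a11, a01, a10, a22]
  · rw [dotProduct_comm, dot_self_cross]
  · rw [dotProduct_comm, dot_cross_self]

theorem det_gramSchmidt (h : 0 < T.det) : (gramSchmidt T).det = 1 := by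
  have a22 : (gramSchmidt T * (gramSchmidt T)ᵀ) 2 2 = 1 := by
    rw [gramSchmidt_mul_transpose h]; rfl
  rw [gramSchmidt, ← triple_product_eq_det, triple_product_permutation,
    triple_product_permutation]
  exact a22

/-- The matrix `T` is the product of a lower triangular matrix with positive diagonal entries and
the rotation `gramSchmidt T`, so the segment between the two avoids singular matrices. -/
theorem det_segment_gramSchmidt_pos (h : 0 < T.det) {t : ℝ} (ht0 : 0 ≤ t) (ht1 : t ≤ 1) :
    0 < ((1 - t) • T + t • gramSchmidt T).det := by
  set O := gramSchmidt T with hO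
  have hOO : O * Oᵀ = 1 := gramSchmidt_mul_transpose h
  have hdet : O.det = 1 := det_gramSchmidt h
  set L := T * Oᵀ with hL
  have hr1 : T 1 = orthRow T + (T 1 ⬝ᵥ unitVec (T 0)) • unitVec (T 0) := by
    rw [orthRow, sub_add_cancel]
  have hw0 : orthRow T ≠ 0 := orthRow_ne_zero h
  have hr0 := row_zero_ne_zero h
  have l01 : L 0 1 = 0 := by
    have h2 := unitVec_dot_unitVec h
    nth_rewrite 1 [unitVec] at h2
    rw [smul_dotProduct, smul_eq_mul] at h2
    exact (mul_eq_zero.1 h2).resolve_left (inv_ne_zero (Real.sqrt_pos.2 (dotProduct_self_pos hr0)).ne')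
  have l02 : L 0 2 = 0 := by
    have h2 := dot_self_cross (unitVec (T 0)) (unitVec (orthRow T))
    nth_rewrite 1 [unitVec] at h2
    rw [smul_dotProduct, smul_eq_mul] at h2
    exact (mul_eq_zero.1 h2).resolve_left (inv_ne_zero (Real.sqrt_pos.2 (dotProduct_self_pos hr0)).ne')
  have l12 : L 1 2 = 0 := by
    have h2 := dot_cross_self (unitVec (T 0)) (unitVec (orthRow T))
    nth_rewrite 1 [unitVec] at h2
    rw [smul_dotProduct, smul_eq_mul] at h2
    have h3 := (mul_eq_zero.1 h2).resolve_left
      (inv_ne_zero (Real.sqrt_pos.2 (dotProduct_self_pos hw0)).ne')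
    change T 1 ⬝ᵥ crossProduct (unitVec (T 0)) (unitVec (orthRow T)) = 0
    rw [hr1, add_dotProduct, h3, smul_dotProduct, dot_self_cross, smul_zero, add_zero]
  have l00 : 0 < L 0 0 := dot_unitVec hr0
  have l11 : 0 < L 1 1 := by
    change 0 < T 1 ⬝ᵥ unitVec (orthRow T)
    rw [hr1, add_dotProduct, smul_dotProduct, unitVec_dot_unitVec h, smul_zero, add_zero]
    exact dot_unitVec hw0
  have hdL : L.det = T.det := by rw [hL, Matrix.det_mul, Matrix.det_transpose, hdet, mul_one]
  have l22 : 0 < L 2 2 := by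
    rw [← hdL, Matrix.det_fin_three, l01, l02, l12] at h
    have : 0 < L 0 0 * L 1 1 * L 2 2 := by linarith
    exact (pos_iff_pos_of_mul_pos this).1 (by positivity)
  have e1 : ((1 - t) • T + t • O).det = ((1 - t) • L + t • (1 : Matrix (Fin 3) (Fin 3) ℝ)).det := by
    have : (1 - t) • L + t • (1 : Matrix (Fin 3) (Fin 3) ℝ) = ((1 - t) • T + t • O) * Oᵀ := by
      rw [Matrix.add_mul, Matrix.smul_mul, Matrix.smul_mul, hOO]
    rw [this, Matrix.det_mul, Matrix.det_transpose, hdet, mul_one]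
  have pos : ∀ {a : ℝ}, 0 < a → 0 < (1 - t) * a + t := by
    intro a ha
    rcases ht1.lt_or_eq with h1 | h1
    · have := mul_pos (sub_pos.2 h1) ha; linarith
    · rw [h1]; norm_num
  rw [e1, Matrix.det_fin_three]
  simp [l01, l02, l12]
  have := mul_pos (mul_pos (pos l00) (pos l11)) (pos l22)
  linarith

theorem gramSchmidt_eq_self (h : T * Tᵀ = 1) (hd : T.det = 1) : gramSchmidt T = T := by
  have entry : ∀ i j, T i ⬝ᵥ T j = (1 : Matrix (Fin 3) (Fin 3) ℝ) i j := fun i j => by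
    rw [← h]; rfl
  have u0 : unitVec (T 0) = T 0 := unitVec_eq_self (entry 0 0)
  have u1 : unitVec (orthRow T) = T 1 := by
    have e10 : T 1 ⬝ᵥ T 0 = 0 := entry 1 0
    rw [orthRow, u0, e10, zero_smul, sub_zero]
    exact unitVec_eq_self (entry 1 1)
  have hadj := adjugate_eq_transpose h hd
  rw [Matrix.adjugate_fin_three] at hadj
  have u2 : crossProduct (T 0) (T 1) = T 2 := by
    rw [cross_apply]
    have b0 := congrFun (congrFun hadj 0) 2
    have b1 := congrFun (congrFun hadj 1) 2
    have b2 := congrFun (congrFun hadj 2) 2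
    simp [Matrix.transpose_apply] at b0 b1 b2
    ext j
    fin_cases j <;> simp <;> linarith
  rw [gramSchmidt, u0, u1, u2]
  ext i j
  fin_cases i <;> rfl

end

theorem continuous_gramSchmidt_comp {X : Type*} [TopologicalSpace X]
    {T : X → Matrix (Fin 3) (Fin 3) ℝ} (hT : Continuous T) (h : ∀ x, 0 < (T x).det) :
    Continuous fun x => gramSchmidt (T x) := by
  have hrow : ∀ i, Continuous fun x => T x i := fun i => (continuous_apply i).comp hT
  have c0 : Continuous fun x => unitVec (T x 0) :=
    continuous_unitVec_comp (hrow 0) fun x => row_zero_ne_zero (h x)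
  have cw : Continuous fun x => orthRow (T x) :=
    (hrow 1).sub (((hrow 1).dotProduct c0).smul c0)
  have c1 : Continuous fun x => unitVec (orthRow (T x)) :=
    continuous_unitVec_comp cw fun x => orthRow_ne_zero (h x)
  have k0 : ∀ j, Continuous fun x => unitVec (T x 0) j := fun j => (continuous_apply j).comp c0
  have k1 : ∀ j, Continuous fun x => unitVec (orthRow (T x)) j :=
    fun j => (continuous_apply j).comp c1
  have c2 : Continuous fun x => crossProduct (unitVec (T x 0)) (unitVec (orthRow (T x))) := by
    simp only [cross_apply]
    refine continuous_pi fun j => ?_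
    fin_cases j <;> simp <;> fun_prop
  refine continuous_pi fun i => ?_
  fin_cases i
  · exact c0
  · exact c1
  · exact c2

/-! ### Vector fields on `S³` in the left-invariant framing -/

/-- The inclusion of the tangent space `T_x S³` into `ℍ`. -/
abbrev ambient (x : S3) : TangentSpace (𝓡 3) x →L[ℝ] ℍ[ℝ] :=
  mvfderiv (𝓡 3) ((↑) : S3 → ℍ[ℝ]) x

theorem mdifferentiableAt_coe_S3 (x : S3) :
    MDifferentiableAt (𝓡 3) 𝓘(ℝ, ℍ[ℝ]) ((↑) : S3 → ℍ[ℝ]) x :=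
  (contMDiff_coe_sphere (m := 1) x).mdifferentiableAt one_ne_zero

theorem ambient_injective (x : S3) : Function.Injective (ambient x) :=
  injective_mvfderiv_subtypeVal_sphere x

theorem contMDiffOn_normalize :
    ContMDiffOn 𝓘(ℝ, ℍ[ℝ]) (𝓡 3) ∞ normalize ({0}ᶜ : Set ℍ[ℝ]) :=
  fun _ hv => (contMDiffAt_normalize hv).contMDiffWithinAt

/-- The differential of radial projection is a left inverse of that of the inclusion `S³ ⊂ ℍ`. -/
theorem tangentMapWithin_normalize_tangentMap_coe (p : TangentBundle (𝓡 3) S3) :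
    tangentMapWithin 𝓘(ℝ, ℍ[ℝ]) (𝓡 3) normalize ({0}ᶜ : Set ℍ[ℝ])
      (tangentMap (𝓡 3) 𝓘(ℝ, ℍ[ℝ]) ((↑) : S3 → ℍ[ℝ]) p) = p := by
  have h0 : (p.1 : ℍ[ℝ]) ≠ 0 := ne_zero_of_mem_unit_sphere p.1
  have hd : MDifferentiableAt 𝓘(ℝ, ℍ[ℝ]) (𝓡 3) normalize (p.1 : ℍ[ℝ]) :=
    (contMDiffAt_normalize h0).mdifferentiableAt (by simp)
  have hu : UniqueMDiffWithinAt 𝓘(ℝ, ℍ[ℝ]) ({0}ᶜ : Set ℍ[ℝ]) (p.1 : ℍ[ℝ]) :=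
    isOpen_compl_singleton.uniqueMDiffWithinAt h0
  rw [tangentMapWithin_eq_tangentMap hu hd,
    ← tangentMap_comp_at p hd (mdifferentiableAt_coe_S3 p.1)]
  have : normalize ∘ ((↑) : S3 → ℍ[ℝ]) = id := funext normalize_coe
  rw [this, tangentMap_id]
  rfl

/-- A vector field along a map `x : Z → S³` is continuous if and only if it is continuous as an
`ℍ`-valued map: radial projection `ℍ ∖ 0 → S³` provides a left inverse of the differential of the
inclusion. -/
theorem continuous_tangentBundle_iff {Z : Type*} [TopologicalSpace Z] {x : Z → S3}
    {V : ∀ z, TangentSpace (𝓡 3) (x z)} (hx : Continuous x) :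
    Continuous (fun z => (⟨x z, V z⟩ : TangentBundle (𝓡 3) S3)) ↔
      Continuous fun z => ambient (x z) (V z) := by
  have ht : Continuous (tangentMap (𝓡 3) 𝓘(ℝ, ℍ[ℝ]) ((↑) : S3 → ℍ[ℝ])) :=
    (contMDiff_coe_sphere (m := 1)).continuous_tangentMap le_rfl
  constructor
  · intro h
    exact continuous_snd.comp
      ((tangentBundleModelSpaceHomeomorph 𝓘(ℝ, ℍ[ℝ])).continuous.comp (ht.comp h))
  · intro h
    have h1 : Continuous fun z =>
        tangentMap (𝓡 3) 𝓘(ℝ, ℍ[ℝ]) ((↑) : S3 → ℍ[ℝ]) (⟨x z, V z⟩ : TangentBundle (𝓡 3) S3) :=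
      (tangentBundleModelSpaceHomeomorph 𝓘(ℝ, ℍ[ℝ])).symm.continuous.comp
        ((continuous_subtype_val.comp hx).prodMk h)
    have h2 := (contMDiffOn_normalize.continuousOn_tangentMapWithin (by simp)
      isOpen_compl_singleton.uniqueMDiffOn).comp_continuous h1
      fun z => ne_zero_of_mem_unit_sphere (x z)
    exact h2.congr fun z => tangentMapWithin_normalize_tangentMap_coe _

theorem inner_coe_ambient (x : S3) (V : TangentSpace (𝓡 3) x) :
    inner ℝ (x : ℍ[ℝ]) (ambient x V) = 0 := by
  have h : ambient x V ∈ (ambient x).range := ⟨V, rfl⟩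
  rwa [range_mvfderiv_subtypeVal, Submodule.mem_orthogonal_singleton_iff_inner_right] at h

theorem inner_mul_left (x : S3) (v w : ℍ[ℝ]) :
    inner ℝ ((x : ℍ[ℝ]) * v) ((x : ℍ[ℝ]) * w) = inner ℝ v w := by
  have := (phi (x, 1)).inner_map_map v w
  simpa only [phi_apply, inv_one, Metric.unitSphere.coe_one, mul_one] using this

/-- Coordinates of tangent vectors with respect to the left-invariant framing. -/
theorem eq_sum_leftFrame (x : S3) (V : TangentSpace (𝓡 3) x) :
    V = ∑ b, (inner ℝ ((x : ℍ[ℝ]) * imUnit b) (ambient x V) : ℝ) • leftFrame b x := by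
  apply ambient_injective x
  rw [map_sum]
  simp only [map_smul, leftFrame_spec]
  set w := ambient x V with hw
  have h1 : w = (x : ℍ[ℝ]) * (((x⁻¹ : S3) : ℍ[ℝ]) * w) := by
    rw [← mul_assoc, coe_mul_inv_S3, one_mul]
  have hre : (((x⁻¹ : S3) : ℍ[ℝ]) * w).re = 0 := by
    have h2 := inner_coe_ambient x V
    rw [← hw, h1, ← mul_one (x : ℍ[ℝ]), mul_assoc, one_mul, inner_mul_left, Quaternion.inner_def,
      one_mul, Quaternion.re_star] at h2
    exact h2
  have h3 := sum_inner_imUnit_smul hre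
  conv_lhs => rw [h1, ← h3, Finset.mul_sum]
  refine Finset.sum_congr rfl fun b _ => ?_
  rw [mul_smul_comm]
  congr 1
  conv_rhs => rw [h1, inner_mul_left]

/-- The matrix whose columns are the coordinates of the fields `X a` with respect to the
left-invariant framing. -/
def coordMatrix (X : FieldTriple S3) (x : S3) : Matrix (Fin 3) (Fin 3) ℝ :=
  Matrix.of fun b a => inner ℝ ((x : ℍ[ℝ]) * imUnit b) (ambient x (X a x))

theorem eq_sum_coordMatrix (X : FieldTriple S3) (a : Fin 3) (x : S3) :
    X a x = ∑ b, coordMatrix X x b a • leftFrame b x := eq_sum_leftFrame x (X a x)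

/-- The triple of vector fields with given coordinates with respect to the left-invariant
framing. -/
def ofCoord (C : S3 → Matrix (Fin 3) (Fin 3) ℝ) : FieldTriple S3 :=
  fun a x => ∑ b, C x b a • leftFrame b x

theorem ofCoord_coordMatrix (X : FieldTriple S3) : ofCoord (coordMatrix X) = X := by
  ext1 a; ext1 x; exact (eq_sum_coordMatrix X a x).symm

theorem coordMatrix_ofCoord (C : S3 → Matrix (Fin 3) (Fin 3) ℝ) (x : S3) :
    coordMatrix (ofCoord C) x = C x := by
  ext b a
  simp only [coordMatrix, ofCoord, Matrix.of_apply, map_sum, map_smul, leftFrame_spec, inner_sum,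
    inner_smul_right, inner_mul_left, inner_imUnit_imUnit]
  simp

theorem coordMatrix_leftFrame (x : S3) : coordMatrix leftFrame x = 1 := by
  ext b a
  simp only [coordMatrix, Matrix.of_apply, leftFrame_spec, inner_mul_left, inner_imUnit_imUnit,
    Matrix.one_apply]

theorem linearIndependent_leftFrame (x : S3) : LinearIndependent ℝ fun a => leftFrame a x := by
  rw [Fintype.linearIndependent_iff]
  intro c hc i
  have := congrArg (fun w => inner ℝ ((x : ℍ[ℝ]) * imUnit i) (ambient x w)) hc
  simpa [leftFrame_spec, map_sum, inner_sum, inner_smul_right, inner_mul_left,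
    inner_imUnit_imUnit] using this

theorem sum_smul_eq_sum_mulVec (X : FieldTriple S3) (x : S3) (c : Fin 3 → ℝ) :
    ∑ a, c a • X a x = ∑ b, (coordMatrix X x *ᵥ c) b • leftFrame b x := by
  simp only [Matrix.mulVec, dotProduct, Finset.sum_smul]
  rw [Finset.sum_comm]
  refine Finset.sum_congr rfl fun a _ => ?_
  rw [eq_sum_coordMatrix X a x, Finset.smul_sum]
  refine Finset.sum_congr rfl fun b _ => ?_
  rw [smul_smul, mul_comm]

theorem sum_leftFrame_inj {x : S3} {c d : Fin 3 → ℝ}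
    (h : ∑ b, c b • leftFrame b x = ∑ b, d b • leftFrame b x) : c = d := by
  rw [← sub_eq_zero, ← Finset.sum_sub_distrib] at h
  simp only [← sub_smul] at h
  ext i
  exact sub_eq_zero.1 (Fintype.linearIndependent_iff.1 (linearIndependent_leftFrame x) _ h i)

/-- The transition matrix is the inverse of the coordinate matrix. -/
theorem isTransition_iff {X : FieldTriple S3} {x : S3} {P : Matrix (Fin 3) (Fin 3) ℝ} :
    IsTransition X x P ↔ coordMatrix X x * P = 1 := by
  have h1 : ∀ b, leftFrame b x = ∑ c, (1 : Matrix (Fin 3) (Fin 3) ℝ) c b • leftFrame c x := by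
    intro b; simp [Matrix.one_apply]
  constructor
  · intro h
    ext c b
    have h2 := h b
    rw [sum_smul_eq_sum_mulVec X x fun a => P a b, h1 b] at h2
    exact (congrFun (sum_leftFrame_inj h2) c).symm
  · intro h b
    rw [sum_smul_eq_sum_mulVec X x fun a => P a b, h1 b, ← h]
    rfl

theorem linearIndependent_iff_det_coordMatrix {X : FieldTriple S3} {x : S3} :
    LinearIndependent ℝ (fun a => X a x) ↔ (coordMatrix X x).det ≠ 0 := by
  rw [Fintype.linearIndependent_iff, ne_eq, ← Matrix.exists_mulVec_eq_zero_iff]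
  constructor
  · rintro h ⟨v, hv, h0⟩
    refine hv (funext fun i => h v ?_ i)
    rw [sum_smul_eq_sum_mulVec, h0]
    simp
  · intro h v hv i
    by_contra hi
    refine h ⟨v, fun h0 => hi (congrFun h0 i), ?_⟩
    rw [sum_smul_eq_sum_mulVec] at hv
    exact sum_leftFrame_inj (hv.trans (by simp))

theorem continuous_iff_coord {Z : Type*} [TopologicalSpace Z] {x : Z → S3}
    {V : ∀ z, TangentSpace (𝓡 3) (x z)} (hx : Continuous x) :
    Continuous (fun z => (⟨x z, V z⟩ : TangentBundle (𝓡 3) S3)) ↔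
      ∀ b, Continuous fun z =>
        (inner ℝ ((x z : ℍ[ℝ]) * imUnit b) (ambient (x z) (V z)) : ℝ) := by
  rw [continuous_tangentBundle_iff hx]
  have hx' : Continuous fun z => (x z : ℍ[ℝ]) := continuous_subtype_val.comp hx
  refine ⟨fun h b => (hx'.mul continuous_const).inner h, fun h => ?_⟩
  have e : ∀ z, ambient (x z) (V z) =
      ∑ b, (inner ℝ ((x z : ℍ[ℝ]) * imUnit b) (ambient (x z) (V z)) : ℝ) •
        ((x z : ℍ[ℝ]) * imUnit b) := by
    intro z
    conv_lhs => rw [eq_sum_leftFrame (x z) (V z), map_sum]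
    simp only [map_smul, leftFrame_spec]
  rw [funext e]
  exact continuous_finsetSum _ fun b _ => (h b).smul (hx'.mul continuous_const)

theorem continuous_family_iff {Z : Type*} [TopologicalSpace Z] {x : Z → S3}
    {X : Z → FieldTriple S3} (hx : Continuous x) :
    (∀ a, Continuous (fun z => (⟨x z, X z a (x z)⟩ : TangentBundle (𝓡 3) S3))) ↔
      Continuous fun z => coordMatrix (X z) (x z) := by
  simp only [continuous_iff_coord hx]
  exact ⟨fun h => continuous_matrix fun b a => h a b, fun h a b => h.matrix_elem b a⟩

theorem isFraming_iff {X : FieldTriple S3} :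
    IsFraming X ↔ Continuous (coordMatrix X) ∧ ∀ x, (coordMatrix X x).det ≠ 0 := by
  have h := continuous_family_iff (x := id) (X := fun _ : S3 => X) continuous_id
  simp only [id] at h
  rw [← h]
  exact ⟨fun hX => ⟨hX.1, fun x => linearIndependent_iff_det_coordMatrix.1 (hX.2 x)⟩,
    fun hX => ⟨hX.1, fun x => linearIndependent_iff_det_coordMatrix.2 (hX.2 x)⟩⟩

theorem isFraming_leftFrame : IsFraming leftFrame := by
  rw [isFraming_iff]
  refine ⟨?_, fun x => ?_⟩
  · rw [funext coordMatrix_leftFrame]; exact continuous_const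
  · rw [coordMatrix_leftFrame]; simp

/-- Homotopies of framings are homotopies of maps to `GL₃(ℝ)`. -/
theorem framingHomotopic_iff {X Y : FieldTriple S3} :
    FramingHomotopic X Y ↔ ∃ C : unitInterval × S3 → Matrix (Fin 3) (Fin 3) ℝ,
      Continuous C ∧ (∀ p, (C p).det ≠ 0) ∧ (∀ x, C (0, x) = coordMatrix X x) ∧
        ∀ x, C (1, x) = coordMatrix Y x := by
  constructor
  · rintro ⟨H, h0, h1, hf, hc⟩
    refine ⟨fun p => coordMatrix (H p.1) p.2, ?_, fun p => ?_, fun x => by simp only [h0],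
      fun x => by simp only [h1]⟩
    · exact (continuous_family_iff (X := fun p : unitInterval × S3 => H p.1) continuous_snd).1 hc
    · exact (isFraming_iff.1 (hf p.1)).2 p.2
  · rintro ⟨C, hC, hd, h0, h1⟩
    refine ⟨fun t => ofCoord fun x => C (t, x), ?_, ?_, fun t => ?_, ?_⟩
    · simp only [h0]; exact ofCoord_coordMatrix X
    · simp only [h1]; exact ofCoord_coordMatrix Y
    · rw [isFraming_iff]
      simp only [funext (coordMatrix_ofCoord fun x => C (t, x))]
      exact ⟨by fun_prop, fun x => hd _⟩
    · refine (continuous_family_iff (X := fun p : unitInterval × S3 => ofCoord fun x => C (p.1, x))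
        continuous_snd).2 ?_
      simp only [coordMatrix_ofCoord]
      exact hC

/-! ### Framing numbers -/

theorem continuous_matrix_inv {Z : Type*} [TopologicalSpace Z]
    {A : Z → Matrix (Fin 3) (Fin 3) ℝ} (hA : Continuous A) (h : ∀ z, (A z).det ≠ 0) :
    Continuous fun z => (A z)⁻¹ := by
  simp only [Matrix.inv_def, Ring.inverse_eq_inv']
  exact (hA.matrix_det.inv₀ h).smul hA.matrix_adjugate

theorem det_inv_ne_zero {A : Matrix (Fin 3) (Fin 3) ℝ} (h : A.det ≠ 0) : A⁻¹.det ≠ 0 := by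
  rw [Matrix.det_nonsing_inv, Ring.inverse_eq_inv']
  exact inv_ne_zero h

/-- If the transition map of `X` is deformed to `x ↦ adMatrix (f x)` through invertible matrices,
then the number of `X` is the degree of `f`. -/
theorem hasFramingNumber_of_path {X : FieldTriple S3} {n : ℤ}
    {P : unitInterval × S3 → Matrix (Fin 3) (Fin 3) ℝ} (hP : Continuous P)
    (hd : ∀ p, 0 < (P p).det) (h0 : ∀ x, IsTransition X x (P (0, x))) {f : C(S3, S3)}
    (h1 : ∀ x, P (1, x) = adMatrix (f x)) (hn : HasDegree f n) : HasFramingNumber X n := by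
  refine ⟨ofCoord fun x => (P (1, x))⁻¹, framingHomotopic_iff.2 ⟨fun p => (P p)⁻¹,
    continuous_matrix_inv hP fun p => (hd p).ne', fun p => det_inv_ne_zero (hd p).ne',
    fun x => Matrix.inv_eq_left_inv (isTransition_iff.1 (h0 x)),
    fun x => (coordMatrix_ofCoord (fun x => (P (1, x))⁻¹) x).symm⟩, f, fun x => ?_, hn⟩
  rw [isTransition_iff, coordMatrix_ofCoord, ← h1]
  exact Matrix.nonsing_inv_mul _ (isUnit_iff_ne_zero.2 (hd _).ne')

/-- The number of a framing is the degree of any lift to `S³` of its orthonormalised transition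
map. -/
theorem HasFramingNumber.hasDegree {X : FieldTriple S3} {n : ℤ} (hn : HasFramingNumber X n)
    {P : S3 → Matrix (Fin 3) (Fin 3) ℝ} (hP : ∀ x, IsTransition X x (P x)) {h : C(S3, S3)}
    (hh : ∀ x, adMatrix (h x) = gramSchmidt (P x)) : HasDegree h n := by
  obtain ⟨Y, hXY, f, hf, hfn⟩ := hn
  obtain ⟨C, hC, hCd, hC0, hC1⟩ := framingHomotopic_iff.1 hXY
  have e0 : ∀ x, (C (0, x))⁻¹ = P x := fun x => by
    rw [hC0]; exact Matrix.inv_eq_right_inv (isTransition_iff.1 (hP x))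
  have e1 : ∀ x, (C (1, x))⁻¹ = adMatrix (f x) := fun x => by
    rw [hC1]; exact Matrix.inv_eq_right_inv (isTransition_iff.1 (hf x))
  have hc := continuous_matrix_inv hC hCd
  -- a path of invertible matrices that ends at a rotation stays in the positive component
  have hpos : ∀ p, 0 < ((C p)⁻¹).det := by
    rintro ⟨t, x⟩
    by_contra hle
    obtain ⟨s, hs⟩ := mem_range_of_exists_le_of_exists_ge
      (f := fun s : unitInterval => ((C (s, x))⁻¹).det) (c := (0 : ℝ))
      ((hc.comp (Continuous.prodMk_left x)).matrix_det) ⟨t, not_lt.1 hle⟩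
      ⟨1, by simp only [e1, det_adMatrix]; exact zero_le_one⟩
    exact det_inv_ne_zero (hCd (s, x)) hs
  refine hfn.homotopic (homotopic_of_homotopy_adMatrix (H := fun p => gramSchmidt (C p)⁻¹)
    (continuous_gramSchmidt_comp hc hpos) (fun p => ⟨gramSchmidt_mul_transpose (hpos p),
      det_gramSchmidt (hpos p)⟩) (fun x => ?_) fun x => ?_)
  · rw [e0, hh]
  · rw [e1]
    exact gramSchmidt_eq_self (adMatrix_mul_transpose _) (det_adMatrix _)

/-- The transition map from the left-invariant framing to `X`. -/
def transition (X : FieldTriple S3) (x : S3) : Matrix (Fin 3) (Fin 3) ℝ := (coordMatrix X x)⁻¹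

theorem isTransition_transition {X : FieldTriple S3} (hX : IsFraming X) (x : S3) :
    IsTransition X x (transition X x) :=
  isTransition_iff.2 (Matrix.mul_nonsing_inv _ (isUnit_iff_ne_zero.2 ((isFraming_iff.1 hX).2 x)))

theorem continuous_transition {X : FieldTriple S3} (hX : IsFraming X) :
    Continuous (transition X) :=
  continuous_matrix_inv (isFraming_iff.1 hX).1 (isFraming_iff.1 hX).2

theorem det_transition_pos {X : FieldTriple S3} (h : IsPositive X) (x : S3) :
    0 < (transition X x).det := by
  obtain ⟨P, hP, hd⟩ := h x
  rwa [transition, Matrix.inv_eq_right_inv (isTransition_iff.1 hP)]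

theorem hasFramingNumber_unique {X : FieldTriple S3} (hX : IsFraming X) (hpos : IsPositive X)
    {m n : ℤ} (hm : HasFramingNumber X m) (hn : HasFramingNumber X n) : m = n := by
  obtain ⟨h, hh⟩ := exists_lift_adMatrix
    (continuous_gramSchmidt_comp (continuous_transition hX) (det_transition_pos hpos))
    fun x => ⟨gramSchmidt_mul_transpose (det_transition_pos hpos x),
      det_gramSchmidt (det_transition_pos hpos x)⟩
  exact HasDegree.unique_of_homotopic (.refl h) (hm.hasDegree (isTransition_transition hX) hh)
    (hn.hasDegree (isTransition_transition hX) hh)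

theorem sign_smul_injective {u v : ℤˣ} {x : S3} (h : u • x = v • x) : u = v := by
  have hne : x ≠ -x := fun h => by
    have h1 : (x : ℍ[ℝ]) = -x := congrArg Subtype.val h
    have h2 : (2 : ℝ) • (x : ℍ[ℝ]) = 0 := by
      rw [two_smul]; nth_rewrite 1 [h1]; exact neg_add_cancel _
    exact ne_zero_of_mem_unit_sphere x ((smul_eq_zero.1 h2).resolve_left two_ne_zero)
  rcases Int.units_eq_one_or u with rfl | rfl <;> rcases Int.units_eq_one_or v with rfl | rfl <;>
    simp only [sign_one_smul, sign_neg_one_smul] at h ⊢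
  · exact (hne h).elim
  · exact (hne h.symm).elim

/-- A lift to `S³` of a map to `SO(3)` invariant under a group is invariant up to a sign character
of the group. -/
theorem exists_sign_character {K : Type*} [Group K] (ρ : K →* O4) {q : C(S3, S3)}
    (h : ∀ k x, adMatrix (q (ρ k • x)) = adMatrix (q x)) :
    ∃ ε : K →* ℤˣ, ∀ k x, q (ρ k • x) = ε k • q x := by
  have h1 : ∀ k, ∃ u : ℤˣ, ∀ x, q (ρ k • x) = u • q x := by
    intro k
    rcases eq_or_eq_neg_of_forall_adMatrix_eq
      (f := q.comp ⟨fun x => ρ k • x, continuous_const_smul _⟩) (g := q) (h k) with h2 | h2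
    · exact ⟨1, fun x => by rw [sign_one_smul]; exact h2 x⟩
    · exact ⟨-1, fun x => by rw [sign_neg_one_smul]; exact h2 x⟩
  choose ε hε using h1
  refine ⟨{ toFun := ε, map_one' := ?_, map_mul' := fun k l => ?_ }, hε⟩
  · refine sign_smul_injective (x := q 1) ?_
    rw [← hε, map_one, one_smul, one_smul]
  · refine sign_smul_injective (x := q 1) ?_
    rw [← hε, map_mul, mul_smul, hε, hε, mul_smul]

/-- Let `X` be a positive framing of `S³` whose transition map `P` satisfies an equivariance
condition under a finite group `K` acting freely on `S³`: the product `P(x) adMatrix(e x)⁻¹` is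
`K`-invariant, for an auxiliary map `e` of degree `d`. This product orthonormalises and lifts to a
map `q : S³ → S³` that is `K`-invariant up to a sign character `ε`. The framing number is the degree
of `q e`, and the degree of `q` is divisible by the order of the kernel of `ε`. -/
theorem exists_framingNumber {X : FieldTriple S3} (hX : IsFraming X) (hpos : IsPositive X)
    {K : Type*} [Group K] [Finite K] (ρ : K →* O4) (hfree : ∀ k (x : S3), ρ k • x = x → k = 1)
    (hdet : ∀ k, 0 < LinearMap.det (ρ k : ℍ[ℝ] →ₗ[ℝ] ℍ[ℝ])) {e : C(S3, S3)} {d : ℤ}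
    (he : HasDegree e d)
    (hinv : ∀ k x, transition X (ρ k • x) * (adMatrix (e (ρ k • x)))ᵀ =
      transition X x * (adMatrix (e x))ᵀ) :
    ∃ n : ℤ, (∀ m, HasFramingNumber X m ↔ m = n) ∧
      ∃ ε : K →* ℤˣ, (Nat.card ε.ker : ℤ) ∣ n - d := by
  set T : S3 → Matrix (Fin 3) (Fin 3) ℝ := fun x => transition X x * (adMatrix (e x))ᵀ with hT
  have cA : Continuous fun x => adMatrix (e x) := continuous_adMatrix.comp e.continuous
  have cT : Continuous T := (continuous_transition hX).matrix_mul cA.matrix_transpose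
  have dT : ∀ x, 0 < (T x).det := fun x => by
    rw [hT]
    simp only [Matrix.det_mul, Matrix.det_transpose, det_adMatrix, mul_one]
    exact det_transition_pos hpos x
  have cG := continuous_gramSchmidt_comp cT dT
  obtain ⟨q, hq⟩ := exists_lift_adMatrix cG
    fun x => ⟨gramSchmidt_mul_transpose (dT x), det_gramSchmidt (dT x)⟩
  obtain ⟨ε, hε⟩ := exists_sign_character ρ (q := q) fun k x => by
    rw [hq, hq]
    exact congrArg gramSchmidt (hinv k x)
  obtain ⟨c, hc⟩ := exists_hasDegree q
  have hdvd : (Nat.card ε.ker : ℤ) ∣ c :=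
    HasDegree.card_dvd (ρ.comp ε.ker.subtype)
      (fun k x h => Subtype.ext (hfree _ x h)) (fun k => hdet _)
      (fun k x => by
        have h1 := hε k x
        rw [k.2, sign_one_smul] at h1
        exact h1) hc
  -- Deform `T` to `gramSchmidt T = adMatrix q`; then `T * adMatrix e` ends at `adMatrix (q * e)`.
  have hnum : HasFramingNumber X (c + d) := by
    refine hasFramingNumber_of_path (f := q * e)
      (P := fun p => ((1 - (p.1 : ℝ)) • T p.2 + (p.1 : ℝ) • gramSchmidt (T p.2)) *
        adMatrix (e p.2)) ?_ (fun p => ?_) (fun x => ?_) (fun x => ?_) (hc.mul he)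
    · have c1 : Continuous fun p : unitInterval × S3 => (p.1 : ℝ) :=
        continuous_subtype_val.comp continuous_fst
      exact (((continuous_const.sub c1).smul (cT.comp continuous_snd)).add
        (c1.smul (cG.comp continuous_snd))).matrix_mul (cA.comp continuous_snd)
    · rw [Matrix.det_mul, det_adMatrix, mul_one]
      exact det_segment_gramSchmidt_pos (dT p.2) p.1.2.1 p.1.2.2
    · have h2 : (adMatrix (e x))ᵀ * adMatrix (e x) = 1 :=
        mul_eq_one_comm.1 (adMatrix_mul_transpose _)
      have h3 := isTransition_transition hX x
      simpa [hT, Matrix.mul_assoc, h2] using h3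
    · rw [ContinuousMap.mul_apply, adMatrix_mul, hq]
      simp
  exact ⟨c + d, fun m => ⟨fun hm => hasFramingNumber_unique hX hpos hm hnum, fun h => h ▸ hnum⟩,
    ε, by simpa using hdvd⟩

theorem hasFramingNumber_zero_of_homotopic_leftFrame {X : FieldTriple S3}
    (h : FramingHomotopic X leftFrame) : HasFramingNumber X 0 := by
  refine ⟨leftFrame, h, ContinuousMap.const S3 1, fun x => ?_, hasDegree_const 1⟩
  rw [isTransition_iff, coordMatrix_leftFrame, one_mul]
  exact adMatrix_one

/-! ### Framings of the quotient -/

theorem isInvertible_of_injective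
    {f : EuclideanSpace ℝ (Fin 3) →L[ℝ] EuclideanSpace ℝ (Fin 3)} (h : Function.Injective f) :
    f.IsInvertible :=
  ⟨(LinearEquiv.ofInjectiveEndo (f : EuclideanSpace ℝ (Fin 3) →ₗ[ℝ] EuclideanSpace ℝ (Fin 3))
    h).toContinuousLinearEquiv, by ext1 v; rfl⟩

theorem linearIndependent_map_of_injective
    {f : EuclideanSpace ℝ (Fin 3) →L[ℝ] EuclideanSpace ℝ (Fin 3)} (hf : Function.Injective f)
    {v : Fin 3 → EuclideanSpace ℝ (Fin 3)} (hv : LinearIndependent ℝ v) :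
    LinearIndependent ℝ fun a => f (v a) :=
  hv.map_injOn (f : EuclideanSpace ℝ (Fin 3) →ₗ[ℝ] EuclideanSpace ℝ (Fin 3)) hf.injOn

theorem mdifferentiableAt_smul_S3 (k : O4) (x : S3) :
    MDifferentiableAt (𝓡 3) (𝓡 3) (fun x : S3 => k • x) x :=
  (contMDiff_smul_S3 k x).mdifferentiableAt (by simp)

/-- The differential of a linear isometry, restricted to the sphere, is the isometry itself. -/
theorem ambient_mfderiv_smul (k : O4) (x : S3) (u : TangentSpace (𝓡 3) x) :
    ambient (k • x) (mfderiv (𝓡 3) (𝓡 3) (fun x : S3 => k • x) x u) = k (ambient x u) := by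
  have h1 := congrArg (fun A => A u) (mfderiv_comp x (mdifferentiableAt_coe_S3 (k • x))
    (mdifferentiableAt_smul_S3 k x))
  have hk : HasMFDerivAt 𝓘(ℝ, ℍ[ℝ]) 𝓘(ℝ, ℍ[ℝ]) (fun v : ℍ[ℝ] => k v) (x : ℍ[ℝ])
      (k.toContinuousLinearEquiv : ℍ[ℝ] →L[ℝ] ℍ[ℝ]) :=
    k.toContinuousLinearEquiv.hasFDerivAt.hasMFDerivAt
  have h2 := congrArg (fun A => A u)
    (hk.comp x (mdifferentiableAt_coe_S3 x).hasMFDerivAt).mfderiv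
  exact h1.symm.trans h2

theorem injective_mfderiv_smul (k : O4) (x : S3) :
    Function.Injective (mfderiv (𝓡 3) (𝓡 3) (fun x : S3 => k • x) x) := by
  intro u v h
  have h1 := ambient_mfderiv_smul k x u
  rw [h, ambient_mfderiv_smul] at h1
  exact (ambient_injective x (k.injective h1)).symm

section

variable {M : Type} [TopologicalSpace M] [ChartedSpace (EuclideanSpace ℝ (Fin 3)) M]
  {q : S3 → M}

theorem mfderiv_pullback (hi : ∀ x, (mfderiv (𝓡 3) (𝓡 3) q x).IsInvertible) (X : FieldTriple M)
    (a : Fin 3) (x : S3) : mfderiv (𝓡 3) (𝓡 3) q x (pullback q X a x) = X a (q x) := by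
  obtain ⟨e, he⟩ := hi x
  rw [pullback, VectorField.mpullback_apply, ← he, ContinuousLinearMap.inverse_equiv]
  exact e.apply_symm_apply _

theorem mfderiv_smul_of_invariant (hq : ContMDiff (𝓡 3) (𝓡 3) ∞ q) {k : O4}
    (hk : ∀ x, q (k • x) = q x) (x : S3) (u : TangentSpace (𝓡 3) x) :
    (mfderiv (𝓡 3) (𝓡 3) q (k • x) (mfderiv (𝓡 3) (𝓡 3) (fun x : S3 => k • x) x u) :
      EuclideanSpace ℝ (Fin 3)) = mfderiv (𝓡 3) (𝓡 3) q x u := by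
  have h1 := mfderiv_comp_apply x ((hq (k • x)).mdifferentiableAt (by simp))
    (mdifferentiableAt_smul_S3 k x) u
  have h2 : q ∘ (fun x : S3 => k • x) = q := funext hk
  rw [h2] at h1
  exact h1.symm

/-- The pullback of a vector field under a `k`-invariant map is `k`-equivariant. -/
theorem ambient_pullback_smul (hq : ContMDiff (𝓡 3) (𝓡 3) ∞ q)
    (hi : ∀ x, (mfderiv (𝓡 3) (𝓡 3) q x).IsInvertible) {k : O4} (hk : ∀ x, q (k • x) = q x)
    (X : FieldTriple M) (a : Fin 3) (x : S3) :
    ambient (k • x) (pullback q X a (k • x)) = k (ambient x (pullback q X a x)) := by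
  rw [← ambient_mfderiv_smul]
  congr 1
  obtain ⟨e, he⟩ := hi (k • x)
  apply e.injective
  have h1 : ∀ v, e v = mfderiv (𝓡 3) (𝓡 3) q (k • x) v := fun v => by rw [← he]; rfl
  rw [h1, h1, mfderiv_pullback hi]
  have h2 := mfderiv_smul_of_invariant hq hk x (pullback q X a x)
  refine Eq.trans ?_ h2.symm
  rw [mfderiv_pullback hi]
  exact congrArg (fun m => (X a m : EuclideanSpace ℝ (Fin 3))) (hk x)

variable [IsManifold (𝓡 3) ∞ M]

theorem isFraming_pullback (hq : ContMDiff (𝓡 3) (𝓡 3) ∞ q)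
    (hi : ∀ x, (mfderiv (𝓡 3) (𝓡 3) q x).IsInvertible) {X : FieldTriple M} (hX : IsFraming X) :
    IsFraming (pullback q X) := by
  refine ⟨fun a => ?_, fun x => ?_⟩
  · have : IsManifold (𝓡 3) 1 M := IsManifold.of_le (n := ∞) (by simp)
    have h := contMDiff_zero_iff.1 (ContMDiff.mpullback_vectorField (m := 0)
      (contMDiff_zero_iff.2 (hX.1 a)) hq hi (by simp))
    exact h
  · have h := hX.2 (q x)
    obtain ⟨e, he⟩ := hi x
    have h1 : ∀ a, pullback q X a x = e.symm (X a (q x)) := fun a => by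
      rw [pullback, VectorField.mpullback_apply, ← he, ContinuousLinearMap.inverse_equiv]
      rfl
    simp only [h1]
    let e' : EuclideanSpace ℝ (Fin 3) ≃L[ℝ] EuclideanSpace ℝ (Fin 3) := e.symm
    exact linearIndependent_map_of_injective
      (f := (e' : EuclideanSpace ℝ (Fin 3) →L[ℝ] EuclideanSpace ℝ (Fin 3))) e'.injective h

end

/-! ### The covering map `S³ → S³/G` -/

section

variable (G : Subgroup O4) [Finite G] [IsCancelSMul G S3]

theorem isQuotientCoveringMap_proj : IsQuotientCoveringMap (proj G) G :=
  isQuotientCoveringMap_quotientMk_of_properlyDiscontinuousSMul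

theorem proj_smul (γ : G) (x : S3) : proj G ((γ : O4) • x) = proj G x :=
  (isQuotientCoveringMap_proj G).map_smul γ

theorem proj_eq_iff {x y : S3} : proj G x = proj G y ↔ ∃ γ : G, (γ : O4) • y = x := by
  rw [(isQuotientCoveringMap_proj G).apply_eq_iff_mem_orbit]
  rfl

/-- In the charts of the quotient, the covering map is the action of an element of `G` followed by
a chart of `S³`. -/
theorem exists_extChartAt_comp_proj (x : S3) : ∃ (γ : O4) (b : S3),
    γ • x ∈ (extChartAt (𝓡 3) b).source ∧
      extChartAt (𝓡 3) (proj G x) ∘ proj G =ᶠ[𝓝 x] fun z => extChartAt (𝓡 3) b (γ • z) := by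
  have hq := isQuotientCoveringMap_proj G
  have hf := hq.isCoveringMap.isLocalHomeomorph
  obtain ⟨b, hb, hchart⟩ : ∃ b : S3, proj G b = proj G x ∧
      chartAt (EuclideanSpace ℝ (Fin 3)) (proj G x) =
        (hf.localInverseAt b).trans (chartAt (EuclideanSpace ℝ (Fin 3)) b) :=
    ⟨_, Quotient.mk_surjective.hasRightInverse.choose_spec (proj G x), rfl⟩
  obtain ⟨γ, hγ⟩ := (proj_eq_iff G).1 hb
  set l := hf.localInverseAt b with hl
  have hls : ⇑l.symm = proj G := hf.localInverseAt_symm b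
  have hbt : b ∈ l.target := hf.self_mem_localInverseAt_target
  refine ⟨γ, b, by rw [hγ]; exact mem_extChartAt_source b, ?_⟩
  have hcont : Continuous fun z : S3 => (γ : O4) • z := continuous_const_smul _
  filter_upwards [hcont.continuousAt.preimage_mem_nhds
    (l.open_target.mem_nhds (by rw [hγ]; exact hbt))] with z hz
  have h2 : l.symm ((γ : O4) • z) = proj G z := by rw [hls]; exact proj_smul G γ z
  have h3 : l (proj G z) = (γ : O4) • z := by rw [← h2]; exact l.right_inv hz
  simp only [Function.comp_apply, extChartAt_coe, hchart, OpenPartialHomeomorph.coe_trans, h3]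

theorem contMDiff_proj : ContMDiff (𝓡 3) (𝓡 3) ∞ (proj G) := by
  intro x
  obtain ⟨γ, b, hb, h⟩ := exists_extChartAt_comp_proj G x
  rw [contMDiffAt_iff_target]
  refine ⟨(isQuotientCoveringMap_proj G).toIsQuotientMap.continuous.continuousAt, ?_⟩
  refine ContMDiffAt.congr_of_eventuallyEq ?_ h
  rw [extChartAt_source] at hb
  exact (contMDiffAt_extChartAt' hb).comp x (contMDiff_smul_S3 γ x)

theorem injective_mfderiv_proj (x : S3) :
    Function.Injective (mfderiv (𝓡 3) (𝓡 3) (proj G) x) := by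
  obtain ⟨γ, b, hb, h⟩ := exists_extChartAt_comp_proj G x
  have hinj : Function.Injective (mfderiv (𝓡 3) 𝓘(ℝ, EuclideanSpace ℝ (Fin 3))
      (extChartAt (𝓡 3) (proj G x) ∘ proj G) x) := by
    rw [h.mfderiv_eq]
    have hb' := hb
    rw [extChartAt_source] at hb'
    have e := mfderiv_comp x (g := extChartAt (𝓡 3) b) (f := fun z : S3 => γ • z)
      (mdifferentiableAt_extChartAt hb') (mdifferentiableAt_smul_S3 γ x)
    change Function.Injective (mfderiv (𝓡 3) 𝓘(ℝ, EuclideanSpace ℝ (Fin 3))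
      (extChartAt (𝓡 3) b ∘ fun z : S3 => γ • z) x)
    rw [e]
    exact (isInvertible_mfderiv_extChartAt hb).injective.comp (injective_mfderiv_smul γ x)
  have hd : MDifferentiableAt (𝓡 3) (𝓡 3) (proj G) x := (contMDiff_proj G x).mdifferentiableAt (by simp)
  rw [mfderiv_comp x (mdifferentiableAt_extChartAt (mem_chart_source _ _)) hd] at hinj
  exact Function.Injective.of_comp hinj

theorem contMDiff_proj_smul (r : O4) :
    ContMDiff (𝓡 3) (𝓡 3) ∞ fun x : S3 => proj G (r • x) :=
  (contMDiff_proj G).comp (contMDiff_smul_S3 r)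

theorem isInvertible_mfderiv_proj_smul (r : O4) (x : S3) :
    (mfderiv (𝓡 3) (𝓡 3) (fun x : S3 => proj G (r • x)) x).IsInvertible := by
  refine isInvertible_of_injective ?_
  have e := mfderiv_comp x (g := proj G) (f := fun z : S3 => r • z)
    ((contMDiff_proj G (r • x)).mdifferentiableAt (by simp)) (mdifferentiableAt_smul_S3 r x)
  change Function.Injective (mfderiv (𝓡 3) (𝓡 3) (proj G ∘ fun x : S3 => r • x) x)
  rw [e]
  exact (injective_mfderiv_proj G (r • x)).comp (injective_mfderiv_smul r x)

theorem isInvertible_mfderiv_proj (x : S3) :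
    (mfderiv (𝓡 3) (𝓡 3) (proj G) x).IsInvertible :=
  isInvertible_of_injective (injective_mfderiv_proj G x)

/-- A `G`-equivariant framing of `S³` descends to `S³/G`. -/
theorem exists_framing_of_equivariant {F : FieldTriple S3} (hF : IsFraming F)
    (h : ∀ (γ : G) a x, ambient ((γ : O4) • x) (F a ((γ : O4) • x)) = (γ : O4) (ambient x (F a x))) :
    ∃ X : FieldTriple (Quot3 G), IsFraming X ∧ pullback (proj G) X = F := by
  -- push the frame forward from an arbitrary point `s m` of the fibre over `m`
  let s : Quot3 G → S3 := Function.surjInv (f := proj G) Quotient.mk_surjective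
  have hs : ∀ m, proj G (s m) = m := Function.surjInv_eq (f := proj G) Quotient.mk_surjective
  let X : FieldTriple (Quot3 G) := fun a m =>
    (mfderiv (𝓡 3) (𝓡 3) (proj G) (s m) (F a (s m)) : EuclideanSpace ℝ (Fin 3))
  have hX : ∀ a x, X a (proj G x) = mfderiv (𝓡 3) (𝓡 3) (proj G) x (F a x) := by
    intro a x
    obtain ⟨γ, hγ⟩ := (proj_eq_iff G).1 (hs (proj G x))
    have h1 := mfderiv_smul_of_invariant (contMDiff_proj G) (proj_smul G γ) x (F a x)
    have h2 : mfderiv (𝓡 3) (𝓡 3) (fun x : S3 => (γ : O4) • x) x (F a x) = F a ((γ : O4) • x) :=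
      ambient_injective _ ((ambient_mfderiv_smul γ x _).trans (h γ a x).symm)
    rw [h2] at h1
    refine Eq.trans ?_ h1
    exact congrArg (fun z => (mfderiv (𝓡 3) (𝓡 3) (proj G) z (F a z) : EuclideanSpace ℝ (Fin 3)))
      hγ.symm
  refine ⟨X, ⟨fun a => ?_, fun m => ?_⟩, ?_⟩
  · rw [(isQuotientCoveringMap_proj G).toIsQuotientMap.continuous_iff]
    have h1 : (fun m => (⟨m, X a m⟩ : TangentBundle (𝓡 3) (Quot3 G))) ∘ proj G =
        fun x => tangentMap (𝓡 3) (𝓡 3) (proj G) (⟨x, F a x⟩ : TangentBundle (𝓡 3) S3) := by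
      ext1 x
      simp only [Function.comp_apply, hX]
      rfl
    rw [h1]
    exact ((contMDiff_proj G).continuous_tangentMap (by simp)).comp (hF.1 a)
  · obtain ⟨x, rfl⟩ := Quotient.mk_surjective m
    change LinearIndependent ℝ fun a => X a (proj G x)
    simp only [hX]
    exact linearIndependent_map_of_injective (f := mfderiv (𝓡 3) (𝓡 3) (proj G) x)
      (injective_mfderiv_proj G x) (hF.2 x)
  · ext1 a; ext1 x
    apply injective_mfderiv_proj G x
    rw [mfderiv_pullback (isInvertible_mfderiv_proj G), hX]

end

/-! ### Left and right multiplications -/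

/-- Left multiplications preserve the left-invariant framing, so the transition map of an equivariant
framing is invariant. -/
theorem transition_smul_left {X : FieldTriple S3} {h x : S3}
    (hX : ∀ a, ambient (phi (h, 1) • x) (X a (phi (h, 1) • x)) = phi (h, 1) (ambient x (X a x))) :
    transition X (phi (h, 1) • x) = transition X x := by
  have : coordMatrix X (phi (h, 1) • x) = coordMatrix X x := by
    ext b a
    simp only [coordMatrix, Matrix.of_apply, hX]
    conv_rhs => rw [← (phi (h, 1)).inner_map_map]
    simp [mul_assoc]
  rw [transition, this, transition]

/-- Right multiplication by `h⁻¹` rotates the left-invariant framing by `adMatrix h`. -/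
theorem transition_smul_right {X : FieldTriple S3} {h x : S3}
    (hX : ∀ a, ambient (phi (1, h) • x) (X a (phi (1, h) • x)) = phi (1, h) (ambient x (X a x))) :
    transition X (phi (1, h) • x) = transition X x * (adMatrix h)ᵀ := by
  have e1 : ∀ b, ((phi (1, h) • x : S3) : ℍ[ℝ]) * imUnit b =
      ∑ c, adMatrix h⁻¹ c b • phi (1, h) ((x : ℍ[ℝ]) * imUnit c) := by
    intro b
    simp only [← map_smul, ← map_sum, ← mul_smul_comm, ← Finset.mul_sum, ← conj_imUnit]
    rw [inv_inv]
    simp only [coe_smul_S3, phi_apply, Metric.unitSphere.coe_one, one_mul, mul_assoc,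
      coe_mul_inv_S3, mul_one]
  have : coordMatrix X (phi (1, h) • x) = adMatrix h * coordMatrix X x := by
    ext b a
    simp only [coordMatrix, Matrix.of_apply, hX, e1, sum_inner, inner_smul_left,
      LinearIsometryEquiv.inner_map_map, Matrix.mul_apply, adMatrix_inv, Matrix.transpose_apply]
    simp
  have hinv : (adMatrix h)⁻¹ = (adMatrix h)ᵀ := Matrix.inv_eq_right_inv (adMatrix_mul_transpose h)
  rw [transition, this, Matrix.mul_inv_rev, hinv, transition]

/-- The right-invariant framing of `S³`: at `x` it is `(ix, jx, kx)`. -/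
def rightFrame : FieldTriple S3 := ofCoord fun x => (adMatrix x)ᵀ

theorem ambient_rightFrame (a : Fin 3) (x : S3) :
    ambient x (rightFrame a x) = imUnit a * (x : ℍ[ℝ]) := by
  simp only [rightFrame, ofCoord, map_sum, map_smul, leftFrame_spec, ← adMatrix_inv,
    ← mul_smul_comm, ← Finset.mul_sum, ← conj_imUnit, inv_inv]
  rw [← mul_assoc, ← mul_assoc, coe_mul_inv_S3, one_mul]

theorem isFraming_rightFrame : IsFraming rightFrame := by
  rw [isFraming_iff, rightFrame]
  simp only [funext (coordMatrix_ofCoord fun x => (adMatrix x)ᵀ)]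
  exact ⟨continuous_adMatrix.matrix_transpose, fun x => by
    rw [Matrix.det_transpose, det_adMatrix]; exact one_ne_zero⟩

theorem isPositive_rightFrame : IsPositive rightFrame := fun x =>
  ⟨adMatrix x, isTransition_iff.2 (by
    rw [rightFrame, coordMatrix_ofCoord]; exact mul_eq_one_comm.1 (adMatrix_mul_transpose x)),
    by rw [det_adMatrix]; exact one_pos⟩

theorem isPositive_leftFrame : IsPositive leftFrame := fun x =>
  ⟨1, isTransition_iff.2 (by rw [coordMatrix_leftFrame, one_mul]), by simp⟩

/-! ### Singular chains with coefficients in `ℤ/2` -/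

/-- The topological `n`-simplex. -/
abbrev Simp (n : ℕ) : Type := stdSimplex ℝ (Fin (n + 1))

/-- The coefficient module `ℤ/2`. -/
abbrev F2 : ModuleCat.{0} (ZMod 2) := ModuleCat.of (ZMod 2) (ZMod 2)

/-- The singular chain complex of `X` with coefficients in `ℤ/2`. -/
abbrev chains (X : Type) [TopologicalSpace X] : ChainComplex (ModuleCat.{0} (ZMod 2)) ℕ :=
  (TopCat.toSSet.obj (TopCat.of X)).chainComplex F2

/-- The inclusion of the `i`-th face of the `(n+1)`-simplex. -/
def faceMap {n : ℕ} (i : Fin (n + 2)) : C(Simp n, Simp (n + 1)) :=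
  ⟨stdSimplex.map i.succAbove, stdSimplex.continuous_map _⟩

section

variable {X : Type} [TopologicalSpace X]

/-- The chain given by a singular simplex. -/
def single {n : ℕ} (σ : C(Simp n, X)) : F2 ⟶ (chains X).X n :=
  (TopCat.toSSet.obj (TopCat.of X)).ιChainComplex
    ((TopCat.toSSetObjEquiv (TopCat.of X) (Opposite.op (SimplexCategory.mk n))).symm σ)

theorem single_d {n : ℕ} (σ : C(Simp (n + 1), X)) :
    single σ ≫ (chains X).d (n + 1) n =
      ∑ i : Fin (n + 2), (-1) ^ i.val • single (σ.comp (faceMap i)) := by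
  rw [single, SSet.ιChainComplex_d]
  rfl

/-- The chain groups are free on the singular simplices: homomorphisms are determined by their values
on simplices. -/
theorem chains_hom_ext {n : ℕ} {T : ModuleCat.{0} (ZMod 2)} {f g : (chains X).X n ⟶ T}
    (h : ∀ σ : C(Simp n, X), single σ ≫ f = single σ ≫ g) : f = g := by
  refine SSet.chainComplex_hom_ext fun x => ?_
  have := h (TopCat.toSSetObjEquiv (TopCat.of X) (Opposite.op (SimplexCategory.mk n)) x)
  rwa [single, Equiv.symm_apply_apply] at this

/-- The chain groups are free on the singular simplices: homomorphisms can be prescribed on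
simplices. -/
theorem exists_chains_hom {n : ℕ} {T : ModuleCat.{0} (ZMod 2)} (φ : C(Simp n, X) → (F2 ⟶ T)) :
    ∃ f : (chains X).X n ⟶ T, ∀ σ, single σ ≫ f = φ σ := by
  refine ⟨Limits.Cofan.IsColimit.desc
    ((TopCat.toSSet.obj (TopCat.of X)).isColimitChainComplexXCofan F2 n)
    fun x => φ (TopCat.toSSetObjEquiv (TopCat.of X) (Opposite.op (SimplexCategory.mk n)) x),
    fun σ => ?_⟩
  have := Limits.Cofan.IsColimit.fac
    ((TopCat.toSSet.obj (TopCat.of X)).isColimitChainComplexXCofan F2 n)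
    (fun x => φ (TopCat.toSSetObjEquiv (TopCat.of X) (Opposite.op (SimplexCategory.mk n)) x))
    ((TopCat.toSSetObjEquiv (TopCat.of X) (Opposite.op (SimplexCategory.mk n))).symm σ)
  rw [Equiv.apply_symm_apply] at this
  exact this

theorem isZero_H1Mod2_iff :
    Limits.IsZero (H1Mod2 X) ↔ ∀ z : (chains X).X 1, (chains X).d 1 0 z = 0 →
      ∃ w : (chains X).X 2, (chains X).d 2 1 w = z := by
  change Limits.IsZero ((chains X).homology 1) ↔ _
  rw [← HomologicalComplex.exactAt_iff_isZero_homology,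
    HomologicalComplex.exactAt_iff' _ 2 1 0 (by simp) (by simp), ShortComplex.moduleCat_exact_iff]
  rfl

theorem hom_neg_eq_self {S T : ModuleCat.{0} (ZMod 2)} (f : S ⟶ T) : -f = f := by
  ext x
  exact ZModModule.neg_eq_self (f x)

theorem hom_add_self {S T : ModuleCat.{0} (ZMod 2)} (f : S ⟶ T) : f + f = 0 := by
  nth_rewrite 1 [← hom_neg_eq_self f]
  exact neg_add_cancel f

theorem one_simplex_d (σ : C(Simp 1, X)) :
    single σ ≫ (chains X).d 1 0 =
      single (σ.comp (faceMap 0)) + single (σ.comp (faceMap 1)) := by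
  rw [single_d, Fin.sum_univ_two]
  simp [hom_neg_eq_self]

theorem two_simplex_d (σ : C(Simp 2, X)) :
    single σ ≫ (chains X).d 2 1 =
      single (σ.comp (faceMap 0)) + single (σ.comp (faceMap 1)) + single (σ.comp (faceMap 2)) := by
  rw [single_d, Fin.sum_univ_three]
  simp [hom_neg_eq_self]

end

/-! ### Simplices: vertices, lifts and fillings -/

/-- The `i`-th vertex of the simplex. -/
abbrev vert {n : ℕ} (i : Fin (n + 1)) : Simp n := stdSimplex.vertex i

theorem faceMap_vert {n : ℕ} (i : Fin (n + 2)) (j : Fin (n + 1)) :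
    faceMap i (vert j) = vert (i.succAbove j) := stdSimplex.map_vertex _ _

theorem simp_zero_eq (a : Simp 0) : a = vert 0 := by
  have : Subsingleton (Simp 0) := inferInstanceAs (Subsingleton (stdSimplex ℝ (Fin 1)))
  exact Subsingleton.elim _ _

instance instContractibleSpaceSimp (n : ℕ) : ContractibleSpace (Simp n) :=
  (convex_stdSimplex ℝ (Fin (n + 1))).contractibleSpace ⟨_, (vert (0 : Fin (n + 1))).2⟩

/-- Maps from a contractible space lift along a covering: lift a contraction. -/
theorem exists_lift_of_contractible {E X A : Type*} [TopologicalSpace E] [TopologicalSpace X]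
    [TopologicalSpace A] [ContractibleSpace A] {p : E → X} (cov : IsCoveringMap p)
    (hs : Function.Surjective p) (f : C(A, X)) : ∃ F : C(A, E), ∀ a, p (F a) = f a := by
  obtain ⟨y, ⟨H⟩⟩ := id_nullhomotopic A
  obtain ⟨e, he⟩ := hs (f y)
  set K : C(unitInterval × A, X) := f.comp H.symm.toContinuousMap with hK
  have H0 : ∀ a, K (0, a) = p (ContinuousMap.const A e a) := fun a => by
    rw [hK, ContinuousMap.const_apply, he]
    exact congrArg f (H.symm.apply_zero a)
  refine ⟨(cov.liftHomotopy K (ContinuousMap.const A e) H0).comp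
    ((ContinuousMap.const A 1).prodMk (ContinuousMap.id A)), fun a => ?_⟩
  refine (congrFun (cov.liftHomotopy_lifts K (ContinuousMap.const A e) H0) (1, a)).trans ?_
  exact congrArg f (H.symm.apply_one a)

theorem coe_faceMap_two (s : Simp 1) : (faceMap 2 s : Fin 3 → ℝ) = ![s 0, s 1, 0] := by
  ext i
  change FunOnFinite.linearMap ℝ ℝ (Fin.succAbove 2) s i = _
  rw [FunOnFinite.linearMap_apply_apply, Finset.sum_filter, Fin.sum_univ_two]
  fin_cases i <;> simp [Fin.succAbove]

theorem coe_faceMap_one (s : Simp 1) : (faceMap 1 s : Fin 3 → ℝ) = ![s 0, 0, s 1] := by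
  ext i
  change FunOnFinite.linearMap ℝ ℝ (Fin.succAbove 1) s i = _
  rw [FunOnFinite.linearMap_apply_apply, Finset.sum_filter, Fin.sum_univ_two]
  fin_cases i <;> simp [Fin.succAbove]

theorem coe_faceMap_zero (s : Simp 1) : (faceMap 0 s : Fin 3 → ℝ) = ![0, s 0, s 1] := by
  ext i
  change FunOnFinite.linearMap ℝ ℝ (Fin.succAbove 0) s i = _
  rw [FunOnFinite.linearMap_apply_apply, Finset.sum_filter, Fin.sum_univ_two]
  fin_cases i <;> simp [Fin.succAbove]

/-- The map from the square to the triangle that collapses two opposite sides to the vertices `0`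
and `2`, maps the bottom side to the edge `02` and the top side to the two other edges. -/
def squareToSimp (p : unitInterval × unitInterval) : Simp 2 :=
  ⟨![1 - (p.2 : ℝ) - (1 - (p.1 : ℝ)) * min (p.2 : ℝ) (1 - p.2),
      2 * ((1 - (p.1 : ℝ)) * min (p.2 : ℝ) (1 - p.2)),
      (p.2 : ℝ) - (1 - (p.1 : ℝ)) * min (p.2 : ℝ) (1 - p.2)], by
    have h0 := p.1.2.1
    have h1 := p.1.2.2
    have h2 := p.2.2.1
    have h3 := p.2.2.2
    have hm : 0 ≤ min (p.2 : ℝ) (1 - p.2) := le_min h2 (by linarith)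
    have hm1 : min (p.2 : ℝ) (1 - p.2) ≤ p.2 := min_le_left _ _
    have hm2 : min (p.2 : ℝ) (1 - p.2) ≤ 1 - p.2 := min_le_right _ _
    have h4 : (1 - (p.1 : ℝ)) * min (p.2 : ℝ) (1 - p.2) ≤ min (p.2 : ℝ) (1 - p.2) :=
      mul_le_of_le_one_left hm (by linarith)
    have h5 : 0 ≤ (1 - (p.1 : ℝ)) * min (p.2 : ℝ) (1 - p.2) := mul_nonneg (by linarith) hm
    refine ⟨fun i => ?_, ?_⟩
    · fin_cases i <;> simp <;> linarith
    · rw [Fin.sum_univ_three]; simp; ring⟩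

theorem continuous_squareToSimp : Continuous squareToSimp := by
  refine Continuous.subtype_mk (continuous_pi fun i => ?_) _
  fin_cases i <;> simp <;> fun_prop

theorem surjective_squareToSimp : Function.Surjective squareToSimp := by
  intro t
  have h0 : 0 ≤ t 0 := t.2.1 0
  have h1 : 0 ≤ t 1 := t.2.1 1
  have h2 : 0 ≤ t 2 := t.2.1 2
  have hs : t 0 + t 1 + t 2 = 1 := by rw [← Fin.sum_univ_three]; exact t.2.2
  set m := min (t 2 + t 1 / 2) (1 - (t 2 + t 1 / 2)) with hm
  have hm1 : t 1 / 2 ≤ m := le_min (by linarith) (by linarith)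
  have key : ∃ s : unitInterval, (1 - (s : ℝ)) * m = t 1 / 2 := by
    rcases h1.eq_or_lt with h | h
    · exact ⟨1, by simp [← h]⟩
    · have hm0 : 0 < m := by linarith
      refine ⟨⟨1 - t 1 / 2 / m, ?_, ?_⟩, ?_⟩
      · rw [sub_nonneg, div_le_one hm0]; exact hm1
      · rw [sub_le_self_iff]; positivity
      · rw [sub_sub_cancel]; field_simp
  obtain ⟨s, hs'⟩ := key
  refine ⟨(s, ⟨t 2 + t 1 / 2, by linarith, by linarith⟩), ?_⟩
  refine Subtype.ext (funext fun i => ?_)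
  simp only [squareToSimp, ← hm, hs']
  fin_cases i
  · change 1 - (t 2 + t 1 / 2) - t 1 / 2 = t 0; linarith
  · change 2 * (t 1 / 2) = t 1; linarith
  · change t 2 + t 1 / 2 - t 1 / 2 = t 2; linarith

/-- The only points that `squareToSimp` identifies lie on a common one of the two collapsed sides. -/
theorem squareToSimp_eq {p q : unitInterval × unitInterval} (h : squareToSimp p = squareToSimp q) :
    p.2 = q.2 ∧ (p.1 = q.1 ∨ p.2 = 0 ∨ p.2 = 1) := by
  have h1 : 2 * ((1 - (p.1 : ℝ)) * min (p.2 : ℝ) (1 - p.2)) =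
      2 * ((1 - (q.1 : ℝ)) * min (q.2 : ℝ) (1 - q.2)) :=
    congrFun (congrArg Subtype.val h) 1
  have h2 : (p.2 : ℝ) - (1 - (p.1 : ℝ)) * min (p.2 : ℝ) (1 - p.2) =
      (q.2 : ℝ) - (1 - (q.1 : ℝ)) * min (q.2 : ℝ) (1 - q.2) :=
    congrFun (congrArg Subtype.val h) 2
  have e2 : p.2 = q.2 := Subtype.ext (by linarith)
  refine ⟨e2, ?_⟩
  rw [← e2] at h1
  by_cases hm : min (p.2 : ℝ) (1 - p.2) = 0
  · right
    rcases min_choice (p.2 : ℝ) (1 - p.2) with h3 | h3 <;> rw [h3] at hm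
    · exact .inl (Subtype.ext hm)
    · exact .inr (Subtype.ext (sub_eq_zero.1 hm).symm)
  · left
    have h4 := mul_right_cancel₀ hm (mul_left_cancel₀ two_ne_zero h1)
    exact Subtype.ext (by linarith)

/-- The path that a singular `1`-simplex defines. -/
def simpPath {X : Type} [TopologicalSpace X] (e : C(Simp 1, X)) :
    Path (e (vert 0)) (e (vert 1)) where
  toFun t := e (stdSimplexHomeomorphUnitInterval.symm t)
  continuous_toFun := e.continuous.comp stdSimplexHomeomorphUnitInterval.symm.continuous
  source' := by
    rw [← stdSimplexHomeomorphUnitInterval_zero, Homeomorph.symm_apply_apply]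
  target' := by
    rw [← stdSimplexHomeomorphUnitInterval_one, Homeomorph.symm_apply_apply]

theorem simpPath_apply {X : Type} [TopologicalSpace X] (e : C(Simp 1, X)) (s : Simp 1)
    (t : unitInterval) (h : (t : ℝ) = s 1) : simpPath e t = e s := by
  have : t = stdSimplexHomeomorphUnitInterval s := Subtype.ext h
  change e (stdSimplexHomeomorphUnitInterval.symm t) = e s
  rw [this, Homeomorph.symm_apply_apply]

/-- In a simply connected space every triangle is the boundary of a singular `2`-simplex. -/
theorem exists_fill {X : Type} [TopologicalSpace X] [SimplyConnectedSpace X]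
    (e₀ e₁ e₂ : C(Simp 1, X)) (h₁ : e₂ (vert 1) = e₀ (vert 0)) (h₂ : e₁ (vert 1) = e₀ (vert 1))
    (h₀ : e₁ (vert 0) = e₂ (vert 0)) :
    ∃ τ : C(Simp 2, X), τ.comp (faceMap 0) = e₀ ∧ τ.comp (faceMap 1) = e₁ ∧
      τ.comp (faceMap 2) = e₂ := by
  -- A homotopy of paths from `e₂` followed by `e₀` to `e₁` is constant on the collapsed sides of the
  -- square, so it factors through the triangle.
  have hp : ((((simpPath e₂).cast rfl h₁.symm).trans (simpPath e₀))).Homotopic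
      ((simpPath e₁).cast h₀.symm h₂.symm) := SimplyConnectedSpace.paths_homotopic _ _
  obtain ⟨H⟩ := hp
  have hq : IsQuotientMap
      (⟨squareToSimp, continuous_squareToSimp⟩ : C(unitInterval × unitInterval, Simp 2)) :=
    IsQuotientMap.of_surjective_continuous surjective_squareToSimp continuous_squareToSimp
  have hfac : Function.FactorsThrough H.toContinuousMap
      (⟨squareToSimp, continuous_squareToSimp⟩ : C(unitInterval × unitInterval, Simp 2)) := by
    rintro ⟨s, t⟩ ⟨s', t'⟩ h
    obtain ⟨ht, h'⟩ := squareToSimp_eq h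
    simp only at ht h'
    subst ht
    rcases h' with rfl | rfl | rfl
    · rfl
    · exact (H.source s).trans (H.source s').symm
    · exact (H.target s).trans (H.target s').symm
  set τ := hq.lift H.toContinuousMap hfac with hτ
  have hval : ∀ s t, τ (squareToSimp (s, t)) = H (s, t) := fun s t =>
    DFunLike.congr_fun (hq.lift_comp H.toContinuousMap hfac) (s, t)
  have hsum : ∀ s : Simp 1, s 0 + s 1 = 1 := fun s => by
    rw [← Fin.sum_univ_two]; exact s.2.2
  have n0 : ∀ s : Simp 1, 0 ≤ s 0 := fun s => s.2.1 0
  have n1 : ∀ s : Simp 1, 0 ≤ s 1 := fun s => s.2.1 1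
  refine ⟨τ, ?_, ?_, ?_⟩ <;> ext1 s <;> rw [ContinuousMap.comp_apply]
  · have ht : (1 + s 1) / 2 ∈ Set.Icc (0 : ℝ) 1 := ⟨by linarith [n1 s], by linarith [n0 s, hsum s]⟩
    have e : faceMap 0 s = squareToSimp (0, ⟨(1 + s 1) / 2, ht⟩) := by
      refine Subtype.ext ((coe_faceMap_zero s).trans ?_)
      have hmin : min ((1 + s 1) / 2) (1 - (1 + s 1) / 2) = s 0 / 2 := by
        rw [min_eq_right (by linarith [n1 s])]; linarith [hsum s]
      simp only [squareToSimp, hmin]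
      ext i
      fin_cases i <;> simp <;> linarith [hsum s]
    rw [e, hval, H.apply_zero, Path.coe_toContinuousMap, Path.trans_apply]
    split_ifs with h
    · have h1 : s 1 = 0 := by simp only at h; linarith [n1 s]
      have hv : s = vert 0 := by
        refine Subtype.ext (funext fun i => ?_)
        fin_cases i
        · change s 0 = (1 : ℝ); linarith [hsum s]
        · exact h1
      refine Eq.trans ?_ (h₁.trans (congrArg e₀ hv.symm))
      refine simpPath_apply e₂ (vert 1) _ ?_
      change 2 * ((1 + s 1) / 2) = (1 : ℝ)
      rw [h1]; norm_num
    · exact simpPath_apply e₀ s _ (by simp; ring)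
  · have e : faceMap 1 s = squareToSimp (1, ⟨s 1, n1 s, by linarith [n0 s, hsum s]⟩) := by
      refine Subtype.ext ((coe_faceMap_one s).trans ?_)
      simp only [squareToSimp]
      ext i
      fin_cases i <;> simp <;> linarith [hsum s]
    rw [e, hval, H.apply_one]
    exact simpPath_apply e₁ s _ rfl
  · have ht : s 1 / 2 ∈ Set.Icc (0 : ℝ) 1 := ⟨by linarith [n1 s], by linarith [n0 s, n1 s, hsum s]⟩
    have e : faceMap 2 s = squareToSimp (0, ⟨s 1 / 2, ht⟩) := by
      refine Subtype.ext ((coe_faceMap_two s).trans ?_)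
      have hmin : min (s 1 / 2) (1 - s 1 / 2) = s 1 / 2 := by
        rw [min_eq_left (by linarith [n0 s, hsum s])]
      simp only [squareToSimp, hmin]
      ext i
      fin_cases i <;> simp <;> linarith [hsum s]
    rw [e, hval, H.apply_zero, Path.coe_toContinuousMap, Path.trans_apply, dif_pos (by
      simp only; linarith [n0 s, hsum s])]
    exact simpPath_apply e₂ s _ (by simp; ring)

/-! ### The first homology of `S³/G` with coefficients in `ℤ/2` -/

section

variable (G : Subgroup O4)

theorem surjective_proj : Function.Surjective (proj G) := Quotient.mk_surjective

variable {G} in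
/-- A sign character as a function with values in `ℤ/2`. -/
def signChar (ε : G →* ℤˣ) (γ : G) : ZMod 2 := if ε γ = 1 then 0 else 1

variable {G} in
theorem signChar_mul (ε : G →* ℤˣ) (γ δ : G) :
    signChar ε (γ * δ) = signChar ε γ + signChar ε δ := by
  simp only [signChar, map_mul]
  rcases Int.units_eq_one_or (ε γ) with h | h <;> rcases Int.units_eq_one_or (ε δ) with h' | h' <;>
    rw [h, h'] <;> decide

variable [IsCancelSMul G S3]

theorem smul_eq_self {γ : G} {x : S3} (h : (γ : O4) • x = x) : γ = 1 :=
  IsCancelSMul.right_cancel γ 1 x (h.trans (one_smul O4 x).symm)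

theorem smul_right_injective_G {γ δ : G} {x : S3} (h : (γ : O4) • x = (δ : O4) • x) : γ = δ :=
  IsCancelSMul.right_cancel γ δ x h

variable [Finite G]

/-- The covering map as a bundled continuous map. -/
def projMap : C(S3, Quot3 G) := ⟨proj G, (isQuotientCoveringMap_proj G).toIsQuotientMap.continuous⟩

/-- The action of an isometry as a bundled continuous map. -/
def smulMap (k : O4) : C(S3, S3) := ⟨fun x => k • x, continuous_const_smul k⟩

theorem projMap_comp_smulMap (γ : G) : (projMap G).comp (smulMap γ) = projMap G :=
  ContinuousMap.ext fun x => proj_smul G γ x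

theorem exists_projMap_lift {n : ℕ} (σ : C(Simp n, Quot3 G)) :
    ∃ F : C(Simp n, S3), (projMap G).comp F = σ := by
  obtain ⟨F, hF⟩ := exists_lift_of_contractible (isQuotientCoveringMap_proj G).isCoveringMap
    (surjective_proj G) σ
  exact ⟨F, ContinuousMap.ext hF⟩

/-- Two lifts of a singular simplex differ by an element of `G`. -/
theorem exists_smulMap_comp_eq {n : ℕ} {F F' : C(Simp n, S3)}
    (h : (projMap G).comp F = (projMap G).comp F') : ∃ γ : G, (smulMap γ).comp F = F' := by
  have h' : ∀ a, proj G (F a) = proj G (F' a) := fun a => DFunLike.congr_fun h a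
  obtain ⟨γ, hγ⟩ := (proj_eq_iff G).1 (h' (vert 0)).symm
  refine ⟨γ, DFunLike.coe_injective ((isQuotientCoveringMap_proj G).isCoveringMap.eq_of_comp_eq
    ((smulMap γ).comp F).continuous F'.continuous (funext fun a => ?_) (vert 0) hγ)⟩
  exact (proj_smul G γ (F a)).trans (h' a)

/-- Labels of the points of `S³` that change by the sign character under `G`: label a set of
representatives of the orbits by `0`. -/
theorem exists_equivariant_label (ε : G →* ℤˣ) :
    ∃ l : S3 → ZMod 2, ∀ (γ : G) x, l ((γ : O4) • x) = signChar ε γ + l x := by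
  have h : ∀ x, ∃ γ : G, (γ : O4) • Function.surjInv (surjective_proj G) (proj G x) = x := fun x =>
    (proj_eq_iff G).1 (Function.surjInv_eq (surjective_proj G) (proj G x)).symm
  choose c hc using h
  refine ⟨fun x => signChar ε (c x), fun γ x => ?_⟩
  have h1 : c ((γ : O4) • x) = γ * c x := by
    refine smul_right_injective_G G
      (x := Function.surjInv (surjective_proj G) (proj G ((γ : O4) • x))) ?_
    rw [hc, Subgroup.coe_mul, mul_smul, proj_smul, hc]
  simp only [h1, signChar_mul]

/-- A sign character of `G` defines a singular `1`-cocycle on `S³/G` that is nonzero on the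
projection of a path from `x` to `γ • x` if `γ` is not in the kernel. If the first homology
vanishes, there is no such `γ`. -/
theorem sign_character_trivial (h : Limits.IsZero (H1Mod2 (Quot3 G))) (ε : G →* ℤˣ) (γ : G) :
    ε γ = 1 := by
  obtain ⟨l, hl⟩ := exists_equivariant_label G ε
  -- the cocycle: the sum of the labels at the ends of any lift
  have hex : ∀ σ : C(Simp 1, Quot3 G), ∃ c : ZMod 2, ∀ F : C(Simp 1, S3), (projMap G).comp F = σ →
      c = l (F (vert 0)) + l (F (vert 1)) := by
    intro σ
    obtain ⟨F, hF⟩ := exists_projMap_lift G σ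
    refine ⟨l (F (vert 0)) + l (F (vert 1)), fun F' hF' => ?_⟩
    obtain ⟨δ, rfl⟩ := exists_smulMap_comp_eq G (hF.trans hF'.symm)
    simp only [ContinuousMap.comp_apply, smulMap, ContinuousMap.coe_mk, hl]
    linear_combination -(CharTwo.add_self_eq_zero (signChar ε δ))
  choose c hc using hex
  obtain ⟨φ, hφ⟩ := exists_chains_hom (X := Quot3 G) (n := 1) (T := F2) fun σ => c σ • 𝟙 F2
  have hcoc : (chains (Quot3 G)).d 2 1 ≫ φ = 0 := by
    refine chains_hom_ext fun τ => ?_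
    obtain ⟨F, hF⟩ := exists_projMap_lift G τ
    have hface : ∀ i, c (τ.comp (faceMap i)) =
        l (F (vert (i.succAbove 0))) + l (F (vert (i.succAbove 1))) := fun i => by
      rw [hc _ (F.comp (faceMap i)) (by rw [← hF]; rfl)]
      simp only [ContinuousMap.comp_apply, faceMap_vert]
    rw [← Category.assoc, two_simplex_d, Preadditive.add_comp, Preadditive.add_comp, hφ, hφ, hφ,
      ← add_smul, ← add_smul, hface, hface, hface, Limits.comp_zero]
    have e0 : (0 : Fin 3).succAbove (0 : Fin 2) = 1 := rfl
    have e1 : (0 : Fin 3).succAbove (1 : Fin 2) = 2 := rfl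
    have e2 : (1 : Fin 3).succAbove (0 : Fin 2) = 0 := rfl
    have e3 : (1 : Fin 3).succAbove (1 : Fin 2) = 2 := rfl
    have e4 : (2 : Fin 3).succAbove (0 : Fin 2) = 0 := rfl
    have e5 : (2 : Fin 3).succAbove (1 : Fin 2) = 1 := rfl
    rw [e0, e1, e2, e3, e4, e5]
    generalize l (F (vert 0)) = a
    generalize l (F (vert 1)) = b
    generalize l (F (vert 2)) = d
    have : b + d + (a + d) + (a + b) = 0 := by
      linear_combination CharTwo.add_self_eq_zero a + CharTwo.add_self_eq_zero b +
        CharTwo.add_self_eq_zero d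
    rw [this, zero_smul]
  -- the loop on which the cocycle takes the value `signChar ε γ`
  obtain ⟨path⟩ := joinedIn_S3 1 ((γ : O4) • (1 : S3))
  set F : C(Simp 1, S3) := path.toContinuousMap.comp
    ⟨stdSimplexHomeomorphUnitInterval, stdSimplexHomeomorphUnitInterval.continuous⟩ with hF
  have F0 : F (vert 0) = 1 := by
    change path (stdSimplexHomeomorphUnitInterval (vert 0)) = 1
    rw [stdSimplexHomeomorphUnitInterval_zero, path.source]
  have F1 : F (vert 1) = (γ : O4) • (1 : S3) := by
    change path (stdSimplexHomeomorphUnitInterval (vert 1)) = _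
    rw [stdSimplexHomeomorphUnitInterval_one, path.target]
  set σ := (projMap G).comp F with hσ
  have hfaces : σ.comp (faceMap 0) = σ.comp (faceMap 1) := by
    ext1 a
    rw [simp_zero_eq a]
    simp only [ContinuousMap.comp_apply, faceMap_vert, hσ]
    change proj G (F (vert 1)) = proj G (F (vert 0))
    rw [F0, F1, proj_smul]
  have hz : (chains (Quot3 G)).d 1 0 (single σ (1 : ZMod 2)) = 0 := by
    have h1 := one_simplex_d σ
    rw [hfaces, hom_add_self] at h1
    exact congrArg (fun f : F2 ⟶ (chains (Quot3 G)).X 0 => f (1 : ZMod 2)) h1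
  obtain ⟨w, hw⟩ := isZero_H1Mod2_iff.1 h _ hz
  have h2 : φ (single σ (1 : ZMod 2)) = 0 := by
    rw [← hw]
    exact congrArg (fun f : (chains (Quot3 G)).X 2 ⟶ F2 => f w) hcoc
  have h3 : φ (single σ (1 : ZMod 2)) = c σ • (1 : ZMod 2) :=
    congrArg (fun f : F2 ⟶ F2 => f (1 : ZMod 2)) (hφ σ)
  have h4 : c σ = 0 := by rw [h2] at h3; simpa using h3.symm
  rw [hc σ F rfl, F0, F1, hl] at h4
  have h5 : signChar ε γ = 0 := by
    linear_combination h4 - CharTwo.add_self_eq_zero (l 1)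
  by_contra hne
  rw [signChar, if_neg hne] at h5
  exact one_ne_zero h5

/-- If the order of `G` is odd, the first homology of `S³/G` vanishes. The transfer, which sends a
simplex to the sum of its lifts, and fillings of the triangles formed by the lifts and by paths from
a base point give a contracting homotopy of `|G|` times the identity in degree one. -/
theorem isZero_H1Mod2_of_odd (hodd : Odd (Nat.card G)) : Limits.IsZero (H1Mod2 (Quot3 G)) := by
  classical
  have : Fintype G := Fintype.ofFinite G
  have hpath : ∀ x : S3, ∃ e : C(Simp 1, S3), e (vert 0) = 1 ∧ e (vert 1) = x := fun x => by
    obtain ⟨path⟩ := joinedIn_S3 1 x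
    refine ⟨path.toContinuousMap.comp
      ⟨stdSimplexHomeomorphUnitInterval, stdSimplexHomeomorphUnitInterval.continuous⟩, ?_, ?_⟩
    · change path (stdSimplexHomeomorphUnitInterval (vert 0)) = 1
      rw [stdSimplexHomeomorphUnitInterval_zero, path.source]
    · change path (stdSimplexHomeomorphUnitInterval (vert 1)) = _
      rw [stdSimplexHomeomorphUnitInterval_one, path.target]
  choose e he0 he1 using hpath
  have hfill : ∀ F : C(Simp 1, S3), ∃ τ : C(Simp 2, S3), τ.comp (faceMap 0) = F ∧
      τ.comp (faceMap 1) = e (F (vert 1)) ∧ τ.comp (faceMap 2) = e (F (vert 0)) := fun F =>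
    exists_fill F (e (F (vert 1))) (e (F (vert 0))) (he1 _) (he1 _) ((he0 _).trans (he0 _).symm)
  choose τ hτ0 hτ1 hτ2 using hfill
  choose L hL using fun σ : C(Simp 1, Quot3 G) => exists_projMap_lift G σ
  choose L' hL' using surjective_proj G
  -- the sum of the projected paths from the base point to the points of a fibre
  set K : S3 → (F2 ⟶ (chains (Quot3 G)).X 1) := fun x =>
    ∑ γ : G, single ((projMap G).comp (e ((γ : O4) • x))) with hK
  have hKinv : ∀ (δ : G) x, K ((δ : O4) • x) = K x := by
    intro δ x
    simp only [hK, ← mul_smul, ← Subgroup.coe_mul]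
    exact Fintype.sum_equiv (Equiv.mulRight δ) _ _ fun γ => rfl
  obtain ⟨k, hk⟩ := exists_chains_hom (X := Quot3 G) (n := 0) (T := (chains (Quot3 G)).X 1)
    fun ν => K (L' (ν (vert 0)))
  obtain ⟨h, hh⟩ := exists_chains_hom (X := Quot3 G) (n := 1) (T := (chains (Quot3 G)).X 2)
    fun σ => ∑ γ : G, single ((projMap G).comp (τ ((smulMap γ).comp (L σ))))
  have hKL : ∀ x, K (L' (proj G x)) = K x := fun x => by
    obtain ⟨δ, hδ⟩ := (proj_eq_iff G).1 (hL' (proj G x))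
    rw [← hδ, hKinv]
  -- Coefficients are in `ℤ/2` and `|G|` is odd, so `|G|` times the identity is the identity.
  have hid : h ≫ (chains (Quot3 G)).d 2 1 + (chains (Quot3 G)).d 1 0 ≫ k = 𝟙 _ := by
    refine chains_hom_ext fun σ => ?_
    have hσ : ∀ a, proj G (L σ a) = σ a := fun a => DFunLike.congr_fun (hL σ) a
    have h1 : single σ ≫ h ≫ (chains (Quot3 G)).d 2 1 =
        ∑ _γ : G, single σ + K (L σ (vert 1)) + K (L σ (vert 0)) := by
      rw [← Category.assoc, hh, Preadditive.sum_comp, hK, ← Finset.sum_add_distrib,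
        ← Finset.sum_add_distrib]
      refine Finset.sum_congr rfl fun γ _ => ?_
      rw [two_simplex_d, ContinuousMap.comp_assoc, ContinuousMap.comp_assoc,
        ContinuousMap.comp_assoc, hτ0, hτ1, hτ2, ← ContinuousMap.comp_assoc, projMap_comp_smulMap,
        hL]
      rfl
    have h2 : single σ ≫ (chains (Quot3 G)).d 1 0 ≫ k =
        K (L σ (vert 1)) + K (L σ (vert 0)) := by
      rw [← Category.assoc, one_simplex_d, Preadditive.add_comp, hk, hk]
      simp only [ContinuousMap.comp_apply, faceMap_vert]
      rw [← hσ, ← hσ, hKL, hKL]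
      rfl
    have h3 : ∑ _γ : G, single σ = single σ := by
      obtain ⟨m, hm⟩ := hodd
      rw [Finset.sum_const, Finset.card_univ, ← Nat.card_eq_fintype_card, hm, add_smul, one_smul,
        mul_comm, mul_smul, two_smul, hom_add_self, smul_zero, zero_add]
    rw [Preadditive.comp_add, h1, h2, h3, Category.comp_id]
    generalize K (L σ (vert 1)) = a
    generalize K (L σ (vert 0)) = b
    have e1 : single σ + a + b + (a + b) = single σ + (a + a) + (b + b) := by abel
    rw [e1, hom_add_self, hom_add_self, add_zero, add_zero]
  rw [isZero_H1Mod2_iff]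
  intro z hz
  refine ⟨h z, ?_⟩
  have h1 := congrArg (fun f : (chains (Quot3 G)).X 1 ⟶ (chains (Quot3 G)).X 1 => f z) hid
  have h2 : (chains (Quot3 G)).d 2 1 (h z) + k ((chains (Quot3 G)).d 1 0 z) = z := h1
  rwa [hz, map_zero, add_zero] at h2

end

/-! ### Equivariant framing numbers of `S³/G` -/

section

variable {M : Type} [TopologicalSpace M] [ChartedSpace (EuclideanSpace ℝ (Fin 3)) M]
  [IsManifold (𝓡 3) ∞ M] {q : S3 → M} {K : Type*} [Group K] [Finite K]

/-- For a covering `q : S³ → M` invariant under a finite group `K` of left multiplications, the number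
of a framing pulled back from `M` is divisible by the order of the kernel of a sign character
of `K`. -/
theorem exists_framingNumber_of_left (hq : ContMDiff (𝓡 3) (𝓡 3) ∞ q)
    (hi : ∀ x, (mfderiv (𝓡 3) (𝓡 3) q x).IsInvertible) (ρ : K →* O4)
    (hfree : ∀ k (x : S3), ρ k • x = x → k = 1) (hρ : ∀ k, ∃ h, ρ k = phi (h, 1))
    (hinv : ∀ k x, q (ρ k • x) = q x) {X : FieldTriple M} (hX : IsOrientedFraming q X) :
    ∃ n : ℤ, (∀ m, HasFramingNumber (pullback q X) m ↔ m = n) ∧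
      ∃ ε : K →* ℤˣ, (Nat.card ε.ker : ℤ) ∣ n - 0 := by
  refine exists_framingNumber (isFraming_pullback hq hi hX.1) hX.2 ρ hfree (fun k => ?_)
    (hasDegree_const 1) fun k x => ?_
  · obtain ⟨h, hh⟩ := hρ k
    rw [hh]; exact det_phi_pos h 1
  · obtain ⟨h, hh⟩ := hρ k
    have h1 := fun a => ambient_pullback_smul hq hi (hinv k) X a x
    rw [hh] at h1 ⊢
    rw [transition_smul_left h1]
    rfl

/-- For right multiplications the number is congruent to `1`: here `P(x) adMatrix(x)⁻¹`, for the
transition map `P`, is invariant, and the identity of `S³` has degree `1`. -/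
theorem exists_framingNumber_of_right (hq : ContMDiff (𝓡 3) (𝓡 3) ∞ q)
    (hi : ∀ x, (mfderiv (𝓡 3) (𝓡 3) q x).IsInvertible) (ρ : K →* O4)
    (hfree : ∀ k (x : S3), ρ k • x = x → k = 1) (hρ : ∀ k, ∃ h, ρ k = phi (1, h))
    (hinv : ∀ k x, q (ρ k • x) = q x) {X : FieldTriple M} (hX : IsOrientedFraming q X) :
    ∃ n : ℤ, (∀ m, HasFramingNumber (pullback q X) m ↔ m = n) ∧
      ∃ ε : K →* ℤˣ, (Nat.card ε.ker : ℤ) ∣ n - 1 := by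
  refine exists_framingNumber (isFraming_pullback hq hi hX.1) hX.2 ρ hfree (fun k => ?_)
    hasDegree_id fun k x => ?_
  · obtain ⟨h, hh⟩ := hρ k
    rw [hh]; exact det_phi_pos 1 h
  · obtain ⟨h, hh⟩ := hρ k
    have h1 := fun a => ambient_pullback_smul hq hi (hinv k) X a x
    rw [hh] at h1 ⊢
    have h2 : phi (1, h) • x = x * h⁻¹ := Subtype.ext (by simp)
    have h3 : (adMatrix h)ᵀ * adMatrix h = 1 := mul_eq_one_comm.1 (adMatrix_mul_transpose h)
    rw [transition_smul_right h1, ContinuousMap.id_apply, ContinuousMap.id_apply, h2, adMatrix_mul,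
      adMatrix_inv, Matrix.transpose_mul, Matrix.transpose_transpose, Matrix.mul_assoc,
      ← Matrix.mul_assoc _ (adMatrix h), h3, Matrix.one_mul]

end

/-- The kernel of a sign character has index at most two. -/
theorem card_ker_sign {K : Type*} [Group K] [Finite K] (ε : K →* ℤˣ) :
    Nat.card K = Nat.card ε.ker ∨ Nat.card K = Nat.card ε.ker * 2 := by
  have h1 := ε.ker.card_mul_index
  have h2 : ε.ker.index ≤ 2 := by
    rw [Subgroup.index_ker]
    refine (Nat.card_le_card_of_injective _ Subtype.val_injective).trans ?_
    simp
  have h3 : ε.ker.index ≠ 0 := Subgroup.index_ne_zero_of_finite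
  have h4 : ε.ker.index = 1 ∨ ε.ker.index = 2 := by omega
  rcases h4 with h | h <;> rw [h] at h1 <;> omega

/-- The modulus `⟨G⟩` divides the order of the kernel of every sign character `ε` of `G`: if
`H₁(S³/G; ℤ/2) = 0` then `ε` is trivial, and otherwise `|G|` is even and the kernel has index at most
two. -/
theorem intCast_eq_of_card_ker_dvd (G : Subgroup O4) [Finite G] [IsCancelSMul G S3]
    (ε : G →* ℤˣ) {n d : ℤ} (h : (Nat.card ε.ker : ℤ) ∣ n - d) :
    (n : ZMod (framingModulus G)) = d := by
  rw [eq_comm, ZMod.intCast_eq_intCast_iff_dvd_sub]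
  refine dvd_trans ?_ h
  rw [Int.natCast_dvd_natCast, framingModulus]
  split_ifs with hz
  · have : ε.ker = ⊤ := by
      rw [eq_top_iff]
      exact fun γ _ => sign_character_trivial G hz ε γ
    rw [this, Subgroup.card_top]
  · have heven : ¬Odd (Nat.card G) := fun ho => hz (isZero_H1Mod2_of_odd G ho)
    rw [Nat.not_odd_iff_even] at heven
    obtain ⟨m, hm⟩ := heven
    rcases card_ker_sign ε with h1 | h1
    · exact ⟨2, by omega⟩
    · exact ⟨1, by omega⟩

theorem exists_phi_of_mem_left {g : O4} (hg : g ∈ leftMultiplications) : ∃ h, g = phi (h, 1) := by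
  obtain ⟨⟨a, b⟩, ⟨-, hb⟩, rfl⟩ := hg
  have hb' : b = 1 := Subgroup.mem_bot.1 hb
  exact ⟨a, by rw [hb']⟩

theorem exists_phi_of_mem_right {g : O4} (hg : g ∈ rightMultiplications) :
    ∃ h, g = phi (1, h) := by
  obtain ⟨⟨a, b⟩, ⟨ha, -⟩, rfl⟩ := hg
  have ha' : a = 1 := Subgroup.mem_bot.1 ha
  exact ⟨b, by rw [ha']⟩

section

variable (G : Subgroup O4) [Finite G] [IsCancelSMul G S3]

theorem equivariantFramingEq_left (hG : G ≤ leftMultiplications) :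
    EquivariantFramingEq (proj G) (framingModulus G) 0 := by
  refine ⟨?_, fun X hX => ?_⟩
  · obtain ⟨X, hX, hp⟩ := exists_framing_of_equivariant G isFraming_leftFrame fun γ a x => by
      obtain ⟨h, hh⟩ := exists_phi_of_mem_left (hG γ.2)
      rw [leftFrame_spec, leftFrame_spec, hh]
      simp [mul_assoc]
    exact ⟨X, hX, by rw [hp]; exact isPositive_leftFrame⟩
  · obtain ⟨n, hn, ε, hε⟩ := exists_framingNumber_of_left (contMDiff_proj G)
      (isInvertible_mfderiv_proj G) G.subtype (fun k x h => smul_eq_self G h)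
      (fun k => exists_phi_of_mem_left (hG k.2)) (proj_smul G) hX
    exact ⟨n, hn, by simpa using intCast_eq_of_card_ker_dvd G ε hε⟩

theorem equivariantFramingEq_right (hG : G ≤ rightMultiplications) :
    EquivariantFramingEq (proj G) (framingModulus G) 1 := by
  refine ⟨?_, fun X hX => ?_⟩
  · obtain ⟨X, hX, hp⟩ := exists_framing_of_equivariant G isFraming_rightFrame fun γ a x => by
      obtain ⟨h, hh⟩ := exists_phi_of_mem_right (hG γ.2)
      rw [ambient_rightFrame, ambient_rightFrame, hh]
      simp [mul_assoc]
    exact ⟨X, hX, by rw [hp]; exact isPositive_rightFrame⟩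
  · obtain ⟨n, hn, ε, hε⟩ := exists_framingNumber_of_right (contMDiff_proj G)
      (isInvertible_mfderiv_proj G) G.subtype (fun k x h => smul_eq_self G h)
      (fun k => exists_phi_of_mem_right (hG k.2)) (proj_smul G) hX
    exact ⟨n, hn, by simpa using intCast_eq_of_card_ker_dvd G ε hε⟩

end

/-! ### Orientation reversal -/

/-- The quaternions `1, i, j, k` span `ℍ`. -/
theorem eq_of_apply_imUnit {f g : ℍ[ℝ] →ₗ[ℝ] ℍ[ℝ]} (h1 : f 1 = g 1)
    (h : ∀ b, f (imUnit b) = g (imUnit b)) : f = g := by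
  ext1 x
  have hx : x = x.re • (1 : ℍ[ℝ]) + ∑ b, (inner ℝ (imUnit b) x : ℝ) • imUnit b := by
    have h2 : (x - x.re • (1 : ℍ[ℝ])).re = 0 := by simp
    have h3 := sum_inner_imUnit_smul h2
    have h4 : ∀ b, inner ℝ (imUnit b) (x - x.re • (1 : ℍ[ℝ])) = (inner ℝ (imUnit b) x : ℝ) := by
      intro b
      rw [inner_sub_right, inner_smul_right, inner_imUnit b 1]
      fin_cases b <;> simp
    simp only [h4] at h3
    rw [h3]
    abel
  rw [hx]
  simp only [map_add, map_smul, map_sum, h1, h]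

/-- An isometry of `ℍ` that fixes `1` is `x ↦ p x p⁻¹` or `x ↦ p x̄ p⁻¹`. -/
theorem exists_conj_of_fix_one (s : O4) (hs : s 1 = 1) :
    ∃ p : S3, (∀ x, s x = (p : ℍ[ℝ]) * x * ((p⁻¹ : S3) : ℍ[ℝ])) ∨
      ∀ x, s x = (p : ℍ[ℝ]) * star x * ((p⁻¹ : S3) : ℍ[ℝ]) := by
  have hre : ∀ w : ℍ[ℝ], inner ℝ (1 : ℍ[ℝ]) w = w.re := fun w => by
    rw [Quaternion.inner_def, one_mul, Quaternion.re_star]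
  have him : ∀ b, (s (imUnit b)).re = 0 := fun b => by
    rw [← hre, ← hs, s.inner_map_map, hre, imUnit_re]
  set N : Matrix (Fin 3) (Fin 3) ℝ := Matrix.of fun a b => inner ℝ (imUnit a) (s (imUnit b)) with hN
  have hsN : ∀ b, s (imUnit b) = ∑ a, N a b • imUnit a := fun b =>
    (sum_inner_imUnit_smul (him b)).symm
  have hNN : Nᵀ * N = 1 := by
    ext a b
    have h1 := s.inner_map_map (imUnit a) (imUnit b)
    rw [hsN b, inner_sum, inner_imUnit_imUnit] at h1
    rw [Matrix.one_apply, ← h1, Matrix.mul_apply]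
    refine Finset.sum_congr rfl fun c _ => ?_
    rw [inner_smul_right, real_inner_comm, Matrix.transpose_apply, mul_comm]
    rfl
  have hNN' : N * Nᵀ = 1 := mul_eq_one_comm.1 hNN
  have hdet : N.det = 1 ∨ N.det = -1 := by
    have h1 := congrArg Matrix.det hNN
    rw [Matrix.det_mul, Matrix.det_transpose, Matrix.det_one] at h1
    exact mul_self_eq_one_iff.1 h1
  have star_im : ∀ b, star (imUnit b) = -imUnit b := fun b =>
    QuaternionAlgebra.ext (by simp [imUnit_re]) (by simp) (by simp) (by simp)
  rcases hdet with h | h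
  · obtain ⟨p, hp⟩ := exists_adMatrix_eq hNN' h
    refine ⟨p, .inl fun x => ?_⟩
    refine LinearMap.congr_fun (f := (s.toLinearEquiv : ℍ[ℝ] →ₗ[ℝ] ℍ[ℝ]))
      (g := ((phi (p, p)).toLinearEquiv : ℍ[ℝ] →ₗ[ℝ] ℍ[ℝ])) (eq_of_apply_imUnit ?_ fun b => ?_) x
    · change s 1 = phi (p, p) 1
      rw [hs, phi_apply, mul_one, coe_mul_inv_S3]
    · change s (imUnit b) = phi (p, p) (imUnit b)
      rw [hsN, phi_apply, conj_imUnit, hp]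
  · obtain ⟨p, hp⟩ := exists_adMatrix_eq (M := -N) (by rw [Matrix.transpose_neg, neg_mul_neg, hNN'])
      (by rw [Matrix.det_neg, h]; norm_num)
    refine ⟨p, .inr fun x => ?_⟩
    have hlin := LinearMap.congr_fun (f := (s.toLinearEquiv : ℍ[ℝ] →ₗ[ℝ] ℍ[ℝ]))
      (g := ((phi (p, p)).toLinearEquiv : ℍ[ℝ] →ₗ[ℝ] ℍ[ℝ]) ∘ₗ
        { toFun := star
          map_add' := star_add
          map_smul' := fun c x => by simp })
      (eq_of_apply_imUnit ?_ fun b => ?_) x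
    · exact hlin
    · change s 1 = phi (p, p) (star 1)
      rw [hs, star_one, phi_apply, mul_one, coe_mul_inv_S3]
    · change s (imUnit b) = phi (p, p) (star (imUnit b))
      rw [hsN, star_im, map_neg, phi_apply, conj_imUnit, hp]
      simp

/-- An orientation-reversing isometry of `ℍ` is `x ↦ a x̄ b` for unit quaternions `a` and `b`. -/
theorem exists_eq_mul_star_mul {r : O4} (hr : LinearMap.det (r : ℍ[ℝ] →ₗ[ℝ] ℍ[ℝ]) < 0) :
    ∃ a b : S3, ∀ x, r x = (a : ℍ[ℝ]) * star x * (b : ℍ[ℝ]) := by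
  set a : S3 := r • 1 with ha
  have ha' : (a : ℍ[ℝ]) = r 1 := rfl
  obtain ⟨p, hp⟩ := exists_conj_of_fix_one (phi (a⁻¹, 1) * r) (by
    change ((a⁻¹ : S3) : ℍ[ℝ]) * r 1 * (((1 : S3)⁻¹ : S3) : ℍ[ℝ]) = 1
    rw [← ha', coe_inv_mul_S3, inv_one, Metric.unitSphere.coe_one, mul_one])
  have hmul : ∀ x, r x = (a : ℍ[ℝ]) * (phi (a⁻¹, 1) * r) x := fun x => by
    change r x = (a : ℍ[ℝ]) * (((a⁻¹ : S3) : ℍ[ℝ]) * r x * (((1 : S3)⁻¹ : S3) : ℍ[ℝ]))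
    rw [inv_one, Metric.unitSphere.coe_one, mul_one, ← mul_assoc, coe_mul_inv_S3, one_mul]
  rcases hp with hp | hp
  · exfalso
    have h1 : r = phi (a * p, p) := by
      ext1 x
      rw [hmul, hp, phi_apply, Metric.unitSphere.coe_mul]
      simp only [mul_assoc]
    rw [h1] at hr
    exact lt_asymm hr (det_phi_pos _ _)
  · refine ⟨a * p, p⁻¹, fun x => ?_⟩
    rw [hmul, hp, Metric.unitSphere.coe_mul]
    simp only [mul_assoc]

/-- Reversing the orientation turns left multiplications into right multiplications. -/
theorem exists_conj_phi {r : O4} (hr : LinearMap.det (r : ℍ[ℝ] →ₗ[ℝ] ℍ[ℝ]) < 0) (h : S3) :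
    ∃ h', r⁻¹ * phi (h, 1) * r = phi (1, h') := by
  obtain ⟨a, b, hab⟩ := exists_eq_mul_star_mul hr
  refine ⟨a⁻¹ * h * a, ?_⟩
  rw [mul_assoc, inv_mul_eq_iff_eq_mul]
  ext1 x
  change phi (h, 1) (r x) = r (phi (1, a⁻¹ * h * a) x)
  rw [hab, hab, phi_apply, phi_apply, coe_inv_S3 (a⁻¹ * h * a), star_mul, star_mul, star_star,
    Metric.unitSphere.coe_mul, Metric.unitSphere.coe_mul, Metric.unitSphere.coe_one, star_one,
    mul_one, inv_one, Metric.unitSphere.coe_one, mul_one]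
  simp only [← mul_assoc, coe_mul_inv_S3, one_mul]

/-- After an orientation reversal the group acts by right multiplications, so the number of a pulled
back framing is congruent to `1` modulo the order of the kernel of a sign character. That kernel is
nontrivial because `|G| > 2`, so the number is not `0`. -/
theorem not_framingHomotopic_leftFrame (G : Subgroup O4) [Finite G] [IsCancelSMul G S3]
    (hG : G ≤ leftMultiplications) (hcard : 2 < Nat.card G) {r : O4}
    (hr : LinearMap.det (r : ℍ[ℝ] →ₗ[ℝ] ℍ[ℝ]) < 0) {X : FieldTriple (Quot3 G)}
    (hX : IsOrientedFraming (fun x => proj G (r • x)) X) :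
    ¬ FramingHomotopic (pullback (fun x => proj G (r • x)) X) leftFrame := by
  intro hhom
  set ρ : G →* O4 := (MulAut.conj r⁻¹).toMonoidHom.comp G.subtype with hρ
  have hρk : ∀ k : G, ρ k = r⁻¹ * k * r := fun k => by simp [hρ]
  have hsm : ∀ (k : G) (x : S3), r • ρ k • x = (k : O4) • r • x := fun k x => by
    rw [hρk, smul_smul, smul_smul]
    congr 1
    group
  obtain ⟨n, hn, ε, hε⟩ := exists_framingNumber_of_right (contMDiff_proj_smul G r)
    (isInvertible_mfderiv_proj_smul G r) ρ (fun k x h => smul_eq_self G (x := r • x) (by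
      rw [← hsm, h])) (fun k => by
        obtain ⟨h, hh⟩ := exists_phi_of_mem_left (hG k.2)
        rw [hρk, hh]
        exact exists_conj_phi hr h) (fun k x => by rw [hsm, proj_smul]) hX
  have h0 : (0 : ℤ) = n := (hn 0).1 (hasFramingNumber_zero_of_homotopic_leftFrame hhom)
  rw [← h0, zero_sub, dvd_neg, Int.natCast_dvd_ofNat] at hε
  have h1 : Nat.card ε.ker = 1 := Nat.dvd_one.1 hε
  rcases card_ker_sign ε with h2 | h2 <;> omega

end EquivFraming

end

theorem mainTheorem7 (G : Subgroup EquivFraming.O4) [Finite G] [IsCancelSMul G EquivFraming.S3] :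
    (G ≤ EquivFraming.leftMultiplications →
      EquivFraming.EquivariantFramingEq (EquivFraming.proj G) (EquivFraming.framingModulus G) 0) ∧
    (G ≤ EquivFraming.rightMultiplications →
      EquivFraming.EquivariantFramingEq (EquivFraming.proj G) (EquivFraming.framingModulus G) 1) ∧
    (G ≤ EquivFraming.leftMultiplications → 2 < Nat.card G →
      ∀ r : EquivFraming.O4, LinearMap.det (r : ℍ[ℝ] →ₗ[ℝ] ℍ[ℝ]) < 0 →
        ∀ X : EquivFraming.FieldTriple (EquivFraming.Quot3 G),
          EquivFraming.IsOrientedFraming (fun x => EquivFraming.proj G (r • x)) X →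
          ¬ EquivFraming.FramingHomotopic
              (EquivFraming.pullback (fun x => EquivFraming.proj G (r • x)) X)
              EquivFraming.leftFrame) :=
  ⟨EquivFraming.equivariantFramingEq_left G, EquivFraming.equivariantFramingEq_right G,
    fun hG hcard _ hr _ hX => EquivFraming.not_framingHomotopic_leftFrame G hG hcard hr hX⟩
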